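/- **Theorem 3.3 (local monotonicity formula for the Yang–Mills–Higgs flow).** *Setting.* Let $n>4$. Let $G$ be a connected compact finite-dimensional semisimple Lie group with Lie algebra $(\mathfrak g,[\cdot,\cdot])$, equipped with the negative Killing form $\langle A,B\rangle=-\operatorname{tr}(\operatorname{ad}_A\circ\operatorname{ad}_B)$. Let $\rho$ be a smooth representation of $G$ on a finite-dimensional real inner product space $V$ whose inner product is $\rho$-invariant, let $X\cdot v$ denote the action of $\mathfrak g$ on $V$ obtained by differentiating $\rho$ at the identity, and let $\odot:V\times V\to\mathfrak g$ be the unique bilinear map with $\langle X,v\odot w\rangle=\langle X\cdot v,w\rangle$ for all $X\in\mathfrak g$, $v,w\in V$. Let $W\in C^1(\mathbb R,[0,\infty))$. For $A=(A_1,\dots,A_n)$ with $A_i:\mathbb R^n\to\mathfrak g$, and $u:\mathbb R^n\to V$, put $$F_{ij}=\partial_iA_j-\partial_jA_i+[A_i,A_j],\qquad \nabla_i\xi=\partial_i\xi+[A_i,\xi]\ (\xi\ \mathfrak g\text{-valued}),\qquad \nabla_iu=\partial_iu+A_i\cdot u,$$ $$e(A,u)=\tfrac12\Big(\sum_{i<j}|F_{ij}|^2+\sum_i|\nabla_iu|^2\Big)+W(|u|^2).$$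 A family $(A(\cdot,t),u(\cdot,t))_{t\in[a,T)}$, smooth on $\mathbb R^n\times[a,T)$, *evolves by the Yang–Mills–Higgs flow* if on $\mathbb R^n\times(a,T)$ $$\partial_tA_j=\sum_i\nabla_iF_{ij}-u\odot\nabla_ju,\qquad \partial_tu=\sum_i\nabla_i\nabla_iu-2W'(|u|^2)\,u .$$ Fix $X\in\mathbb R^n$ and put $$S^A_j=\partial_tA_j+\sum_i\frac{(x-X)^i}{2(t-T)}F_{ij},\qquad J^u=\partial_tu+\sum_i\frac{(x-X)^i}{2(t-T)}\nabla_iu,\qquad c_n=\sqrt{\frac{n-4}{2\pi e}},$$ $$\Phi(x,t)=\frac1{(4\pi(T-t))^{(n-4)/2}}\exp\Big(\frac{|x-X|^2}{4(t-T)}\Big),\qquad E_r(X,T)=\{(x,t)\in\mathbb R^n\times(-\infty,T):\Phi(x,t)>r^{4-n}\}.$$ *Theorem.* Suppose $(A,u)$ evolves by the Yang–Mills–Higgs flow on $[a,T)$ and that $e(A,u)\in L^1\big(B_{2c_nr_0}(X)\times(T-\tfrac{r_0^2}{4\pi},T)\big)$ for some $0<r_0\le\sqrt{4\pi(T-a)}$.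 Then for every $r\in(0,r_0)$ the two integrands below are integrable over $E_r(X,T)$, the function of $r$ on the left is differentiable, and $$\frac{d}{dr}\left(\frac1{r^{n-4}}\iint_{E_r(X,T)}\Big(e(A,u)\,\frac{n-4}{2(T-t)}-\sum_j\Big\langle\sum_i\frac{(x-X)^i}{2(t-T)}F_{ij},S^A_j\Big\rangle-\Big\langle\sum_i\frac{(x-X)^i}{2(t-T)}\nabla_iu,J^u\Big\rangle\Big)dx\,dt\right)$$ $$=\frac{n-4}{r^{n-3}}\iint_{E_r(X,T)}\left(\frac{\sum_i|\nabla_iu|^2+4W(|u|^2)}{2(T-t)}+\sum_j|S^A_j|^2+|J^u|^2\right)dx\,dt\ \ge\ 0 .$$ -/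

import Mathlib

open scoped Manifold ContDiff
open MeasureTheory Set

noncomputable section

/-- A smooth real Lie group is regular enough for Mathlib's Lie algebra of a Lie group. -/
instance instLieGroupMinSmoothness {E : Type*} [NormedAddCommGroup E] [NormedSpace ℝ E]
    {G : Type*} [TopologicalSpace G] [ChartedSpace E G] [Group G] [LieGroup 𝓘(ℝ, E) ∞ G] :
    LieGroup 𝓘(ℝ, E) (minSmoothness ℝ 3) G := by
  rw [minSmoothness_of_isRCLikeNormedField]
  infer_instance

namespace YMH

/-! Throughout, `G` is a Lie group modelled on `E`. Its Lie algebra is Mathlib's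
`GroupLieAlgebra 𝓘(ℝ, E) G`, the tangent space at the identity; as a vector space this is `E` by
definition. Lie-algebra-valued functions are written as `E`-valued functions, so that they can be
differentiated; the bracket and the inner product come from `GroupLieAlgebra 𝓘(ℝ, E) G`.

A point of space-time is a pair `(x, t)` with `x` in Euclidean `n`-space and `t` real. -/

/-- Space-time `ℝⁿ × ℝ`. -/
abbrev Spacetime (n : ℕ) : Type := EuclideanSpace ℝ (Fin n) × ℝ

section LieGroup

variable {E : Type*} [NormedAddCommGroup E] [NormedSpace ℝ E] [FiniteDimensional ℝ E]
  (G : Type*) [TopologicalSpace G] [ChartedSpace E G] [Group G] [LieGroup 𝓘(ℝ, E) ∞ G]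

/-- The bracket `[X, Y]` of the Lie algebra of `G`. -/
def lieBr (X Y : E) : E :=
  Bracket.bracket (L := GroupLieAlgebra 𝓘(ℝ, E) G) (M := GroupLieAlgebra 𝓘(ℝ, E) G) X Y

/-- The negative Killing form `⟨X, Y⟩ = -tr (ad X ∘ ad Y)` of the Lie algebra of `G`. -/
def lieInner (X Y : E) : ℝ :=
  -killingForm ℝ (GroupLieAlgebra 𝓘(ℝ, E) G) (X : GroupLieAlgebra 𝓘(ℝ, E) G)
    (Y : GroupLieAlgebra 𝓘(ℝ, E) G)

/-- `|X|² = ⟨X, X⟩` on the Lie algebra of `G`. -/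
def lieNormSq (X : E) : ℝ := lieInner G X X

variable {G}
variable {V : Type*} [NormedAddCommGroup V] [InnerProductSpace ℝ V] [FiniteDimensional ℝ V]

/-- The action `X · v` of the Lie algebra of `G` on `V`: the derivative of the representation
`ρ` at the identity. -/
def act (ρ : G →* (V →L[ℝ] V)) (X : E) (v : V) : V :=
  (show V →L[ℝ] V from
    mfderiv 𝓘(ℝ, E) 𝓘(ℝ, V →L[ℝ] V) (fun g : G => ρ g) 1 (X : GroupLieAlgebra 𝓘(ℝ, E) G)) v

/-- The unique bilinear map `⊙ : V × V → 𝔤` with `⟨X, v ⊙ w⟩ = ⟨X · v, w⟩` for all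
`X ∈ 𝔤` and `v, w ∈ V`. -/
def odot (ρ : G →* (V →L[ℝ] V)) : V →ₗ[ℝ] V →ₗ[ℝ] E :=
  Classical.epsilon fun B : V →ₗ[ℝ] V →ₗ[ℝ] E =>
    ∀ (X : E) (v w : V), lieInner G X (B v w) = inner ℝ (act ρ X v) w

end LieGroup

section Calculus

variable {n : ℕ} {F : Type*} [NormedAddCommGroup F] [NormedSpace ℝ F]

/-- The spatial partial derivative `∂ᵢ f` at the space-time point `p`. -/
def dx (i : Fin n) (f : Spacetime n → F) (p : Spacetime n) : F :=
  lineDeriv ℝ f p (EuclideanSpace.single i 1, 0)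

/-- The time derivative `∂ₜ f` at the space-time point `p`. -/
def dt (f : Spacetime n → F) (p : Spacetime n) : F :=
  lineDeriv ℝ f p (0, 1)

end Calculus

section Fields

variable {n : ℕ} {E : Type*} [NormedAddCommGroup E] [NormedSpace ℝ E] [FiniteDimensional ℝ E]
  (G : Type*) [TopologicalSpace G] [ChartedSpace E G] [Group G] [LieGroup 𝓘(ℝ, E) ∞ G]

/-- The gauge-covariant partial derivative `∇ᵢ ξ = ∂ᵢ ξ + [Aᵢ, ξ]` of a `𝔤`-valued function. -/
def covG (A : Fin n → Spacetime n → E) (i : Fin n) (ξ : Spacetime n → E) (p : Spacetime n) : E :=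
  dx i ξ p + lieBr G (A i p) (ξ p)

/-- The curvature `Fᵢⱼ = ∂ᵢ Aⱼ - ∂ⱼ Aᵢ + [Aᵢ, Aⱼ]`. -/
def curv (A : Fin n → Spacetime n → E) (i j : Fin n) (p : Spacetime n) : E :=
  dx i (A j) p - dx j (A i) p + lieBr G (A i p) (A j p)

/-- `∑ᵢ (x - X)ⁱ / (2 (t - T)) Fᵢⱼ`. -/
def radialCurv (X : EuclideanSpace ℝ (Fin n)) (T : ℝ) (A : Fin n → Spacetime n → E) (j : Fin n)
    (p : Spacetime n) : E :=
  ∑ i, ((p.1 i - X i) / (2 * (p.2 - T))) • curv G A i j p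

/-- `Sⱼ = ∂ₜ Aⱼ + ∑ᵢ (x - X)ⁱ / (2 (t - T)) Fᵢⱼ`. -/
def SA (X : EuclideanSpace ℝ (Fin n)) (T : ℝ) (A : Fin n → Spacetime n → E) (j : Fin n)
    (p : Spacetime n) : E :=
  dt (A j) p + radialCurv G X T A j p

variable {G}
variable {V : Type*} [NormedAddCommGroup V] [InnerProductSpace ℝ V] [FiniteDimensional ℝ V]
  (ρ : G →* (V →L[ℝ] V))

/-- The gauge-covariant partial derivative `∂ᵢ u + Aᵢ · u` of a `V`-valued function. -/
def covV (A : Fin n → Spacetime n → E) (i : Fin n) (u : Spacetime n → V) (p : Spacetime n) : V :=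
  dx i u p + act ρ (A i p) (u p)

/-- `∑ᵢ (x - X)ⁱ / (2 (t - T)) ∇ᵢ u`. -/
def radialCovV (X : EuclideanSpace ℝ (Fin n)) (T : ℝ) (A : Fin n → Spacetime n → E)
    (u : Spacetime n → V) (p : Spacetime n) : V :=
  ∑ i, ((p.1 i - X i) / (2 * (p.2 - T))) • covV ρ A i u p

/-- `J = ∂ₜ u + ∑ᵢ (x - X)ⁱ / (2 (t - T)) ∇ᵢ u`. -/
def Ju (X : EuclideanSpace ℝ (Fin n)) (T : ℝ) (A : Fin n → Spacetime n → E)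
    (u : Spacetime n → V) (p : Spacetime n) : V :=
  dt u p + radialCovV ρ X T A u p

/-- The energy density
`e(A, u) = (1/2) (∑_{i<j} |Fᵢⱼ|² + ∑ᵢ |∇ᵢ u|²) + W(|u|²)`. -/
def energyDensity (W : ℝ → ℝ) (A : Fin n → Spacetime n → E) (u : Spacetime n → V)
    (p : Spacetime n) : ℝ :=
  (1 / 2) * ((∑ i, ∑ j ∈ Finset.Ioi i, lieNormSq G (curv G A i j p)) + ∑ i, ‖covV ρ A i u p‖ ^ 2)
    + W (‖u p‖ ^ 2)

/-- The family of pairs `(A(·, t), u(·, t))`, `t ∈ [a, b)`, is smooth and evolves by the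
Yang–Mills–Higgs flow with potential `W`. -/
structure IsYMHFlow (W : ℝ → ℝ) (A : Fin n → Spacetime n → E) (u : Spacetime n → V)
    (a b : ℝ) : Prop where
  smooth_gauge : ∀ i, ContDiffOn ℝ ∞ (A i) (univ ×ˢ Ico a b)
  smooth_scalar : ContDiffOn ℝ ∞ u (univ ×ˢ Ico a b)
  gauge_eq : ∀ p ∈ (univ ×ˢ Ioo a b : Set (Spacetime n)), ∀ j,
    dt (A j) p = ∑ i, covG G A i (curv G A i j) p - odot ρ (u p) (covV ρ A j u p)
  scalar_eq : ∀ p ∈ (univ ×ˢ Ioo a b : Set (Spacetime n)),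
    dt u p = ∑ i, covV ρ A i (covV ρ A i u) p - (2 * deriv W (‖u p‖ ^ 2)) • u p

/-- The integrand on the left-hand side of the local monotonicity formula. -/
def lhsIntegrand (W : ℝ → ℝ) (X : EuclideanSpace ℝ (Fin n)) (T : ℝ)
    (A : Fin n → Spacetime n → E) (u : Spacetime n → V) (p : Spacetime n) : ℝ :=
  energyDensity ρ W A u p * (((n : ℝ) - 4) / (2 * (T - p.2)))
    - ∑ j, lieInner G (radialCurv G X T A j p) (SA G X T A j p)
    - inner ℝ (radialCovV ρ X T A u p) (Ju ρ X T A u p)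

/-- The integrand on the right-hand side of the local monotonicity formula. -/
def rhsIntegrand (W : ℝ → ℝ) (X : EuclideanSpace ℝ (Fin n)) (T : ℝ)
    (A : Fin n → Spacetime n → E) (u : Spacetime n → V) (p : Spacetime n) : ℝ :=
  ((∑ i, ‖covV ρ A i u p‖ ^ 2) + 4 * W (‖u p‖ ^ 2)) / (2 * (T - p.2))
    + (∑ j, lieNormSq G (SA G X T A j p)) + ‖Ju ρ X T A u p‖ ^ 2

end Fields

section HeatBall

variable {n : ℕ}

/-- The weighted backward heat kernel
`Φ(x, t) = (4π (T - t))^(-(n-4)/2) exp (|x - X|² / (4 (t - T)))`, of interest for `t < T`. -/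
def heatKernel (X : EuclideanSpace ℝ (Fin n)) (T : ℝ) (p : Spacetime n) : ℝ :=
  1 / (4 * Real.pi * (T - p.2)) ^ (((n : ℝ) - 4) / 2)
    * Real.exp (‖p.1 - X‖ ^ 2 / (4 * (p.2 - T)))

/-- The weighted heat ball `E_r(X, T)`. -/
def heatBall (X : EuclideanSpace ℝ (Fin n)) (T r : ℝ) : Set (Spacetime n) :=
  {p | p.2 < T ∧ 1 / r ^ ((n : ℝ) - 4) < heatKernel X T p}

/-- The constant `cₙ = √((n - 4) / (2πe))`. -/
def cConst (n : ℕ) : ℝ := √(((n : ℝ) - 4) / (2 * Real.pi * Real.exp 1))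

end HeatBall

end YMH

end

/-! Write `m = n - 4`, `τ = T - t`, `y = x - X`, `Ψ = log Φ` and `ν = ∇Ψ = -y/(2τ)`.

The analysis uses the flow only through two balance laws for the energy density `e`. Let `K = |∂ₜA|²
+ |∂ₜu|²`, `Pᵢ = ∑ₖ⟨Fᵢₖ, ∂ₜAₖ⟩ + ⟨∇ᵢu, ∂ₜu⟩`, `Qᵢⱼ = ∑ₖ⟨Fᵢₖ, Fⱼₖ⟩ + ⟨∇ᵢu, ∇ⱼu⟩` and `w = |∇u|² +
4W`. Then `∂ₜe = div P - K` and `∑ᵢ∂ᵢQᵢⱼ - ∂ⱼe = Pⱼ`; moreover `tr Q = 4e - w`, and `s²K + 2s v·P +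
Q(v,v)` is a sum of squares. Both laws are instances of one identity, `GaugeAlgebra.div_stress`,
which rests on the Bianchi identity and the commutator of covariant derivatives. `isStressBalance`
collects these facts.

The squares are nonnegative because the Lie algebra of a compact group carries an `Ad`-invariant
inner product (a Haar average). For it every `ad x` is skew, so `tr (ad x)² ≤ 0`; semisimplicity
makes the form definite, which also yields `⊙`. The bracket is defined through left-invariant
fields, so it is first identified with the antisymmetrised Hessian of the multiplication in a chart.
From this follow `d Ad = ad` and the homomorphism property of `dρ`.

The heart is to test the energy law with `η` and to add a multiple of the dilation identity `div (Qy
- ey) = P·y - (m e + w)`. For `η = f(m log r + Ψ)` and the multiple `-1/(2τ)` the terms in `|ν|²`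
cancel. With `L` and `D` the left and right integrands of the theorem, the time derivative of `∫ eη`
becomes `∫ f' L - f (L + D)`. Integration in time gives `∫ f' L = ∫ f (L + D)`. Letting `f` tend to
a difference of two positive parts yields `d/dr ∫_{E_r} L = (m/r) ∫_{E_r} (L + D)`. The derivative
of `r⁻ᵐ` then removes the `L` term and leaves `m r⁻ᵐ⁻¹ ∫_{E_r} D`, where `D ≥ 0`.

The difficulty is the final time, where only `e ∈ L¹` is known. A cut-off argument gives `K ∈ L¹`
(`integrableOn_K`). A localised weighted-energy estimate bounds `∫ e Φ`, uniformly over kernels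
whose singular time is `T' ≥ T` (`exists_integral_exp_logKernel_le`). In a heat ball `|x - X|² ≤ C
τ^(3/4)`, so taking `T' - t` comparable to `τ^(3/4)` shows that the energy of its slice is
`O(τ^(3/8))`. This removes the boundary term at `T` and makes `e|ν|²` and `e/τ` integrable. -/

noncomputable section

namespace YMH

/-! ### The group law in a chart, and the bracket as its antisymmetrised Hessian -/

section GroupChart

open Filter Topology

variable {E : Type*} [NormedAddCommGroup E] [NormedSpace ℝ E]
  (G : Type*) [TopologicalSpace G] [ChartedSpace E G] [Group G] [LieGroup 𝓘(ℝ, E) ∞ G]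

/-- The coordinates of the identity in the preferred chart. -/
def oneCoord : E := extChartAt 𝓘(ℝ, E) (1 : G) (1 : G)

/-- The multiplication of `G` read in the preferred chart at the identity. -/
def mulCoord (p : E × E) : E :=
  extChartAt 𝓘(ℝ, E) (1 : G) ((extChartAt 𝓘(ℝ, E) (1 : G)).symm p.1 *
    (extChartAt 𝓘(ℝ, E) (1 : G)).symm p.2)

/-- The conjugation `g h g⁻¹` of `G` read in the preferred chart at the identity. -/
def conjCoord (p : E × E) : E :=
  extChartAt 𝓘(ℝ, E) (1 : G) ((extChartAt 𝓘(ℝ, E) (1 : G)).symm p.1 *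
    (extChartAt 𝓘(ℝ, E) (1 : G)).symm p.2 * ((extChartAt 𝓘(ℝ, E) (1 : G)).symm p.1)⁻¹)

omit [LieGroup 𝓘(ℝ, E) ∞ G] in
lemma chart_symm_oneCoord : (extChartAt 𝓘(ℝ, E) (1 : G)).symm (oneCoord G) = 1 :=
  extChartAt_to_inv (1 : G)

omit [LieGroup 𝓘(ℝ, E) ∞ G] in
lemma target_mem_nhds_oneCoord :
    (extChartAt 𝓘(ℝ, E) (1 : G)).target ∈ 𝓝 (oneCoord G : E) :=
  extChartAt_target_mem_nhds (1 : G)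

lemma contMDiffAt_chart_symm {n : ℕ∞ω} (hn : n ≤ ∞) :
    ContMDiffAt 𝓘(ℝ, E) 𝓘(ℝ, E) n (extChartAt 𝓘(ℝ, E) (1 : G)).symm (oneCoord G) := by
  have : ContMDiffAt 𝓘(ℝ, E) 𝓘(ℝ, E) ∞ (extChartAt 𝓘(ℝ, E) (1 : G)).symm (oneCoord G) :=
    have : IsManifold 𝓘(ℝ, E) ∞ G := LieGroup.toContMDiffMul.toIsManifold
    (contMDiffOn_extChartAt_symm (n := ∞) (1 : G)).contMDiffAt (target_mem_nhds_oneCoord G)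
  exact this.of_le hn

lemma contDiffAt_mulCoord : ContDiffAt ℝ ∞ (mulCoord G) ((oneCoord G : E), oneCoord G) := by
  apply ContMDiffAt.contDiffAt
  have h1 : ContMDiffAt (𝓘(ℝ, E × E)) 𝓘(ℝ, E) ∞
      (fun p : E × E => (extChartAt 𝓘(ℝ, E) (1 : G)).symm p.1) (oneCoord G, oneCoord G) :=
    ContMDiffAt.comp (I' := 𝓘(ℝ, E)) _ (contMDiffAt_chart_symm G le_rfl)
      contDiff_fst.contMDiff.contMDiffAt
  have h2 : ContMDiffAt (𝓘(ℝ, E × E)) 𝓘(ℝ, E) ∞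
      (fun p : E × E => (extChartAt 𝓘(ℝ, E) (1 : G)).symm p.2) (oneCoord G, oneCoord G) :=
    ContMDiffAt.comp (I' := 𝓘(ℝ, E)) _ (contMDiffAt_chart_symm G le_rfl)
      contDiff_snd.contMDiff.contMDiffAt
  have h3 := h1.mul h2
  refine ContMDiffAt.comp (I' := 𝓘(ℝ, E)) (g := extChartAt 𝓘(ℝ, E) (1 : G)) _ ?_ h3
  simp only [chart_symm_oneCoord, mul_one]
  have : IsManifold 𝓘(ℝ, E) ∞ G := LieGroup.toContMDiffMul.toIsManifold
  exact contMDiffAt_extChartAt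

lemma contDiffAt_conjCoord : ContDiffAt ℝ ∞ (conjCoord G) ((oneCoord G : E), oneCoord G) := by
  apply ContMDiffAt.contDiffAt
  have h1 : ContMDiffAt (𝓘(ℝ, E × E)) 𝓘(ℝ, E) ∞
      (fun p : E × E => (extChartAt 𝓘(ℝ, E) (1 : G)).symm p.1) (oneCoord G, oneCoord G) :=
    ContMDiffAt.comp (I' := 𝓘(ℝ, E)) _ (contMDiffAt_chart_symm G le_rfl)
      contDiff_fst.contMDiff.contMDiffAt
  have h2 : ContMDiffAt (𝓘(ℝ, E × E)) 𝓘(ℝ, E) ∞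
      (fun p : E × E => (extChartAt 𝓘(ℝ, E) (1 : G)).symm p.2) (oneCoord G, oneCoord G) :=
    ContMDiffAt.comp (I' := 𝓘(ℝ, E)) _ (contMDiffAt_chart_symm G le_rfl)
      contDiff_snd.contMDiff.contMDiffAt
  have h3 := (h1.mul h2).mul h1.inv
  refine ContMDiffAt.comp (I' := 𝓘(ℝ, E)) (g := extChartAt 𝓘(ℝ, E) (1 : G)) _ ?_ h3
  simp only [chart_symm_oneCoord, mul_one, inv_one]
  have : IsManifold 𝓘(ℝ, E) ∞ G := LieGroup.toContMDiffMul.toIsManifold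
  exact contMDiffAt_extChartAt

omit [LieGroup 𝓘(ℝ, E) ∞ G] in
lemma mulCoord_one_left : ∀ᶠ y in 𝓝 (oneCoord G : E), mulCoord G (oneCoord G, y) = y := by
  filter_upwards [target_mem_nhds_oneCoord (E := E) G] with y hy
  simp only [mulCoord, chart_symm_oneCoord, one_mul]
  exact (extChartAt 𝓘(ℝ, E) (1 : G)).right_inv hy

omit [LieGroup 𝓘(ℝ, E) ∞ G] in
lemma mulCoord_one_right : ∀ᶠ y in 𝓝 (oneCoord G : E), mulCoord G (y, oneCoord G) = y := by
  filter_upwards [target_mem_nhds_oneCoord (E := E) G] with y hy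
  simp only [mulCoord, chart_symm_oneCoord, mul_one]
  exact (extChartAt 𝓘(ℝ, E) (1 : G)).right_inv hy

/-- Products of elements near the identity stay in the chart domain, so there the coordinate law
loses no information. -/
lemma eventually_symm_mulCoord :
    ∀ᶠ p in 𝓝 ((oneCoord G : E), (oneCoord G : E)),
      (extChartAt 𝓘(ℝ, E) (1 : G)).symm (mulCoord G p) =
        (extChartAt 𝓘(ℝ, E) (1 : G)).symm p.1 * (extChartAt 𝓘(ℝ, E) (1 : G)).symm p.2 := by
  have h1 : ContinuousAt (extChartAt 𝓘(ℝ, E) (1 : G)).symm (oneCoord G) :=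
    (contMDiffAt_chart_symm G le_rfl).continuousAt
  have : IsTopologicalGroup G := topologicalGroup_of_lieGroup 𝓘(ℝ, E) ∞
  have h2 : ContinuousAt (fun p : E × E => (extChartAt 𝓘(ℝ, E) (1 : G)).symm p.1 *
      (extChartAt 𝓘(ℝ, E) (1 : G)).symm p.2) (oneCoord G, oneCoord G) :=
    (ContinuousAt.comp (f := Prod.fst) h1 continuousAt_fst).mul
      (ContinuousAt.comp (f := Prod.snd) h1 continuousAt_snd)
  have h3 : (extChartAt 𝓘(ℝ, E) (1 : G)).source ∈
      𝓝 ((extChartAt 𝓘(ℝ, E) (1 : G)).symm (oneCoord G) *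
        (extChartAt 𝓘(ℝ, E) (1 : G)).symm (oneCoord G)) := by
    rw [chart_symm_oneCoord, mul_one]
    exact extChartAt_source_mem_nhds (1 : G)
  filter_upwards [h2 h3] with p hp
  exact (extChartAt 𝓘(ℝ, E) (1 : G)).left_inv hp

lemma eventually_symm_conjCoord :
    ∀ᶠ p in 𝓝 ((oneCoord G : E), (oneCoord G : E)),
      (extChartAt 𝓘(ℝ, E) (1 : G)).symm (conjCoord G p) =
        (extChartAt 𝓘(ℝ, E) (1 : G)).symm p.1 * (extChartAt 𝓘(ℝ, E) (1 : G)).symm p.2 *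
          ((extChartAt 𝓘(ℝ, E) (1 : G)).symm p.1)⁻¹ := by
  have h1 : ContinuousAt (extChartAt 𝓘(ℝ, E) (1 : G)).symm (oneCoord G) :=
    (contMDiffAt_chart_symm G le_rfl).continuousAt
  have : IsTopologicalGroup G := topologicalGroup_of_lieGroup 𝓘(ℝ, E) ∞
  have h2 : ContinuousAt (fun p : E × E => (extChartAt 𝓘(ℝ, E) (1 : G)).symm p.1 *
      (extChartAt 𝓘(ℝ, E) (1 : G)).symm p.2 * ((extChartAt 𝓘(ℝ, E) (1 : G)).symm p.1)⁻¹)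
      (oneCoord G, oneCoord G) :=
    ((ContinuousAt.comp (f := Prod.fst) h1 continuousAt_fst).mul
      (ContinuousAt.comp (f := Prod.snd) h1 continuousAt_snd)).mul
      (ContinuousAt.comp (f := Prod.fst) h1 continuousAt_fst).inv
  have h3 : (extChartAt 𝓘(ℝ, E) (1 : G)).source ∈
      𝓝 ((extChartAt 𝓘(ℝ, E) (1 : G)).symm (oneCoord G) *
        (extChartAt 𝓘(ℝ, E) (1 : G)).symm (oneCoord G) *
        ((extChartAt 𝓘(ℝ, E) (1 : G)).symm (oneCoord G))⁻¹) := by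
    rw [chart_symm_oneCoord, mul_one, inv_one, mul_one]
    exact extChartAt_source_mem_nhds (1 : G)
  filter_upwards [h2 h3] with p hp
  exact (extChartAt 𝓘(ℝ, E) (1 : G)).left_inv hp

/-- The mixed second derivative at the identity of the multiplication read in the chart. -/
def mulHess (v w : E) : E :=
  fderiv ℝ (fderiv ℝ (mulCoord G)) (oneCoord G, oneCoord G) (v, 0) (0, w)

omit [LieGroup 𝓘(ℝ, E) ∞ G] in
variable {G} in
/-- The derivative at the identity of a function on `G`, read in the preferred chart. -/
lemma mfderiv_one_eq {F : Type*} [NormedAddCommGroup F] [NormedSpace ℝ F] {f : G → F}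
    (hf : MDifferentiableAt 𝓘(ℝ, E) 𝓘(ℝ, F) f 1) :
    HasFDerivAt (fun x : E => f ((extChartAt 𝓘(ℝ, E) (1 : G)).symm x))
      (show E →L[ℝ] F from mfderiv 𝓘(ℝ, E) 𝓘(ℝ, F) f 1) (oneCoord G) := by
  have h := hf.hasMFDerivAt.2
  simp only [modelWithCornersSelf_coe, range_id] at h
  exact hasFDerivWithinAt_univ.mp h

/-- A left-invariant field at `g` is the derivative of `h ↦ g h` at the identity applied to `v`. In
coordinates this is the partial derivative of the multiplication in its second variable. -/
lemma mulInvariantVectorField_coord (v : E) :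
    ∀ᶠ x in 𝓝 (oneCoord G : E),
      (mfderivWithin 𝓘(ℝ, E) 𝓘(ℝ, E) (extChartAt 𝓘(ℝ, E) (1 : G)).symm (range 𝓘(ℝ, E)) x).inverse
        (mulInvariantVectorField (I := 𝓘(ℝ, E)) (v : GroupLieAlgebra 𝓘(ℝ, E) G)
          ((extChartAt 𝓘(ℝ, E) (1 : G)).symm x)) =
      fderiv ℝ (mulCoord G) (x, oneCoord G) (0, v) := by
  have hd : ∀ᶠ p in 𝓝 ((oneCoord G : E), (oneCoord G : E)),
      DifferentiableAt ℝ (mulCoord G) p := by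
    filter_upwards [((contDiffAt_mulCoord (E := E) G).of_le
      (show (1 : ℕ∞ω) ≤ ∞ by simp)).eventually (by simp)] with p hp
    exact hp.differentiableAt (by simp)
  have hc : Tendsto (fun x : E => (x, (oneCoord G : E))) (𝓝 (oneCoord G))
      (𝓝 ((oneCoord G : E), (oneCoord G : E))) :=
    (Continuous.prodMk_left _).continuousAt
  filter_upwards [target_mem_nhds_oneCoord (E := E) G, hc.eventually hd] with x hx hdx
  have : IsManifold 𝓘(ℝ, E) ∞ G := LieGroup.toContMDiffMul.toIsManifold
  have : IsManifold 𝓘(ℝ, E) 1 G := IsManifold.of_le (n := ∞) (by simp)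
  have h1 := mfderiv_extChartAt_comp_mfderivWithin_extChartAt_symm (I := 𝓘(ℝ, E)) (x := (1:G)) hx
  have h2 := mfderivWithin_extChartAt_symm_comp_mfderiv_extChartAt (I := 𝓘(ℝ, E)) (x := (1:G)) hx
  rw [ContinuousLinearMap.inverse_eq h2 h1]
  set φ := extChartAt 𝓘(ℝ, E) (1 : G) with hφ
  have hml : MDifferentiableAt 𝓘(ℝ, E) 𝓘(ℝ, E) (fun h : G => φ.symm x * h) 1 :=
    (contMDiff_mul_left (I := 𝓘(ℝ, E)) (n := ∞)).mdifferentiable (by simp) _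
  have hφd : MDifferentiableAt 𝓘(ℝ, E) 𝓘(ℝ, E) φ (φ.symm x * 1) := by
    rw [mul_one]
    refine mdifferentiableAt_extChartAt ?_
    have := φ.map_target hx
    simpa [hφ] using this
  have hcomp : MDifferentiableAt 𝓘(ℝ, E) 𝓘(ℝ, E) (φ ∘ (fun h : G => φ.symm x * h)) 1 :=
    MDifferentiableAt.comp (I' := 𝓘(ℝ, E)) 1 hφd hml
  have h4 : HasFDerivAt (fun y : E => mulCoord G (x, y))
      ((fderiv ℝ (mulCoord G) (x, oneCoord G)).comp (ContinuousLinearMap.inr ℝ E E))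
      (oneCoord G) :=
    hdx.hasFDerivAt.comp (oneCoord G) (hasFDerivAt_prodMk_right x (oneCoord G))
  have h3 := congrArg (fun L : E →L[ℝ] E => L v) (h4.unique (mfderiv_one_eq hcomp))
  simp only [ContinuousLinearMap.comp_apply, ContinuousLinearMap.inr_apply] at h3
  rw [h3, mfderiv_comp (I' := 𝓘(ℝ, E)) _ hφd hml]
  -- The base points `φ.symm x * 1` and `φ.symm x` are only propositionally equal and the tangent
  -- spaces depend on them, so the equality is eliminated for a variable `g`.
  have key : ∀ g : G, g = φ.symm x → ∀ z : E,
      (show E →L[ℝ] E from mfderiv 𝓘(ℝ, E) 𝓘(ℝ, E) φ (φ.symm x)) z =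
      (show E →L[ℝ] E from mfderiv 𝓘(ℝ, E) 𝓘(ℝ, E) φ g) z := by
    rintro _ rfl z
    rfl
  exact key _ (mul_one _) _

/-- The left-invariant vector field with value `v` at the identity, read in the chart. -/
def leftInvCoord (v : E) : E → E :=
  VectorField.mpullbackWithin 𝓘(ℝ, E) 𝓘(ℝ, E) (extChartAt 𝓘(ℝ, E) (1 : G)).symm
    (mulInvariantVectorField (I := 𝓘(ℝ, E)) (v : GroupLieAlgebra 𝓘(ℝ, E) G)) (range 𝓘(ℝ, E))

lemma leftInvCoord_eventuallyEq (v : E) :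
    leftInvCoord G v =ᶠ[𝓝 (oneCoord G : E)]
      fun x : E => fderiv ℝ (mulCoord G) (x, oneCoord G) (0, v) :=
  mulInvariantVectorField_coord G v

/-- In coordinates the bracket of fields is `DW(V) - DV(W)`. The left-invariant field of `w` is `x ↦
∂₂μ(x, c) w`, with value `w` at the identity and derivative `mulHess v w` in the direction `v`. -/
lemma lieBr_eq_mulHess (v w : E) : lieBr G v w = mulHess G v w - mulHess G w v := by
  have hD : DifferentiableAt ℝ (fderiv ℝ (mulCoord G)) ((oneCoord G : E), oneCoord G) :=
    ((contDiffAt_mulCoord (E := E) G).fderiv_right (m := ∞) (by simp)).differentiableAt (by simp)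
  have hder : ∀ w v : E, fderiv ℝ (fun x : E => fderiv ℝ (mulCoord G) (x, oneCoord G) (0, w))
      (oneCoord G) v = mulHess G v w := by
    intro w v
    have h1 : HasFDerivAt (fun x : E => fderiv ℝ (mulCoord G) (x, oneCoord G))
        ((fderiv ℝ (fderiv ℝ (mulCoord G)) (oneCoord G, oneCoord G)).comp
          (ContinuousLinearMap.inl ℝ E E)) (oneCoord G) :=
      HasFDerivAt.comp (f := fun x : E => (x, (oneCoord G : E))) _ hD.hasFDerivAt
        (hasFDerivAt_prodMk_left (oneCoord G) (oneCoord G))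
    have h2 := h1.clm_apply (hasFDerivAt_const ((0 : E), w) (oneCoord G))
    rw [h2.fderiv]
    simp [mulHess]
  have hval : ∀ w : E, fderiv ℝ (mulCoord G) (oneCoord G, oneCoord G) (0, w) = w := by
    intro w
    have hd : DifferentiableAt ℝ (mulCoord G) ((oneCoord G : E), oneCoord G) :=
      (contDiffAt_mulCoord (E := E) G).differentiableAt (by simp)
    have h4 : HasFDerivAt (fun y : E => mulCoord G (oneCoord G, y))
        ((fderiv ℝ (mulCoord G) (oneCoord G, oneCoord G)).comp (ContinuousLinearMap.inr ℝ E E))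
        (oneCoord G) :=
      hd.hasFDerivAt.comp (oneCoord G) (hasFDerivAt_prodMk_right _ (oneCoord G))
    have h5 := (hasFDerivAt_id (𝕜 := ℝ) (oneCoord G : E)).congr_of_eventuallyEq
      (mulCoord_one_left (E := E) G)
    have := congrArg (fun L : E →L[ℝ] E => L w) (h4.unique h5)
    simpa using this
  have h := VectorField.mlieBracketWithin_apply (I := 𝓘(ℝ, E)) (s := univ) (x₀ := (1 : G))
    (V := mulInvariantVectorField (I := 𝓘(ℝ, E)) (v : GroupLieAlgebra 𝓘(ℝ, E) G))
    (W := mulInvariantVectorField (I := 𝓘(ℝ, E)) (w : GroupLieAlgebra 𝓘(ℝ, E) G))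
  have hM : IsManifold 𝓘(ℝ, E) ∞ G := LieGroup.toContMDiffMul.toIsManifold
  have : IsManifold 𝓘(ℝ, E) 1 G := IsManifold.of_le (n := ∞) (by simp)
  rw [VectorField.mlieBracketWithin_univ, mfderiv_extChartAt_self] at h
  have hi : ∀ z : E, (ContinuousLinearMap.id ℝ E).inverse z = z := fun z => by
    rw [ContinuousLinearMap.inverse_id]
    rfl
  have e1 : lieBr G v w = VectorField.lieBracketWithin ℝ (leftInvCoord G v) (leftInvCoord G w)
      ((extChartAt 𝓘(ℝ, E) (1:G)).symm ⁻¹' univ ∩ range 𝓘(ℝ, E)) (oneCoord G) := h.trans (hi _)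
  have e2 : ((extChartAt 𝓘(ℝ, E) (1:G)).symm ⁻¹' univ ∩ range 𝓘(ℝ, E)) = univ := by simp
  rw [e1, e2, VectorField.lieBracketWithin_univ,
    Filter.EventuallyEq.lieBracket_vectorField_eq (leftInvCoord_eventuallyEq G v)
      (leftInvCoord_eventuallyEq G w), VectorField.lieBracket, hval, hval, hder, hder]

end GroupChart

lemma minSmoothness_two_le_infty : minSmoothness ℝ 2 ≤ (∞ : ℕ∞ω) := by
  rw [minSmoothness_of_isRCLikeNormedField]
  exact WithTop.coe_le_coe.2 (le_top : (2 : ℕ∞) ≤ ⊤)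

/-! ### The differential of an orthogonal representation -/

section Representation

open Filter Topology

variable {E : Type*} [NormedAddCommGroup E] [NormedSpace ℝ E]
  {G : Type*} [TopologicalSpace G] [ChartedSpace E G] [Group G] [LieGroup 𝓘(ℝ, E) ∞ G]
  {V : Type*} [NormedAddCommGroup V] [InnerProductSpace ℝ V]

/-- The infinitesimal action as a continuous linear map. -/
def actL (ρ : G →* (V →L[ℝ] V)) : E →L[ℝ] V →L[ℝ] V :=
  show E →L[ℝ] V →L[ℝ] V from mfderiv 𝓘(ℝ, E) 𝓘(ℝ, V →L[ℝ] V) (fun g : G => ρ g) 1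

lemma hasFDerivAt_coord_rep (ρ : G →* (V →L[ℝ] V))
    (hρ : ContMDiff 𝓘(ℝ, E) 𝓘(ℝ, V →L[ℝ] V) ∞ (fun g : G => ρ g)) :
    HasFDerivAt (fun x : E => ρ ((extChartAt 𝓘(ℝ, E) (1 : G)).symm x)) (actL ρ) (oneCoord G) :=
  mfderiv_one_eq (hρ.mdifferentiable (by simp) 1)

lemma contDiffAt_coord_rep (ρ : G →* (V →L[ℝ] V))
    (hρ : ContMDiff 𝓘(ℝ, E) 𝓘(ℝ, V →L[ℝ] V) ∞ (fun g : G => ρ g)) :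
    ContDiffAt ℝ ∞ (fun x : E => ρ ((extChartAt 𝓘(ℝ, E) (1 : G)).symm x)) (oneCoord G) :=
  ContMDiffAt.contDiffAt <| ContMDiffAt.comp (I' := 𝓘(ℝ, E)) (g := fun g : G => ρ g) _
    hρ.contMDiffAt (contMDiffAt_chart_symm G le_rfl)

variable (G) in
lemma eventually_differentiableAt_mulCoord :
    ∀ᶠ x in 𝓝 (oneCoord G : E), DifferentiableAt ℝ (mulCoord G) (x, oneCoord G) := by
  have hd : ∀ᶠ p in 𝓝 ((oneCoord G : E), (oneCoord G : E)),
      DifferentiableAt ℝ (mulCoord G) p := by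
    filter_upwards [((contDiffAt_mulCoord (E := E) G).of_le
      (show (1 : ℕ∞ω) ≤ ∞ by simp)).eventually (by simp)] with p hp
    exact hp.differentiableAt (by simp)
  exact (Continuous.prodMk_left (oneCoord G : E)).continuousAt.eventually hd

variable (G) in
lemma hasFDerivAt_mulCoord_partial (w : E) :
    HasFDerivAt (fun x : E => fderiv ℝ (mulCoord G) (x, oneCoord G) (0, w))
      (((fderiv ℝ (fderiv ℝ (mulCoord G)) (oneCoord G, oneCoord G)).comp
          (ContinuousLinearMap.inl ℝ E E)).flip (0, w)) (oneCoord G) := by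
  have hD : DifferentiableAt ℝ (fderiv ℝ (mulCoord G)) ((oneCoord G : E), oneCoord G) :=
    ((contDiffAt_mulCoord (E := E) G).fderiv_right (m := ∞) (by simp)).differentiableAt (by simp)
  have h1 : HasFDerivAt (fun x : E => fderiv ℝ (mulCoord G) (x, oneCoord G))
      ((fderiv ℝ (fderiv ℝ (mulCoord G)) (oneCoord G, oneCoord G)).comp
        (ContinuousLinearMap.inl ℝ E E)) (oneCoord G) :=
    HasFDerivAt.comp (f := fun x : E => (x, (oneCoord G : E))) _ hD.hasFDerivAt
      (hasFDerivAt_prodMk_left (oneCoord G) (oneCoord G))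
  have h2 := h1.clm_apply (hasFDerivAt_const ((0 : E), w) (oneCoord G))
  convert h2 using 1
  ext v
  simp

variable (G) in
lemma fderiv_mulCoord_inr (w : E) :
    fderiv ℝ (mulCoord G) (oneCoord G, oneCoord G) (0, w) = w := by
  have hd : DifferentiableAt ℝ (mulCoord G) ((oneCoord G : E), oneCoord G) :=
    (contDiffAt_mulCoord (E := E) G).differentiableAt (by simp)
  have h4 : HasFDerivAt (fun y : E => mulCoord G (oneCoord G, y))
      ((fderiv ℝ (mulCoord G) (oneCoord G, oneCoord G)).comp (ContinuousLinearMap.inr ℝ E E))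
      (oneCoord G) :=
    hd.hasFDerivAt.comp (oneCoord G) (hasFDerivAt_prodMk_right _ (oneCoord G))
  have h5 := (hasFDerivAt_id (𝕜 := ℝ) (oneCoord G : E)).congr_of_eventuallyEq
    (mulCoord_one_left (E := E) G)
  simpa using congrArg (fun L : E →L[ℝ] E => L w) (h4.unique h5)

variable (G) in
lemma fderiv_mulCoord_inl (w : E) :
    fderiv ℝ (mulCoord G) (oneCoord G, oneCoord G) (w, 0) = w := by
  have hd : DifferentiableAt ℝ (mulCoord G) ((oneCoord G : E), oneCoord G) :=
    (contDiffAt_mulCoord (E := E) G).differentiableAt (by simp)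
  have h4 : HasFDerivAt (fun y : E => mulCoord G (y, oneCoord G))
      ((fderiv ℝ (mulCoord G) (oneCoord G, oneCoord G)).comp (ContinuousLinearMap.inl ℝ E E))
      (oneCoord G) :=
    HasFDerivAt.comp (f := fun x : E => (x, (oneCoord G : E))) _ hd.hasFDerivAt
      (hasFDerivAt_prodMk_left _ (oneCoord G))
  have h5 := (hasFDerivAt_id (𝕜 := ℝ) (oneCoord G : E)).congr_of_eventuallyEq
    (mulCoord_one_right (E := E) G)
  simpa using congrArg (fun L : E →L[ℝ] E => L w) (h4.unique h5)

/-- With `f` the representation in the chart, the mixed second derivative of `f(μ(x, y)) = f(x)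
f(y)` at the identity reads `D²f(v, w) + Df(H(v, w)) = Df(v) Df(w)`. Antisymmetrising removes `D²f`
and turns `H` into the bracket. -/
lemma actL_lieBr (ρ : G →* (V →L[ℝ] V))
    (hρ : ContMDiff 𝓘(ℝ, E) 𝓘(ℝ, V →L[ℝ] V) ∞ (fun g : G => ρ g)) (v w : E) :
    actL ρ (lieBr G v w) = actL ρ v * actL ρ w - actL ρ w * actL ρ v := by
  set c : E := oneCoord G with hc
  set f : E → V →L[ℝ] V := fun x : E => ρ ((extChartAt 𝓘(ℝ, E) (1 : G)).symm x) with hf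
  have hfc : ContDiffAt ℝ ∞ f c := contDiffAt_coord_rep ρ hρ
  have hf1 : f c = 1 := by simp only [hf, hc, chart_symm_oneCoord, map_one]
  have hfd : HasFDerivAt f (actL ρ) c := hasFDerivAt_coord_rep ρ hρ
  have hfe : ∀ᶠ x in 𝓝 c, DifferentiableAt ℝ f x := by
    filter_upwards [(hfc.of_le (show (1 : ℕ∞ω) ≤ ∞ by simp)).eventually (by simp)] with p hp
    exact hp.differentiableAt (by simp)
  have hf2 : DifferentiableAt ℝ (fderiv ℝ f) c :=
    (hfc.fderiv_right (m := ∞) (by simp)).differentiableAt (by simp)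
  have key : ∀ v w : E, fderiv ℝ (fderiv ℝ f) c v w + actL ρ (mulHess G v w) =
      actL ρ v * actL ρ w := by
    intro v w
    have hmul : ∀ᶠ x in 𝓝 c, ∀ᶠ y in 𝓝 c, f (mulCoord G (x, y)) = f x * f y := by
      have h1 := eventually_symm_mulCoord (E := E) G
      rw [nhds_prod_eq] at h1
      filter_upwards [h1.curry] with x hx
      filter_upwards [hx] with y hy
      simp only [hf, hy, map_mul]
    -- The derivative in `y` is taken first, at `y = c`, for all `x` near `c`, so that the result
    -- can be differentiated again in `x`.
    have hE : ∀ᶠ x in 𝓝 c, fderiv ℝ f x (fderiv ℝ (mulCoord G) (x, c) (0, w)) =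
        f x * actL ρ w := by
      filter_upwards [hmul, hfe, eventually_differentiableAt_mulCoord (E := E) G,
        mulCoord_one_right (E := E) G] with x hx hfx hmx hx1
      have h4 : HasFDerivAt (fun y : E => mulCoord G (x, y))
          ((fderiv ℝ (mulCoord G) (x, c)).comp (ContinuousLinearMap.inr ℝ E E)) c :=
        hmx.hasFDerivAt.comp c (hasFDerivAt_prodMk_right x c)
      have hfx' : HasFDerivAt f (fderiv ℝ f x) (mulCoord G (x, c)) := by
        rw [hx1]
        exact hfx.hasFDerivAt
      have h5 : HasFDerivAt (fun y : E => f (mulCoord G (x, y)))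
          ((fderiv ℝ f x).comp
            ((fderiv ℝ (mulCoord G) (x, c)).comp (ContinuousLinearMap.inr ℝ E E))) c :=
        HasFDerivAt.comp (f := fun y : E => mulCoord G (x, y)) c hfx' h4
      have h6 : HasFDerivAt (fun y : E => f x * f y)
          ((ContinuousLinearMap.mul ℝ (V →L[ℝ] V) (f x)).comp (actL ρ)) c :=
        (ContinuousLinearMap.mul ℝ (V →L[ℝ] V) (f x)).hasFDerivAt.comp c hfd
      have h7 := h5.unique (h6.congr_of_eventuallyEq hx)
      simpa using congrArg (fun L : E →L[ℝ] (V →L[ℝ] V) => L w) h7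
    have hL := hf2.hasFDerivAt.clm_apply (hasFDerivAt_mulCoord_partial G w)
    have hR : HasFDerivAt (fun x : E => f x * actL ρ w)
        (((ContinuousLinearMap.mul ℝ (V →L[ℝ] V)).flip (actL ρ w)).comp (actL ρ)) c :=
      ((ContinuousLinearMap.mul ℝ (V →L[ℝ] V)).flip (actL ρ w)).hasFDerivAt.comp c hfd
    have h8 := congrArg (fun L : E →L[ℝ] (V →L[ℝ] V) => L v)
      (hL.unique (hR.congr_of_eventuallyEq hE))
    have h9 := fderiv_mulCoord_inr G w
    rw [← hc] at h9
    simp only [add_apply, ContinuousLinearMap.comp_apply,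
      ContinuousLinearMap.flip_apply, ContinuousLinearMap.inl_apply, ← hc, h9,
      ContinuousLinearMap.mul_apply', hfd.fderiv] at h8
    rw [← h8, add_comm]
    rfl
  have hsymm : fderiv ℝ (fderiv ℝ f) c v w = fderiv ℝ (fderiv ℝ f) c w v :=
    (hfc.isSymmSndFDerivAt minSmoothness_two_le_infty) v w
  rw [lieBr_eq_mulHess, map_sub, ← key v w, ← key w v, hsymm]
  abel

/-- The derivative of the constant function `g ↦ ⟨ρ(g) v, ρ(g) w⟩` at the identity vanishes. -/
lemma actL_skew (ρ : G →* (V →L[ℝ] V))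
    (hρ : ContMDiff 𝓘(ℝ, E) 𝓘(ℝ, V →L[ℝ] V) ∞ (fun g : G => ρ g))
    (hinv : ∀ (g : G) (v w : V), inner ℝ (ρ g v) (ρ g w) = inner ℝ v w) (X : E) (v w : V) :
    inner ℝ (actL ρ X v) w = -inner ℝ v (actL ρ X w) := by
  have hfd := hasFDerivAt_coord_rep ρ hρ
  have h1 := hfd.clm_apply (hasFDerivAt_const v (oneCoord G : E))
  have h2 := hfd.clm_apply (hasFDerivAt_const w (oneCoord G : E))
  have h3 := h1.inner ℝ h2
  simp only [hinv] at h3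
  have h4 := congrArg (fun L : E →L[ℝ] ℝ => L X)
    (h3.unique (hasFDerivAt_const (inner ℝ v w : ℝ) (oneCoord G : E)))
  simp only [chart_symm_oneCoord, map_one] at h4
  simp [fderivInnerCLM_apply] at h4
  linarith

end Representation

/-! ### The adjoint representation and its differential -/

section AdjointRep

open Filter Topology

variable {E : Type*} [NormedAddCommGroup E] [NormedSpace ℝ E]
  {G : Type*} [TopologicalSpace G] [ChartedSpace E G] [Group G] [LieGroup 𝓘(ℝ, E) ∞ G]

/-- Conjugation by `g`, read in the preferred chart at the identity. -/
def conjBy (g : G) (y : E) : E :=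
  extChartAt 𝓘(ℝ, E) (1 : G) (g * (extChartAt 𝓘(ℝ, E) (1 : G)).symm y * g⁻¹)

omit [LieGroup 𝓘(ℝ, E) ∞ G] in
lemma conjBy_oneCoord (g : G) : conjBy g (oneCoord G : E) = oneCoord G := by
  simp [conjBy, oneCoord]

lemma contDiffAt_conjBy (g : G) : ContDiffAt ℝ ∞ (conjBy g : E → E) (oneCoord G) := by
  apply ContMDiffAt.contDiffAt
  have h1 := contMDiffAt_chart_symm (E := E) G le_rfl
  have h3 : ContMDiffAt 𝓘(ℝ, E) 𝓘(ℝ, E) ∞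
      (fun y : E => g * (extChartAt 𝓘(ℝ, E) (1 : G)).symm y * g⁻¹) (oneCoord G) :=
    (contMDiffAt_const.mul h1).mul contMDiffAt_const
  refine ContMDiffAt.comp (I' := 𝓘(ℝ, E)) (g := extChartAt 𝓘(ℝ, E) (1 : G)) _ ?_ h3
  simp only [chart_symm_oneCoord, mul_one, mul_inv_cancel]
  have : IsManifold 𝓘(ℝ, E) ∞ G := LieGroup.toContMDiffMul.toIsManifold
  exact contMDiffAt_extChartAt

/-- The adjoint representation of `G`. -/
def adRep (g : G) : E →L[ℝ] E := fderiv ℝ (conjBy g) (oneCoord G)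

lemma hasFDerivAt_conjBy (g : G) :
    HasFDerivAt (conjBy g : E → E) (adRep g) (oneCoord G) :=
  ((contDiffAt_conjBy g).differentiableAt (by simp)).hasFDerivAt

lemma eventually_conjBy_mul (g h : G) :
    ∀ᶠ y in 𝓝 (oneCoord G : E), conjBy (g * h) y = conjBy g (conjBy h y) := by
  have h1 : ContinuousAt (extChartAt 𝓘(ℝ, E) (1 : G)).symm (oneCoord G) :=
    (contMDiffAt_chart_symm G le_rfl).continuousAt
  have : IsTopologicalGroup G := topologicalGroup_of_lieGroup 𝓘(ℝ, E) ∞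
  have h2 : ContinuousAt (fun y : E => h * (extChartAt 𝓘(ℝ, E) (1 : G)).symm y * h⁻¹)
      (oneCoord G) := (continuousAt_const.mul h1).mul continuousAt_const
  have h3 : (extChartAt 𝓘(ℝ, E) (1 : G)).source ∈
      𝓝 (h * (extChartAt 𝓘(ℝ, E) (1 : G)).symm (oneCoord G) * h⁻¹) := by
    rw [chart_symm_oneCoord, mul_one, mul_inv_cancel]
    exact extChartAt_source_mem_nhds (1 : G)
  filter_upwards [h2 h3] with y hy
  simp only [conjBy]
  rw [(extChartAt 𝓘(ℝ, E) (1 : G)).left_inv hy]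
  simp [mul_assoc]

lemma adRep_mul (g h : G) : (adRep (g * h) : E →L[ℝ] E) = (adRep g).comp (adRep h) := by
  have h1 : HasFDerivAt (conjBy g : E → E) (adRep g) (conjBy h (oneCoord G)) := by
    rw [conjBy_oneCoord]
    exact hasFDerivAt_conjBy g
  have h2 := h1.comp _ (hasFDerivAt_conjBy h)
  exact (hasFDerivAt_conjBy (g * h)).unique (h2.congr_of_eventuallyEq (eventually_conjBy_mul g h))

lemma adRep_one : (adRep (1 : G) : E →L[ℝ] E) = ContinuousLinearMap.id ℝ E := by
  refine (hasFDerivAt_conjBy (1 : G)).unique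
    ((hasFDerivAt_id (oneCoord G : E)).congr_of_eventuallyEq ?_)
  filter_upwards [target_mem_nhds_oneCoord (E := E) G] with y hy
  simp only [conjBy, one_mul, inv_one, mul_one, id]
  exact (extChartAt 𝓘(ℝ, E) (1 : G)).right_inv hy

/-- The adjoint representation near the identity, read in the chart. -/
lemma eventually_adRep_symm :
    ∀ᶠ x in 𝓝 (oneCoord G : E), adRep ((extChartAt 𝓘(ℝ, E) (1 : G)).symm x) =
      (fderiv ℝ (conjCoord G) (x, oneCoord G)).comp (ContinuousLinearMap.inr ℝ E E) := by
  have hd : ∀ᶠ p in 𝓝 ((oneCoord G : E), (oneCoord G : E)),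
      DifferentiableAt ℝ (conjCoord G) p := by
    filter_upwards [((contDiffAt_conjCoord (E := E) G).of_le
      (show (1 : ℕ∞ω) ≤ ∞ by simp)).eventually (by simp)] with p hp
    exact hp.differentiableAt (by simp)
  have hd' := (Continuous.prodMk_left (oneCoord G : E)).continuousAt.eventually hd
  filter_upwards [hd'] with x hx
  have h4 : HasFDerivAt (fun y : E => conjCoord G (x, y))
      ((fderiv ℝ (conjCoord G) (x, oneCoord G)).comp (ContinuousLinearMap.inr ℝ E E))
      (oneCoord G) :=
    hx.hasFDerivAt.comp (oneCoord G) (hasFDerivAt_prodMk_right x (oneCoord G))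
  exact (hasFDerivAt_conjBy _).unique h4

lemma differentiableAt_adRep_symm :
    DifferentiableAt ℝ (fun x : E => (adRep ((extChartAt 𝓘(ℝ, E) (1 : G)).symm x) : E →L[ℝ] E))
      (oneCoord G) := by
  have hD : DifferentiableAt ℝ (fderiv ℝ (conjCoord G)) ((oneCoord G : E), oneCoord G) :=
    ((contDiffAt_conjCoord (E := E) G).fderiv_right (m := ∞) (by simp)).differentiableAt (by simp)
  have h1 : DifferentiableAt ℝ (fun x : E => fderiv ℝ (conjCoord G) (x, oneCoord G))
      (oneCoord G) :=
    DifferentiableAt.comp (f := fun x : E => (x, (oneCoord G : E))) _ hD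
      (hasFDerivAt_prodMk_left (oneCoord G) (oneCoord G)).differentiableAt
  exact (h1.clm_comp (differentiableAt_const _)).congr_of_eventuallyEq eventually_adRep_symm

/-- The differential of the adjoint representation is the bracket. -/
lemma fderiv_adRep_symm (v w : E) :
    fderiv ℝ (fun x : E => (adRep ((extChartAt 𝓘(ℝ, E) (1 : G)).symm x) : E →L[ℝ] E))
      (oneCoord G) v w = lieBr G v w := by
  set c : E := oneCoord G with hc
  set α : E → E →L[ℝ] E := fun x : E => adRep ((extChartAt 𝓘(ℝ, E) (1 : G)).symm x) with hα
  have hαd : HasFDerivAt α (fderiv ℝ α c) c := differentiableAt_adRep_symm.hasFDerivAt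
  have hα1 : α c = ContinuousLinearMap.id ℝ E := by
    simp only [hα, hc, chart_symm_oneCoord, adRep_one]
  -- The relation `(x y x⁻¹) x = x y` avoids differentiating the inverse. Its derivative in `y`,
  -- then in `x`, at the identity is `D²μ((0,v),(w,0)) + Dα(v) w = D²μ((v,0),(0,w))`. Symmetry of
  -- `D²μ` then gives `Dα(v) w` as the antisymmetrised Hessian.
  have hmul : ∀ᶠ x in 𝓝 c, ∀ᶠ y in 𝓝 c,
      mulCoord G (conjBy ((extChartAt 𝓘(ℝ, E) (1 : G)).symm x) y, x) = mulCoord G (x, y) := by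
    have h1 := eventually_symm_conjCoord (E := E) G
    rw [nhds_prod_eq] at h1
    filter_upwards [h1.curry] with x hx
    filter_upwards [hx] with y hy
    change mulCoord G (conjCoord G (x, y), x) = _
    simp only [mulCoord, hy, inv_mul_cancel_right]
  have hswap : ∀ᶠ x in 𝓝 c, DifferentiableAt ℝ (mulCoord G) (c, x) := by
    have hd : ∀ᶠ p in 𝓝 ((oneCoord G : E), (oneCoord G : E)),
        DifferentiableAt ℝ (mulCoord G) p := by
      filter_upwards [((contDiffAt_mulCoord (E := E) G).of_le
        (show (1 : ℕ∞ω) ≤ ∞ by simp)).eventually (by simp)] with p hp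
      exact hp.differentiableAt (by simp)
    exact (Continuous.prodMk_right (oneCoord G : E)).continuousAt.eventually hd
  have hE : ∀ᶠ x in 𝓝 c, fderiv ℝ (mulCoord G) (c, x) (α x w, 0) =
      fderiv ℝ (mulCoord G) (x, c) (0, w) := by
    filter_upwards [hmul, hswap, eventually_differentiableAt_mulCoord (E := E) G] with x hx hs hmx
    have h4 : HasFDerivAt (fun y : E => mulCoord G (x, y))
        ((fderiv ℝ (mulCoord G) (x, c)).comp (ContinuousLinearMap.inr ℝ E E)) c :=
      hmx.hasFDerivAt.comp c (hasFDerivAt_prodMk_right x c)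
    have hs' : HasFDerivAt (mulCoord G) (fderiv ℝ (mulCoord G) (c, x))
        (conjBy ((extChartAt 𝓘(ℝ, E) (1 : G)).symm x) c, x) := by
      rw [hc, conjBy_oneCoord]
      exact hs.hasFDerivAt
    have h5 : HasFDerivAt
        (fun y : E => mulCoord G (conjBy ((extChartAt 𝓘(ℝ, E) (1 : G)).symm x) y, x))
        ((fderiv ℝ (mulCoord G) (c, x)).comp ((α x).prod 0)) c :=
      HasFDerivAt.comp (f := fun y : E => (conjBy ((extChartAt 𝓘(ℝ, E) (1 : G)).symm x) y, x)) _
        hs' ((hasFDerivAt_conjBy _).prodMk (hasFDerivAt_const x c))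
    have h7 := h5.unique (h4.congr_of_eventuallyEq hx)
    simpa using congrArg (fun L : E →L[ℝ] E => L w) h7
  have hD : DifferentiableAt ℝ (fderiv ℝ (mulCoord G)) (c, c) :=
    ((contDiffAt_mulCoord (E := E) G).fderiv_right (m := ∞) (by simp)).differentiableAt (by simp)
  have h1 : HasFDerivAt (fun x : E => fderiv ℝ (mulCoord G) (c, x))
      ((fderiv ℝ (fderiv ℝ (mulCoord G)) (c, c)).comp (ContinuousLinearMap.inr ℝ E E)) c :=
    HasFDerivAt.comp (f := fun x : E => (c, x)) _ hD.hasFDerivAt (hasFDerivAt_prodMk_right c c)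
  have h2 : HasFDerivAt (fun x : E => (α x w, (0 : E))) (((fderiv ℝ α c).flip w).prod 0) c := by
    have h3 := hαd.clm_apply (hasFDerivAt_const w c)
    refine HasFDerivAt.prodMk ?_ (hasFDerivAt_const (0 : E) c)
    convert h3 using 1
    ext z
    simp
  have h8 := congrArg (fun L : E →L[ℝ] E => L v) (((h1.clm_apply h2).congr_of_eventuallyEq
    (hE.mono fun x hx => hx.symm)).unique (hasFDerivAt_mulCoord_partial G w))
  have hsymm : fderiv ℝ (fderiv ℝ (mulCoord G)) (c, c) (0, v) (w, 0) =
      fderiv ℝ (fderiv ℝ (mulCoord G)) (c, c) (w, 0) (0, v) :=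
    ((contDiffAt_mulCoord (E := E) G).isSymmSndFDerivAt minSmoothness_two_le_infty) (0, v) (w, 0)
  have h9 := fderiv_mulCoord_inl G (fderiv ℝ α c v w)
  rw [← hc] at h9
  simp only [hα1, add_apply, ContinuousLinearMap.comp_apply,
    ContinuousLinearMap.flip_apply, ContinuousLinearMap.inl_apply, ContinuousLinearMap.inr_apply,
    ← hc, ContinuousLinearMap.prod_apply, zero_apply, h9, hsymm,
    ContinuousLinearMap.id_apply] at h8
  rw [lieBr_eq_mulHess, eq_sub_iff_add_eq]
  exact h8

/-- The chart gives continuity at the identity only; `Ad g = Ad g₀ ∘ Ad (g₀⁻¹ g)` transports it to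
every `g₀`. Global continuity is what the Haar average requires. -/
lemma continuous_adRep : Continuous (fun g : G => (adRep g : E →L[ℝ] E)) := by
  have : IsTopologicalGroup G := topologicalGroup_of_lieGroup 𝓘(ℝ, E) ∞
  have h1 : ContinuousAt (fun g : G => (adRep g : E →L[ℝ] E)) 1 := by
    have h2 : ContinuousAt (fun g : G =>
        (adRep ((extChartAt 𝓘(ℝ, E) (1 : G)).symm (extChartAt 𝓘(ℝ, E) (1 : G) g)) : E →L[ℝ] E))
        1 :=
      ContinuousAt.comp (f := extChartAt 𝓘(ℝ, E) (1 : G))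
        (differentiableAt_adRep_symm (E := E) (G := G)).continuousAt (continuousAt_extChartAt 1)
    refine h2.congr ?_
    filter_upwards [extChartAt_source_mem_nhds (I := 𝓘(ℝ, E)) (1 : G)] with g hg
    rw [(extChartAt 𝓘(ℝ, E) (1 : G)).left_inv hg]
  rw [continuous_iff_continuousAt]
  intro g₀
  have h2 : ContinuousAt (fun g : G => (adRep (g₀⁻¹ * g) : E →L[ℝ] E)) g₀ := by
    refine ContinuousAt.comp (f := fun g : G => g₀⁻¹ * g) (g := fun g : G => (adRep g : E →L[ℝ] E))
      (by rw [inv_mul_cancel]; exact h1) ?_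
    exact (continuous_const.mul continuous_id).continuousAt
  have h3 : (fun g : G => (adRep g : E →L[ℝ] E)) = fun g => (adRep g₀).comp (adRep (g₀⁻¹ * g)) := by
    ext1 g
    rw [← adRep_mul, mul_inv_cancel_left]
  rw [h3]
  exact continuousAt_const.clm_comp h2

end AdjointRep

/-! ### Invariant inner product, positivity of the negative Killing form, and the moment map -/

section SkewTrace

/-- In an orthonormal basis the trace of `f²` is `∑⟨bᵢ, f(f bᵢ)⟩ = -∑|f bᵢ|²`, which vanishes only
if `f` kills the basis. -/
lemma trace_comp_self_of_skew {F : Type*} [AddCommGroup F] [Module ℝ F] [FiniteDimensional ℝ F]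
    (core : InnerProductSpace.Core ℝ F) (f : F →ₗ[ℝ] F)
    (hf : ∀ x y, core.inner (f x) y = -core.inner x (f y)) :
    LinearMap.trace ℝ F (f ∘ₗ f) ≤ 0 ∧ (LinearMap.trace ℝ F (f ∘ₗ f) = 0 → f = 0) := by
  let _ : NormedAddCommGroup F := core.toNormedAddCommGroup
  let _ : InnerProductSpace ℝ F := InnerProductSpace.ofCore core.toCore
  have hsk : ∀ x y : F, inner ℝ (f x) y = -inner ℝ x (f y) := hf
  let b := stdOrthonormalBasis ℝ F
  have h1 : LinearMap.trace ℝ F (f ∘ₗ f) = -∑ i, ‖f (b i)‖ ^ 2 := by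
    rw [LinearMap.trace_eq_sum_inner _ b, ← Finset.sum_neg_distrib]
    refine Finset.sum_congr rfl fun i _ => ?_
    have h2 := hsk (b i) (f (b i))
    rw [real_inner_self_eq_norm_sq] at h2
    rw [LinearMap.comp_apply, h2, neg_neg]
  have h0 : 0 ≤ ∑ i, ‖f (b i)‖ ^ 2 := Finset.sum_nonneg fun i _ => by positivity
  refine ⟨by rw [h1]; linarith, fun h => ?_⟩
  have h3 : ∑ i, ‖f (b i)‖ ^ 2 = 0 := by linarith
  rw [Finset.sum_eq_zero_iff_of_nonneg fun i _ => by positivity] at h3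
  refine b.toBasis.ext fun i => ?_
  have := h3 i (Finset.mem_univ i)
  simpa using this

end SkewTrace

section InvariantInner

open Filter Topology

variable {E : Type*} [NormedAddCommGroup E] [NormedSpace ℝ E] [FiniteDimensional ℝ E]
  (G : Type*) [TopologicalSpace G]
  [ChartedSpace E G] [Group G] [LieGroup 𝓘(ℝ, E) ∞ G]

variable (E) [CompactSpace G] in
/-- A compact Lie group carries an inner product on its Lie algebra that is invariant under the
adjoint representation. -/
lemma exists_adRep_invariant_core : ∃ core : InnerProductSpace.Core ℝ E,
    ∀ (g : G) (x y : E), core.inner (adRep g x) (adRep g y) = core.inner x y := by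
  have : IsTopologicalGroup G := topologicalGroup_of_lieGroup 𝓘(ℝ, E) ∞
  borelize G
  let μ : Measure G := Measure.haar
  let f : E → E → G → ℝ := fun x y g =>
    inner ℝ (toEuclidean (adRep g⁻¹ x)) (toEuclidean (adRep g⁻¹ y))
  have hcont : ∀ x y, Continuous (f x y) := by
    intro x y
    have h1 : ∀ z : E, Continuous fun g : G => toEuclidean (adRep g⁻¹ z) := fun z =>
      toEuclidean.continuous.comp ((continuous_adRep.comp continuous_inv).clm_apply
        continuous_const)
    exact (h1 x).inner (h1 y)
  have hint : ∀ x y, Integrable (f x y) μ := fun x y =>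
    (hcont x y).integrable_of_hasCompactSupport (HasCompactSupport.of_compactSpace _)
  let core : InnerProductSpace.Core ℝ E :=
    { inner := fun x y => ∫ g, f x y g ∂μ
      conj_inner_symm := fun x y => by
        simp only [conj_trivial]
        refine integral_congr_ae (ae_of_all _ fun g => ?_)
        simp only [f]
        rw [real_inner_comm]
      re_inner_nonneg := fun x => by
        simp only [RCLike.re_to_real]
        exact integral_nonneg fun g => real_inner_self_nonneg
      add_left := fun x y z => by
        rw [← integral_add (hint x z) (hint y z)]
        refine integral_congr_ae (ae_of_all _ fun g => ?_)
        simp only [f, map_add, inner_add_left]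
      smul_left := fun x y r => by
        simp only [conj_trivial]
        rw [← integral_const_mul]
        refine integral_congr_ae (ae_of_all _ fun g => ?_)
        simp only [f, map_smul, real_inner_smul_left]
      definite := fun x hx => by
        by_contra hne
        -- A continuous nonnegative integrand that is nonzero at one point, here the identity, has
        -- positive Haar integral.
        have h1 : f x x 1 ≠ 0 := by
          simp only [f, inv_one, adRep_one, ContinuousLinearMap.id_apply]
          rw [inner_self_ne_zero]
          simpa using hne
        exact ((hcont x x).integral_pos_of_hasCompactSupport_nonneg_nonzero
          (HasCompactSupport.of_compactSpace _) (fun g => real_inner_self_nonneg) h1).ne' hx }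
  refine ⟨core, fun g x y => ?_⟩
  change ∫ h, f (adRep g x) (adRep g y) h ∂μ = ∫ h, f x y h ∂μ
  -- After the substitution `h ↦ g h`, the factor `Ad (g h)⁻¹` absorbs `Ad g`.
  rw [← integral_mul_left_eq_self _ g]
  refine integral_congr_ae (ae_of_all _ fun h => ?_)
  simp only [f]
  have : ∀ z : E, adRep (g * h)⁻¹ (adRep g z) = adRep h⁻¹ z := by
    intro z
    rw [← ContinuousLinearMap.comp_apply, ← adRep_mul]
    congr 2
    group
  rw [this, this]

/-- Infinitesimal form of `Ad`-invariance: the constant `⟨Ad(p) x, Ad(p) y⟩` is differentiated at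
the identity, where the derivative of `Ad` is the bracket. -/
lemma core_inner_lieBr_left (core : InnerProductSpace.Core ℝ E)
    (hcore : ∀ (g : G) (x y : E), core.inner (adRep g x) (adRep g y) = core.inner x y)
    (v x y : E) : core.inner (lieBr G v x) y = -core.inner x (lieBr G v y) := by
  let B : E →L[ℝ] E →L[ℝ] ℝ := LinearMap.toContinuousBilinearMap
    (LinearMap.mk₂ ℝ (fun x y => core.inner x y) core.add_left
      (fun c x y => core.smul_left x y c)
      (fun x y z => by
        have h := fun a b => core.conj_inner_symm a b
        simp only [conj_trivial] at h
        rw [h (y + z) x, core.add_left, h x y, h x z])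
      (fun c x y => by
        have h := fun a b => core.conj_inner_symm a b
        simp only [conj_trivial] at h
        rw [h (c • y) x, core.smul_left, h x y]
        simp))
  have hB : ∀ x y, B x y = core.inner x y := fun x y => rfl
  set c : E := oneCoord G
  set α : E → E →L[ℝ] E := fun x : E => adRep ((extChartAt 𝓘(ℝ, E) (1 : G)).symm x) with hα
  have hαd : HasFDerivAt α (fderiv ℝ α c) c := differentiableAt_adRep_symm.hasFDerivAt
  have hα1 : α c = ContinuousLinearMap.id ℝ E := by
    simp only [hα, c, chart_symm_oneCoord, adRep_one]
  have h1 : ∀ z : E, HasFDerivAt (fun p => α p z) ((fderiv ℝ α c).flip z) c := by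
    intro z
    have h3 := hαd.clm_apply (hasFDerivAt_const z c)
    convert h3 using 1
    ext z
    simp
  have h2 := B.hasFDerivAt_of_bilinear (h1 x) (h1 y)
  have h3 : (fun p => B (α p x) (α p y)) = fun _ => B x y := by
    ext p
    simp only [hB, hα, hcore]
  rw [h3] at h2
  have h4 := congrArg (fun L : E →L[ℝ] ℝ => L v) (h2.unique (hasFDerivAt_const (B x y) c))
  have h5 : ∀ w, fderiv ℝ α c v w = lieBr G v w := fun w => fderiv_adRep_symm v w
  simp [ContinuousLinearMap.precompR_apply, ContinuousLinearMap.precompL_apply, hα1, h5] at h4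
  rw [← hB, ← hB]
  linarith

end InvariantInner

section KillingForm

lemma eq_zero_of_forall_lie_eq_zero (R : Type*) {L : Type*} [CommRing R] [LieRing L]
    [LieAlgebra R L] [LieModule.IsFaithful R L L] {x : L} (h : ∀ y : L, ⁅y, x⁆ = 0) : x = 0 := by
  have h1 : x ∈ LieAlgebra.center R L := by
    rwa [LieModule.mem_maxTrivSubmodule]
  rwa [LieAlgebra.center_eq_bot, LieSubmodule.mem_bot] at h1

variable {E : Type*} [NormedAddCommGroup E] [NormedSpace ℝ E] [FiniteDimensional ℝ E]
  (G : Type*) [TopologicalSpace G]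
  [ChartedSpace E G] [Group G] [LieGroup 𝓘(ℝ, E) ∞ G]

/-- The Lie bracket as a continuous bilinear map. -/
def brL : E →L[ℝ] E →L[ℝ] E :=
  LinearMap.toContinuousBilinearMap
    (LinearMap.mk₂ ℝ (lieBr G)
      (fun x y z => add_lie (L := GroupLieAlgebra 𝓘(ℝ, E) G) (M := GroupLieAlgebra 𝓘(ℝ, E) G) x y z)
      (fun c x y => smul_lie (R := ℝ) (L := GroupLieAlgebra 𝓘(ℝ, E) G)
        (M := GroupLieAlgebra 𝓘(ℝ, E) G) c x y)
      (fun x y z => lie_add (L := GroupLieAlgebra 𝓘(ℝ, E) G) (M := GroupLieAlgebra 𝓘(ℝ, E) G) x y z)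
      (fun c x y => lie_smul (R := ℝ) (L := GroupLieAlgebra 𝓘(ℝ, E) G)
        (M := GroupLieAlgebra 𝓘(ℝ, E) G) c x y))

/-- The negative Killing form as a continuous bilinear map. -/
def kilL : E →L[ℝ] E →L[ℝ] ℝ :=
  LinearMap.toContinuousBilinearMap
    (show E →ₗ[ℝ] E →ₗ[ℝ] ℝ from -killingForm ℝ (GroupLieAlgebra 𝓘(ℝ, E) G))

lemma brL_apply (x y : E) : brL G x y = lieBr G x y := rfl

lemma brL_skew (x y : E) : brL G x y = -brL G y x :=
  (lie_skew (L := GroupLieAlgebra 𝓘(ℝ, E) G) x y).symm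

lemma brL_jacobi (x y z : E) :
    brL G x (brL G y z) = brL G (brL G x y) z + brL G y (brL G x z) :=
  leibniz_lie (L₁ := GroupLieAlgebra 𝓘(ℝ, E) G) (L₂ := GroupLieAlgebra 𝓘(ℝ, E) G)
    (M := GroupLieAlgebra 𝓘(ℝ, E) G) x y z

lemma kilL_comm (x y : E) : kilL G x y = kilL G y x :=
  congrArg Neg.neg (LieModule.traceForm_comm ℝ (GroupLieAlgebra 𝓘(ℝ, E) G)
    (GroupLieAlgebra 𝓘(ℝ, E) G) x y)

lemma kilL_brL (x y z : E) : kilL G (brL G x y) z = -kilL G y (brL G x z) := by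
  have h : kilL G (brL G y x) z = kilL G y (brL G x z) :=
    congrArg Neg.neg (LieModule.traceForm_apply_lie_apply ℝ (GroupLieAlgebra 𝓘(ℝ, E) G)
      (GroupLieAlgebra 𝓘(ℝ, E) G) y x z)
  rw [brL_skew, ← h]
  simp

variable [CompactSpace G]

/-- Each `ad x` is skew for an invariant inner product, so minus the trace of its square is
nonnegative and vanishes only when `ad x = 0`. -/
lemma kilL_self_nonneg_and (x : E) :
    0 ≤ kilL G x x ∧ (kilL G x x = 0 → ∀ y, brL G x y = 0) := by
  obtain ⟨core, hcore⟩ := exists_adRep_invariant_core E G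
  have h := trace_comp_self_of_skew core (brL G x : E →ₗ[ℝ] E)
    (fun y z => core_inner_lieBr_left G core hcore x y z)
  have h1 : kilL G x x = -LinearMap.trace ℝ E ((brL G x : E →ₗ[ℝ] E) ∘ₗ (brL G x : E →ₗ[ℝ] E)) :=
    congrArg Neg.neg (LieModule.traceForm_apply_apply ℝ (GroupLieAlgebra 𝓘(ℝ, E) G)
      (GroupLieAlgebra 𝓘(ℝ, E) G) x x)
  refine ⟨by rw [h1]; linarith [h.1], fun h0 y => ?_⟩
  have h2 := h.2 (by linarith)
  exact congrArg (fun f : E →ₗ[ℝ] E => f y) h2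

lemma kilL_self_nonneg (x : E) : 0 ≤ kilL G x x := (kilL_self_nonneg_and G x).1

/-- A null vector has `ad x = 0`, hence is central, and a semisimple Lie algebra has trivial centre.
-/
lemma kilL_definite [LieAlgebra.IsSemisimple ℝ (GroupLieAlgebra 𝓘(ℝ, E) G)] (x : E)
    (hx : kilL G x x = 0) : x = 0 := by
  have h := (kilL_self_nonneg_and G x).2 hx
  have h2 : ∀ y : E, brL G y x = 0 := fun y => by rw [brL_skew, h, neg_zero]
  exact eq_zero_of_forall_lie_eq_zero ℝ (L := GroupLieAlgebra 𝓘(ℝ, E) G) h2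

/-- Since `odot` is a choice, its defining property holds once some bilinear map has it.
Definiteness makes the form an isomorphism onto the dual, and the functional `X ↦ ⟨X·v, w⟩` is
pulled back through it. -/
lemma odot_spec [LieAlgebra.IsSemisimple ℝ (GroupLieAlgebra 𝓘(ℝ, E) G)]
    {V : Type*} [NormedAddCommGroup V] [InnerProductSpace ℝ V] [FiniteDimensional ℝ V]
    (ρ : G →* (V →L[ℝ] V)) (x : E) (v w : V) :
    kilL G x (odot ρ v w) = inner ℝ (actL ρ x v) w := by
  let K : E →ₗ[ℝ] Module.Dual ℝ E :=
    show E →ₗ[ℝ] E →ₗ[ℝ] ℝ from -killingForm ℝ (GroupLieAlgebra 𝓘(ℝ, E) G)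
  have hK : ∀ x y, K x y = kilL G x y := fun x y => rfl
  have hinj : Function.Injective K := by
    rw [← LinearMap.ker_eq_bot, LinearMap.ker_eq_bot']
    intro y hy
    refine kilL_definite G y ?_
    rw [← hK, hy]
    rfl
  let e : E ≃ₗ[ℝ] Module.Dual ℝ E :=
    LinearEquiv.ofInjectiveOfFinrankEq K hinj Subspace.dual_finrank_eq.symm
  have he : ∀ l y, kilL G y (e.symm l) = l y := by
    intro l y
    rw [kilL_comm, ← hK]
    change (e (e.symm l)) y = l y
    rw [e.apply_symm_apply]
  let B : V →ₗ[ℝ] V →ₗ[ℝ] E := LinearMap.mk₂ ℝ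
    (fun v w => e.symm ((innerₗ V w).comp ((actL ρ : E →L[ℝ] V →L[ℝ] V).flip v).toLinearMap))
    (fun v₁ v₂ w => by
      rw [← map_add]
      congr 1
      ext y
      simp [inner_add_right])
    (fun c v w => by
      rw [← map_smul]
      congr 1
      ext y
      simp)
    (fun v w₁ w₂ => by
      rw [← map_add]
      congr 1
      ext y
      simp)
    (fun c v w => by
      rw [← map_smul]
      congr 1
      ext y
      simp)
  have hB : ∀ (X : E) (v w : V), lieInner G X (B v w) = inner ℝ (act ρ X v) w := by
    intro X v w
    have := he ((innerₗ V w).comp ((actL ρ : E →L[ℝ] V →L[ℝ] V).flip v).toLinearMap) X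
    rw [real_inner_comm]
    exact this
  exact Classical.epsilon_spec (p := fun B : V →ₗ[ℝ] V →ₗ[ℝ] E =>
    ∀ (X : E) (v w : V), lieInner G X (B v w) = inner ℝ (act ρ X v) w) ⟨B, hB⟩ x v w

end KillingForm

/-! ### Calculus of directional derivatives -/

section DirectionalDerivative

open Filter Topology

variable {M F F₁ F₂ F₃ : Type*} [NormedAddCommGroup M] [NormedSpace ℝ M]
  [NormedAddCommGroup F] [NormedSpace ℝ F] [NormedAddCommGroup F₁] [NormedSpace ℝ F₁]
  [NormedAddCommGroup F₂] [NormedSpace ℝ F₂] [NormedAddCommGroup F₃] [NormedSpace ℝ F₃]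

/-- The directional derivative in the direction `v`, as a function of the base point. -/
abbrev dirDeriv (v : M) (f : M → F) (p : M) : F := lineDeriv ℝ f p v

lemma dirDeriv_eq_fderiv {v : M} {f : M → F} {p : M} (hf : DifferentiableAt ℝ f p) :
    dirDeriv v f p = fderiv ℝ f p v := hf.lineDeriv_eq_fderiv

lemma eventually_differentiableAt {f : M → F} {p : M} (hf : ContDiffAt ℝ 1 f p) :
    ∀ᶠ q in 𝓝 p, DifferentiableAt ℝ f q := by
  filter_upwards [hf.eventually (by simp)] with q hq
  exact hq.differentiableAt (by simp)

lemma dirDeriv_eventuallyEq {v : M} {f : M → F} {p : M} (hf : ContDiffAt ℝ 1 f p) :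
    dirDeriv v f =ᶠ[𝓝 p] fun q => fderiv ℝ f q v := by
  filter_upwards [eventually_differentiableAt hf] with q hq
  exact hq.lineDeriv_eq_fderiv

lemma contDiffAt_dirDeriv (v : M) {f : M → F} {p : M} {k m : ℕ∞ω} (hf : ContDiffAt ℝ m f p)
    (hkm : k + 1 ≤ m) : ContDiffAt ℝ k (dirDeriv v f) p := by
  have h1 : ContDiffAt ℝ 1 f p := hf.of_le (le_trans (by simp) hkm)
  refine ContDiffAt.congr_of_eventuallyEq ?_ (dirDeriv_eventuallyEq h1)
  exact (hf.fderiv_right hkm).clm_apply contDiffAt_const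

lemma dirDeriv_comm (v w : M) {f : M → F} {p : M} (hf : ContDiffAt ℝ 2 f p) :
    dirDeriv v (dirDeriv w f) p = dirDeriv w (dirDeriv v f) p := by
  have h1 : ContDiffAt ℝ 1 f p := hf.of_le (by norm_num)
  have h2 : DifferentiableAt ℝ (fderiv ℝ f) p :=
    (hf.fderiv_right (m := 1) (by norm_num)).differentiableAt (by simp)
  have h3 : ∀ v w : M, dirDeriv v (dirDeriv w f) p = fderiv ℝ (fderiv ℝ f) p v w := by
    intro v w
    have h4 : DifferentiableAt ℝ (dirDeriv w f) p :=
      (contDiffAt_dirDeriv w (k := 1) hf (by norm_num)).differentiableAt (by simp)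
    rw [dirDeriv_eq_fderiv h4, (dirDeriv_eventuallyEq h1).fderiv_eq,
      (h2.hasFDerivAt.clm_apply (hasFDerivAt_const w p)).fderiv]
    simp
  rw [h3, h3]
  exact (hf.isSymmSndFDerivAt (by rw [minSmoothness_of_isRCLikeNormedField])) v w

lemma dirDeriv_add {v : M} {f g : M → F} {p : M} (hf : DifferentiableAt ℝ f p)
    (hg : DifferentiableAt ℝ g p) :
    dirDeriv v (fun q => f q + g q) p = dirDeriv v f p + dirDeriv v g p := by
  rw [dirDeriv_eq_fderiv hf, dirDeriv_eq_fderiv hg, dirDeriv_eq_fderiv (hf.fun_add hg),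
    fderiv_fun_add hf hg]
  rfl

lemma dirDeriv_sub {v : M} {f g : M → F} {p : M} (hf : DifferentiableAt ℝ f p)
    (hg : DifferentiableAt ℝ g p) :
    dirDeriv v (fun q => f q - g q) p = dirDeriv v f p - dirDeriv v g p := by
  rw [dirDeriv_eq_fderiv hf, dirDeriv_eq_fderiv hg, dirDeriv_eq_fderiv (hf.fun_sub hg),
    fderiv_fun_sub hf hg]
  rfl

lemma dirDeriv_neg {v : M} {f : M → F} {p : M} (hf : DifferentiableAt ℝ f p) :
    dirDeriv v (fun q => -f q) p = -dirDeriv v f p := by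
  rw [dirDeriv_eq_fderiv hf, dirDeriv_eq_fderiv hf.fun_neg, fderiv_fun_neg]
  rfl

lemma dirDeriv_sum {ι : Type*} {s : Finset ι} {v : M} {f : ι → M → F} {p : M}
    (hf : ∀ i ∈ s, DifferentiableAt ℝ (f i) p) :
    dirDeriv v (fun q => ∑ i ∈ s, f i q) p = ∑ i ∈ s, dirDeriv v (f i) p := by
  have h := DifferentiableAt.fun_sum hf
  rw [dirDeriv_eq_fderiv h, fderiv_fun_sum hf, sum_apply]
  exact Finset.sum_congr rfl fun i hi => (dirDeriv_eq_fderiv (hf i hi)).symm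

lemma dirDeriv_const_mul {v : M} {f : M → ℝ} {p : M} (c : ℝ) (hf : DifferentiableAt ℝ f p) :
    dirDeriv v (fun q => c * f q) p = c * dirDeriv v f p := by
  rw [dirDeriv_eq_fderiv hf, dirDeriv_eq_fderiv (hf.const_mul c), fderiv_const_mul hf]
  rfl

lemma dirDeriv_mul {v : M} {f g : M → ℝ} {p : M} (hf : DifferentiableAt ℝ f p)
    (hg : DifferentiableAt ℝ g p) :
    dirDeriv v (fun q => f q * g q) p = f p * dirDeriv v g p + g p * dirDeriv v f p := by
  rw [dirDeriv_eq_fderiv hf, dirDeriv_eq_fderiv hg, dirDeriv_eq_fderiv (hf.fun_mul hg),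
    fderiv_fun_mul hf hg]
  rfl

lemma dirDeriv_bilin (B : F₁ →L[ℝ] F₂ →L[ℝ] F₃) {v : M} {f : M → F₁} {g : M → F₂} {p : M}
    (hf : DifferentiableAt ℝ f p) (hg : DifferentiableAt ℝ g p) :
    dirDeriv v (fun q => B (f q) (g q)) p = B (dirDeriv v f p) (g p) + B (f p) (dirDeriv v g p) := by
  have h := B.hasFDerivAt_of_bilinear hf.hasFDerivAt hg.hasFDerivAt
  rw [dirDeriv_eq_fderiv hf, dirDeriv_eq_fderiv hg, dirDeriv_eq_fderiv h.differentiableAt, h.fderiv]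
  simp [ContinuousLinearMap.precompR_apply, ContinuousLinearMap.precompL_apply, add_comm]

lemma contDiffAt_bilin (B : F₁ →L[ℝ] F₂ →L[ℝ] F₃) {f : M → F₁} {g : M → F₂} {p : M} {k : ℕ∞ω}
    (hf : ContDiffAt ℝ k f p) (hg : ContDiffAt ℝ k g p) :
    ContDiffAt ℝ k (fun q => B (f q) (g q)) p :=
  (B.contDiff.contDiffAt.comp p hf).clm_apply hg

end DirectionalDerivative

/-- The algebra underlying the Yang–Mills–Higgs equations: a Lie algebra with invariant
nonnegative form acting by skew maps on an inner product space, with moment map `od`. -/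
structure GaugeAlgebra (E V : Type*) [NormedAddCommGroup E] [NormedSpace ℝ E]
    [NormedAddCommGroup V] [InnerProductSpace ℝ V] where
  br : E →L[ℝ] E →L[ℝ] E
  kil : E →L[ℝ] E →L[ℝ] ℝ
  act : E →L[ℝ] V →L[ℝ] V
  od : V → V → E
  br_skew : ∀ x y, br x y = -br y x
  jacobi : ∀ x y z, br x (br y z) = br (br x y) z + br y (br x z)
  kil_comm : ∀ x y, kil x y = kil y x
  kil_br : ∀ x y z, kil (br x y) z = -kil y (br x z)
  kil_nonneg : ∀ x, 0 ≤ kil x x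
  act_br : ∀ x y v, act (br x y) v = act x (act y v) - act y (act x v)
  act_skew : ∀ x v w, inner ℝ (act x v) w = -inner ℝ v (act x w)
  kil_od : ∀ x v w, kil x (od v w) = inner ℝ (act x v) w

/-! ### Covariant derivatives, Bianchi identity and stress identity -/

namespace GaugeAlgebra

open Filter Topology

variable {M E V : Type*} [NormedAddCommGroup M] [NormedSpace ℝ M]
  [NormedAddCommGroup E] [NormedSpace ℝ E]
  [NormedAddCommGroup V] [InnerProductSpace ℝ V] (𝔞 : GaugeAlgebra E V)

/-- The covariant derivative of an `E`-valued function in the direction `v`, along which the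
potential is `a`. -/
def covE (v : M) (a ξ : M → E) (p : M) : E := dirDeriv v ξ p + 𝔞.br (a p) (ξ p)

/-- The covariant derivative of a `V`-valued function in the direction `v`, along which the
potential is `a`. -/
def covV (v : M) (a : M → E) (u : M → V) (p : M) : V := dirDeriv v u p + 𝔞.act (a p) (u p)

/-- The curvature in the directions `v` and `w`, along which the potentials are `a` and `b`. -/
def curv (v : M) (a : M → E) (w : M) (b : M → E) (p : M) : E :=
  dirDeriv v b p - dirDeriv w a p + 𝔞.br (a p) (b p)

variable {𝔞} {p : M} {u : M → V} {a b c ξ η : M → E} {s t : M → V} {v w z : M}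

lemma curv_neg : 𝔞.curv w b v a = fun q => -𝔞.curv v a w b q := by
  ext q
  simp only [curv]
  rw [𝔞.br_skew]
  abel

lemma contDiffAt_curv {k m : ℕ∞ω} (hkm : k + 1 ≤ m) (ha : ContDiffAt ℝ m a p)
    (hb : ContDiffAt ℝ m b p) : ContDiffAt ℝ k (𝔞.curv v a w b) p := by
  have hk : k ≤ m := le_trans le_self_add hkm
  exact ((contDiffAt_dirDeriv v hb hkm).sub (contDiffAt_dirDeriv w ha hkm)).add
    (contDiffAt_bilin 𝔞.br (ha.of_le hk) (hb.of_le hk))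

lemma contDiffAt_covV {k m : ℕ∞ω} (hkm : k + 1 ≤ m) (ha : ContDiffAt ℝ m a p)
    (hu : ContDiffAt ℝ m u p) : ContDiffAt ℝ k (𝔞.covV v a u) p := by
  have hk : k ≤ m := le_trans le_self_add hkm
  exact (contDiffAt_dirDeriv v hu hkm).add (contDiffAt_bilin 𝔞.act (ha.of_le hk) (hu.of_le hk))

lemma covE_neg (hξ : DifferentiableAt ℝ ξ p) :
    𝔞.covE v a (fun q => -ξ q) p = -𝔞.covE v a ξ p := by
  simp only [covE, dirDeriv_neg hξ, map_neg]
  abel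

/-- The potential `a` is arbitrary: invariance of the form makes the two bracket terms cancel. -/
lemma dirDeriv_kil (hξ : DifferentiableAt ℝ ξ p) (hη : DifferentiableAt ℝ η p) :
    dirDeriv v (fun q => 𝔞.kil (ξ q) (η q)) p =
      𝔞.kil (𝔞.covE v a ξ p) (η p) + 𝔞.kil (ξ p) (𝔞.covE v a η p) := by
  rw [dirDeriv_bilin 𝔞.kil hξ hη]
  simp only [covE, map_add, add_apply, 𝔞.kil_br]
  ring

lemma dirDeriv_inner (hs : DifferentiableAt ℝ s p) (ht : DifferentiableAt ℝ t p) :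
    dirDeriv v (fun q => (inner ℝ (s q) (t q) : ℝ)) p =
      inner ℝ (𝔞.covV v a s p) (t p) + inner ℝ (s p) (𝔞.covV v a t p) := by
  have h := hs.hasFDerivAt.inner ℝ ht.hasFDerivAt
  rw [dirDeriv_eq_fderiv h.differentiableAt, h.fderiv]
  simp only [covV, inner_add_left, inner_add_right, 𝔞.act_skew, dirDeriv_eq_fderiv hs,
    dirDeriv_eq_fderiv ht, ContinuousLinearMap.comp_apply, ContinuousLinearMap.prod_apply,
    fderivInnerCLM_apply]
  ring

lemma dirDeriv_comp_norm_sq {W : ℝ → ℝ} (hW : ContDiff ℝ 1 W) (hu : DifferentiableAt ℝ u p) :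
    dirDeriv v (fun q => W (‖u q‖ ^ 2)) p =
      2 * deriv W (‖u p‖ ^ 2) * inner ℝ (u p) (𝔞.covV v a u p) := by
  have h1 := dirDeriv_inner (𝔞 := 𝔞) (v := v) (a := a) hu hu
  simp only [real_inner_self_eq_norm_sq] at h1
  have h2 : DifferentiableAt ℝ (fun q => ‖u q‖ ^ 2) p := hu.norm_sq ℝ
  have h3 : HasFDerivAt (fun q => W (‖u q‖ ^ 2))
      (deriv W (‖u p‖ ^ 2) • fderiv ℝ (fun q => ‖u q‖ ^ 2) p) p :=
    ((hW.differentiable (by simp) _).hasDerivAt).comp_hasFDerivAt p h2.hasFDerivAt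
  rw [dirDeriv_eq_fderiv h3.differentiableAt, h3.fderiv]
  rw [dirDeriv_eq_fderiv h2, real_inner_comm] at h1
  simp only [smul_apply, smul_eq_mul, h1]
  ring

lemma dirDeriv_curv (ha : ContDiffAt ℝ 2 a p) (hb : ContDiffAt ℝ 2 b p) :
    dirDeriv z (𝔞.curv v a w b) p = dirDeriv z (dirDeriv v b) p - dirDeriv z (dirDeriv w a) p +
      (𝔞.br (dirDeriv z a p) (b p) + 𝔞.br (a p) (dirDeriv z b p)) := by
  have hv : DifferentiableAt ℝ (dirDeriv v b) p :=
    (contDiffAt_dirDeriv v (k := 1) hb (by norm_num)).differentiableAt (by simp)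
  have hw : DifferentiableAt ℝ (dirDeriv w a) p :=
    (contDiffAt_dirDeriv w (k := 1) ha (by norm_num)).differentiableAt (by simp)
  have ha' := ha.differentiableAt (by simp)
  have hb' := hb.differentiableAt (by simp)
  have hab : DifferentiableAt ℝ (fun q => 𝔞.br (a q) (b q)) p :=
    (contDiffAt_bilin 𝔞.br ha hb).differentiableAt (by simp)
  rw [← dirDeriv_bilin 𝔞.br ha' hb', ← dirDeriv_sub hv hw, ← dirDeriv_add (hv.fun_sub hw) hab]
  rfl

/-- The Bianchi identity. -/
lemma bianchi (ha : ContDiffAt ℝ 2 a p) (hb : ContDiffAt ℝ 2 b p) (hc : ContDiffAt ℝ 2 c p) :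
    𝔞.covE v a (𝔞.curv w b z c) p + 𝔞.covE w b (𝔞.curv z c v a) p +
      𝔞.covE z c (𝔞.curv v a w b) p = 0 := by
  simp only [covE, dirDeriv_curv ha hb, dirDeriv_curv hb hc, dirDeriv_curv hc ha]
  -- Second derivatives cancel by symmetry, triple brackets by the Jacobi identity, and brackets
  -- with one derivative by skewness.
  rw [dirDeriv_comm v w hc, dirDeriv_comm v z hb, dirDeriv_comm w z ha]
  simp only [curv, map_add, map_sub]
  rw [𝔞.jacobi (a p) (b p) (c p), 𝔞.br_skew (c p) (𝔞.br (a p) (b p)),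
    𝔞.br_skew (c p) (a p), 𝔞.br_skew (dirDeriv w c p) (a p), 𝔞.br_skew (dirDeriv v b p) (c p),
    𝔞.br_skew (dirDeriv z a p) (b p)]
  simp only [map_neg]
  abel

/-- The commutator of covariant derivatives is the action of the curvature. -/
lemma covV_comm (ha : ContDiffAt ℝ 2 a p) (hb : ContDiffAt ℝ 2 b p) (hu : ContDiffAt ℝ 2 u p) :
    𝔞.covV v a (𝔞.covV w b u) p - 𝔞.covV w b (𝔞.covV v a u) p =
      𝔞.act (𝔞.curv v a w b p) (u p) := by
  have key : ∀ {v w : M} {a b : M → E}, ContDiffAt ℝ 2 a p → ContDiffAt ℝ 2 b p →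
      dirDeriv v (𝔞.covV w b u) p = dirDeriv v (dirDeriv w u) p +
        (𝔞.act (dirDeriv v b p) (u p) + 𝔞.act (b p) (dirDeriv v u p)) := by
    intro v w a b ha hb
    have hw : DifferentiableAt ℝ (dirDeriv w u) p :=
      (contDiffAt_dirDeriv w (k := 1) hu (by norm_num)).differentiableAt (by simp)
    have hbu : DifferentiableAt ℝ (fun q => 𝔞.act (b q) (u q)) p :=
      (contDiffAt_bilin 𝔞.act hb hu).differentiableAt (by simp)
    rw [← dirDeriv_bilin 𝔞.act (hb.differentiableAt (by simp)) (hu.differentiableAt (by simp)),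
      ← dirDeriv_add hw hbu]
    rfl
  change dirDeriv v (𝔞.covV w b u) p + 𝔞.act (a p) (𝔞.covV w b u p) -
    (dirDeriv w (𝔞.covV v a u) p + 𝔞.act (b p) (𝔞.covV v a u p)) = _
  rw [key ha hb, key hb ha, dirDeriv_comm v w hu]
  simp only [covV, curv, map_add, map_sub, add_apply, sub_apply, 𝔞.act_br]
  abel

variable {ι : Type*} [Fintype ι] (e : ι → M) (A : ι → M → E)

/-- The stress identity: the divergence of `∑ₖ ⟨Fᵢₖ, F_{bk}⟩ + ⟨∇ᵢu, ∇_b u⟩` minus the derivative of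
the energy density along `(z, b)`, in terms of the Euler–Lagrange expressions. -/
lemma div_stress {W : ℝ → ℝ} (hW : ContDiff ℝ 1 W) (hA : ∀ i, ContDiffAt ℝ 2 (A i) p)
    (hb : ContDiffAt ℝ 2 b p) (hu : ContDiffAt ℝ 2 u p) :
    ∑ i, dirDeriv (e i) (fun q =>
        ∑ k, 𝔞.kil (𝔞.curv (e i) (A i) (e k) (A k) q) (𝔞.curv z b (e k) (A k) q) +
          inner ℝ (𝔞.covV (e i) (A i) u q) (𝔞.covV z b u q)) p -
      dirDeriv z (fun q => 1 / 2 * (1 / 2 * ∑ i, ∑ k,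
        𝔞.kil (𝔞.curv (e i) (A i) (e k) (A k) q) (𝔞.curv (e i) (A i) (e k) (A k) q) +
          ∑ i, ‖𝔞.covV (e i) (A i) u q‖ ^ 2) + W (‖u q‖ ^ 2)) p =
    ∑ k, 𝔞.kil (∑ i, 𝔞.covE (e i) (A i) (𝔞.curv (e i) (A i) (e k) (A k)) p -
        𝔞.od (u p) (𝔞.covV (e k) (A k) u p)) (𝔞.curv z b (e k) (A k) p) +
      inner ℝ (∑ i, 𝔞.covV (e i) (A i) (𝔞.covV (e i) (A i) u) p -
        (2 * deriv W (‖u p‖ ^ 2)) • u p) (𝔞.covV z b u p) := by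
  set F : ι → ι → M → E := fun i k => 𝔞.curv (e i) (A i) (e k) (A k) with hF
  set Fb : ι → M → E := fun k => 𝔞.curv z b (e k) (A k) with hFb
  set D : ι → M → V := fun i => 𝔞.covV (e i) (A i) u with hD
  set Db : M → V := 𝔞.covV z b u with hDb
  have dF : ∀ i k, DifferentiableAt ℝ (F i k) p := fun i k =>
    (contDiffAt_curv (k := 1) (by norm_num) (hA i) (hA k)).differentiableAt (by simp)
  have dFb : ∀ k, DifferentiableAt ℝ (Fb k) p := fun k =>
    (contDiffAt_curv (k := 1) (by norm_num) hb (hA k)).differentiableAt (by simp)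
  have dD : ∀ i, DifferentiableAt ℝ (D i) p := fun i =>
    (contDiffAt_covV (k := 1) (by norm_num) (hA i) hu).differentiableAt (by simp)
  have dDb : DifferentiableAt ℝ Db p :=
    (contDiffAt_covV (k := 1) (by norm_num) hb hu).differentiableAt (by simp)
  have du : DifferentiableAt ℝ u p := hu.differentiableAt (by simp)
  have dkil : ∀ {f g : M → E}, DifferentiableAt ℝ f p → DifferentiableAt ℝ g p →
      DifferentiableAt ℝ (fun q => 𝔞.kil (f q) (g q)) p := fun hf hg =>
    (𝔞.kil.hasFDerivAt_of_bilinear hf.hasFDerivAt hg.hasFDerivAt).differentiableAt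
  have dW : DifferentiableAt ℝ (fun q => W (‖u q‖ ^ 2)) p :=
    (hW.differentiable (by simp) _).comp p (du.norm_sq ℝ)
  have h1 : ∀ i, dirDeriv (e i) (fun q => ∑ k, 𝔞.kil (F i k q) (Fb k q) +
      inner ℝ (D i q) (Db q)) p =
      ∑ k, (𝔞.kil (𝔞.covE (e i) (A i) (F i k) p) (Fb k p) +
        𝔞.kil (F i k p) (𝔞.covE (e i) (A i) (Fb k) p)) +
      (inner ℝ (𝔞.covV (e i) (A i) (D i) p) (Db p) +
        inner ℝ (D i p) (𝔞.covV (e i) (A i) Db p)) := by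
    intro i
    rw [dirDeriv_add (DifferentiableAt.fun_sum fun k _ => dkil (dF i k) (dFb k))
      ((dD i).inner ℝ dDb), dirDeriv_sum fun k _ => dkil (dF i k) (dFb k),
      dirDeriv_inner (𝔞 := 𝔞) (a := A i) (dD i) dDb]
    congr 1
    exact Finset.sum_congr rfl fun k _ => dirDeriv_kil (dF i k) (dFb k)
  have h2 : dirDeriv z (fun q => 1 / 2 * (1 / 2 * ∑ i, ∑ k, 𝔞.kil (F i k q) (F i k q) +
      ∑ i, ‖D i q‖ ^ 2) + W (‖u q‖ ^ 2)) p =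
      1 / 2 * (1 / 2 * ∑ i, ∑ k, 2 * 𝔞.kil (F i k p) (𝔞.covE z b (F i k) p) +
        ∑ i, 2 * inner ℝ (D i p) (𝔞.covV z b (D i) p)) +
      2 * deriv W (‖u p‖ ^ 2) * inner ℝ (u p) (Db p) := by
    have d1 : ∀ i, DifferentiableAt ℝ (fun q => ∑ k, 𝔞.kil (F i k q) (F i k q)) p := fun i =>
      DifferentiableAt.fun_sum fun k _ => dkil (dF i k) (dF i k)
    have d2 : DifferentiableAt ℝ (fun q => ∑ i, ∑ k, 𝔞.kil (F i k q) (F i k q)) p :=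
      DifferentiableAt.fun_sum fun i _ => d1 i
    have d3 : DifferentiableAt ℝ (fun q => ∑ i, ‖D i q‖ ^ 2) p :=
      DifferentiableAt.fun_sum fun i _ => (dD i).norm_sq ℝ
    have h3 : ∀ i, dirDeriv z (fun q => ∑ k, 𝔞.kil (F i k q) (F i k q)) p =
        ∑ k, 2 * 𝔞.kil (F i k p) (𝔞.covE z b (F i k) p) := by
      intro i
      rw [dirDeriv_sum fun k _ => dkil (dF i k) (dF i k)]
      refine Finset.sum_congr rfl fun k _ => ?_
      rw [dirDeriv_kil (a := b) (dF i k) (dF i k), 𝔞.kil_comm (𝔞.covE z b (F i k) p)]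
      ring
    have h4 : ∀ i, dirDeriv z (fun q => ‖D i q‖ ^ 2) p =
        2 * inner ℝ (D i p) (𝔞.covV z b (D i) p) := by
      intro i
      have h3 := dirDeriv_inner (𝔞 := 𝔞) (v := z) (a := b) (dD i) (dD i)
      simp only [real_inner_self_eq_norm_sq] at h3
      rw [h3, real_inner_comm]
      ring
    rw [dirDeriv_add (((d2.const_mul _).fun_add d3).const_mul _) dW,
      dirDeriv_const_mul _ ((d2.const_mul _).fun_add d3), dirDeriv_add (d2.const_mul _) d3,
      dirDeriv_const_mul _ d2, dirDeriv_sum fun i _ => d1 i,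
      dirDeriv_sum fun i _ => (dD i).norm_sq ℝ, dirDeriv_comp_norm_sq (𝔞 := 𝔞) (a := b) hW du]
    simp only [h3, h4, hDb]
  -- By the Bianchi identity `∇_b Fᵢₖ = ∇ᵢF_{bk} - ∇ₖF_{bi}`. Paired with the antisymmetric `Fᵢₖ`,
  -- both terms on the right contribute equally, whence the factor `1/2`. This is the derivative of
  -- the curvature energy.
  have h3 : ∑ i, ∑ k, 𝔞.kil (F i k p) (𝔞.covE (e i) (A i) (Fb k) p) =
      1 / 2 * ∑ i, ∑ k, 𝔞.kil (F i k p) (𝔞.covE z b (F i k) p) := by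
    have h4 : ∑ i, ∑ k, 𝔞.kil (F i k p) (𝔞.covE (e i) (A i) (Fb k) p) =
        -∑ i, ∑ k, 𝔞.kil (F i k p) (𝔞.covE (e k) (A k) (Fb i) p) := by
      rw [Finset.sum_comm, ← Finset.sum_neg_distrib]
      refine Finset.sum_congr rfl fun i _ => ?_
      rw [← Finset.sum_neg_distrib]
      refine Finset.sum_congr rfl fun k _ => ?_
      have : F k i p = -F i k p := congrFun curv_neg p
      rw [this]
      simp
    have h5 : ∀ i k, 𝔞.covE z b (F i k) p =
        𝔞.covE (e i) (A i) (Fb k) p - 𝔞.covE (e k) (A k) (Fb i) p := by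
      intro i k
      have h6 := bianchi (𝔞 := 𝔞) (v := z) (w := e i) (z := e k) hb (hA i) (hA k)
      have h7 : 𝔞.covE (e i) (A i) (𝔞.curv (e k) (A k) z b) p =
          -𝔞.covE (e i) (A i) (Fb k) p := by
        rw [curv_neg, covE_neg (dFb k)]
      rw [h7] at h6
      rw [eq_sub_iff_add_eq, ← sub_eq_zero, ← h6]
      simp only [hF, hFb]
      abel
    simp only [h5, map_sub, Finset.sum_sub_distrib]
    linarith
  -- Exchanging `∇ᵢ` and `∇_b` costs the action of `Fᵢ_b` on `u`. The defining property of `od`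
  -- turns this into the source term of the gauge equation, so the two couplings match.
  have h4 : ∑ i, inner ℝ (D i p) (𝔞.covV (e i) (A i) Db p) =
      ∑ i, inner ℝ (D i p) (𝔞.covV z b (D i) p) -
        ∑ k, 𝔞.kil (𝔞.od (u p) (D k p)) (Fb k p) := by
    rw [← Finset.sum_sub_distrib]
    refine Finset.sum_congr rfl fun i _ => ?_
    have h5 := covV_comm (𝔞 := 𝔞) (v := e i) (w := z) (hA i) hb hu
    have h6 : 𝔞.curv (e i) (A i) z b p = -Fb i p := congrFun curv_neg p
    rw [h6] at h5
    rw [sub_eq_iff_eq_add.mp h5, inner_add_right, 𝔞.kil_comm, 𝔞.kil_od, real_inner_comm _ (D i p)]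
    simp only [map_neg, neg_apply, inner_neg_left]
    ring
  change ∑ i, dirDeriv (e i) (fun q => ∑ k, 𝔞.kil (F i k q) (Fb k q) +
      inner ℝ (D i q) (Db q)) p - dirDeriv z (fun q => 1 / 2 * (1 / 2 * ∑ i, ∑ k,
        𝔞.kil (F i k q) (F i k q) + ∑ i, ‖D i q‖ ^ 2) + W (‖u q‖ ^ 2)) p =
    ∑ k, 𝔞.kil (∑ i, 𝔞.covE (e i) (A i) (F i k) p - 𝔞.od (u p) (D k p)) (Fb k p) +
      inner ℝ (∑ i, 𝔞.covV (e i) (A i) (D i) p - (2 * deriv W (‖u p‖ ^ 2)) • u p) (Db p)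
  simp only [h1]
  rw [h2]
  simp only [Finset.sum_add_distrib, map_sub, map_sum, sub_apply, sum_apply,
    Finset.sum_sub_distrib, inner_sub_left, sum_inner, real_inner_smul_left, ← Finset.mul_sum]
  rw [h3, h4, Finset.sum_comm (f := fun i k => 𝔞.kil (𝔞.covE (e i) (A i) (F i k) p) (Fb k p))]
  ring

end GaugeAlgebra

/-- An energy density `e` with dissipation `K`, energy flux `P` and stress tensor `Q - e δ` on the
space-time slab `ℝⁿ × (a, T)`. -/
structure IsStressBalance {n : ℕ} (e K w : Spacetime n → ℝ) (P : Fin n → Spacetime n → ℝ)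
    (Q : Fin n → Fin n → Spacetime n → ℝ) (a T : ℝ) : Prop where
  e_smooth : ContDiffOn ℝ 1 e (univ ×ˢ Ioo a T)
  P_smooth : ∀ i, ContDiffOn ℝ 1 (P i) (univ ×ˢ Ioo a T)
  Q_smooth : ∀ i j, ContDiffOn ℝ 1 (Q i j) (univ ×ˢ Ioo a T)
  K_cont : ContinuousOn K (univ ×ˢ Ioo a T)
  w_cont : ContinuousOn w (univ ×ˢ Ioo a T)
  e_nonneg : ∀ p, 0 ≤ e p
  w_nonneg : ∀ p, 0 ≤ w p
  energy_eq : ∀ p ∈ (univ ×ˢ Ioo a T : Set (Spacetime n)), dt e p = ∑ i, dx i (P i) p - K p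
  stress_eq : ∀ p ∈ (univ ×ˢ Ioo a T : Set (Spacetime n)), ∀ j,
    ∑ i, dx i (Q i j) p - dx j e p = P j p
  form_nonneg : ∀ p (s : ℝ) (v : Fin n → ℝ),
    0 ≤ s ^ 2 * K p + 2 * s * ∑ i, v i * P i p + ∑ i, ∑ j, v i * v j * Q i j p
  stress_le : ∀ p (v : Fin n → ℝ), ∑ i, ∑ j, v i * v j * Q i j p ≤ 4 * e p * ∑ i, v i ^ 2
  symm : ∀ i j p, Q i j p = Q j i p
  trace : ∀ p, ∑ i, Q i i p = 4 * e p - w p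

lemma sum_sum_Ioi_of_symm {n : ℕ} (f : Fin n → Fin n → ℝ) (hs : ∀ i j, f i j = f j i)
    (h0 : ∀ i, f i i = 0) : ∑ i, ∑ j ∈ Finset.Ioi i, f i j = 1 / 2 * ∑ i, ∑ j, f i j := by
  have h1 : ∀ i, ∑ j, f i j = ∑ j ∈ Finset.Ioi i, f i j + ∑ j ∈ Finset.Iio i, f i j := by
    intro i
    have h2 : (Finset.univ : Finset (Fin n)) = insert i (Finset.Ioi i ∪ Finset.Iio i) := by
      ext j
      simp only [Finset.mem_univ, Finset.mem_insert, Finset.mem_union, Finset.mem_Ioi,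
        Finset.mem_Iio, true_iff]
      rcases lt_trichotomy i j with h | h | h
      · exact Or.inr (Or.inl h)
      · exact Or.inl h.symm
      · exact Or.inr (Or.inr h)
    have h3 : Disjoint (Finset.Ioi i) (Finset.Iio i) := by
      rw [Finset.disjoint_left]
      intro j hj hj'
      simp only [Finset.mem_Ioi, Finset.mem_Iio] at hj hj'
      exact lt_asymm hj hj'
    rw [h2, Finset.sum_insert (by simp), h0, zero_add, Finset.sum_union h3]
  have h2 : ∑ i, ∑ j ∈ Finset.Iio i, f i j = ∑ i, ∑ j ∈ Finset.Ioi i, f i j := by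
    rw [Finset.sum_comm' (t' := Finset.univ) (s' := fun j => Finset.Ioi j) (by simp)]
    exact Finset.sum_congr rfl fun i _ => Finset.sum_congr rfl fun j _ => hs j i
  simp only [h1, Finset.sum_add_distrib, h2]
  ring

namespace GaugeAlgebra

variable {E V : Type*} [NormedAddCommGroup E] [NormedSpace ℝ E]
  [NormedAddCommGroup V] [InnerProductSpace ℝ V] (𝔞 : GaugeAlgebra E V) {ι κ : Type*} [Fintype ι]
  [Fintype κ]

/-- Expansion of the square of `s (a, b) + ∑ᵢ vᵢ (Fᵢ, Dᵢ)`. -/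
lemma expand_square (s : ℝ) (v : ι → ℝ) (a : κ → E) (F : ι → κ → E) (b : V) (D : ι → V) :
    (∑ k, 𝔞.kil (s • a k + ∑ i, v i • F i k) (s • a k + ∑ i, v i • F i k)) +
      ‖s • b + ∑ i, v i • D i‖ ^ 2 =
    s ^ 2 * (∑ k, 𝔞.kil (a k) (a k) + ‖b‖ ^ 2) +
      2 * s * ∑ i, v i * (∑ k, 𝔞.kil (F i k) (a k) + inner ℝ (D i) b) +
      ∑ i, ∑ j, v i * v j * (∑ k, 𝔞.kil (F i k) (F j k) + inner ℝ (D i) (D j)) := by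
  have h1 : ∀ k, 𝔞.kil (s • a k + ∑ i, v i • F i k) (s • a k + ∑ i, v i • F i k) =
      s ^ 2 * 𝔞.kil (a k) (a k) + 2 * s * ∑ i, v i * 𝔞.kil (F i k) (a k) +
        ∑ i, ∑ j, v i * v j * 𝔞.kil (F i k) (F j k) := by
    intro k
    simp only [map_add, map_smul, add_apply, smul_apply, smul_eq_mul, map_sum, sum_apply,
      𝔞.kil_comm (a k), mul_add, Finset.sum_add_distrib]
    have e1 : ∑ i, v i * (s * 𝔞.kil (F i k) (a k)) = s * ∑ i, v i * 𝔞.kil (F i k) (a k) := by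
      rw [Finset.mul_sum]
      exact Finset.sum_congr rfl fun i _ => by ring
    have e2 : ∑ i, v i * ∑ j, v j * 𝔞.kil (F j k) (F i k) =
        ∑ i, ∑ j, v i * v j * 𝔞.kil (F i k) (F j k) := by
      simp only [Finset.mul_sum]
      exact Finset.sum_congr rfl fun i _ => Finset.sum_congr rfl fun j _ => by
        rw [𝔞.kil_comm]
        ring
    rw [e1, e2]
    ring
  have h2 : ‖s • b + ∑ i, v i • D i‖ ^ 2 = s ^ 2 * ‖b‖ ^ 2 + 2 * s * ∑ i, v i * inner ℝ (D i) b +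
      ∑ i, ∑ j, v i * v j * inner ℝ (D i) (D j) := by
    rw [norm_add_sq_real, norm_smul, mul_pow, Real.norm_eq_abs, sq_abs,
      ← real_inner_self_eq_norm_sq (∑ i, v i • D i)]
    simp only [inner_sum, sum_inner, real_inner_smul_left, real_inner_smul_right, Finset.mul_sum]
    congr 1
    · congr 1
      exact Finset.sum_congr rfl fun i _ => by rw [real_inner_comm]; ring
    · rw [Finset.sum_comm]
      exact Finset.sum_congr rfl fun i _ => Finset.sum_congr rfl fun j _ => by ring
  simp only [h1, h2, Finset.sum_add_distrib, mul_add, Finset.mul_sum]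
  have h3 : ∀ f : κ → ι → ℝ, ∑ k, ∑ i, f k i = ∑ i, ∑ k, f k i := fun f => Finset.sum_comm
  have h4 : ∀ f : κ → ι → ι → ℝ, ∑ k, ∑ i, ∑ j, f k i j = ∑ i, ∑ j, ∑ k, f k i j := fun f => by
    rw [h3]
    exact Finset.sum_congr rfl fun i _ => h3 _
  rw [h3, h4]
  ring

/-- Cauchy–Schwarz bound for the stress. -/
lemma stress_sum_le (v : ι → ℝ) (F : ι → κ → E) (D : ι → V) :
    ∑ i, ∑ j, v i * v j * (∑ k, 𝔞.kil (F i k) (F j k) + inner ℝ (D i) (D j)) ≤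
      (∑ i, v i ^ 2) * (∑ i, ∑ k, 𝔞.kil (F i k) (F i k) + ∑ i, ‖D i‖ ^ 2) := by
  have key : ∀ i j, v i * v j * (∑ k, 𝔞.kil (F i k) (F j k) + inner ℝ (D i) (D j)) ≤
      1 / 2 * (v i ^ 2 * (∑ k, 𝔞.kil (F j k) (F j k) + ‖D j‖ ^ 2)) +
      1 / 2 * (v j ^ 2 * (∑ k, 𝔞.kil (F i k) (F i k) + ‖D i‖ ^ 2)) := by
    intro i j
    -- The square of `vᵢ (Fⱼ, Dⱼ) - vⱼ (Fᵢ, Dᵢ)` is nonnegative; summed over `i` and `j` this gives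
    -- the bound.
    have h := 𝔞.expand_square (v i) (fun _ : Unit => -v j) (fun k => F j k) (fun _ k => F i k)
      (D j) (fun _ => D i)
    have h0 : 0 ≤ (∑ k, 𝔞.kil (v i • F j k + ∑ _i : Unit, (-v j) • F i k)
        (v i • F j k + ∑ _i : Unit, (-v j) • F i k)) +
        ‖v i • D j + ∑ _i : Unit, (-v j) • D i‖ ^ 2 :=
      add_nonneg (Finset.sum_nonneg fun k _ => 𝔞.kil_nonneg _) (by positivity)
    rw [h] at h0
    simp only [Finset.univ_unique, Finset.sum_singleton, real_inner_self_eq_norm_sq] at h0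
    linarith
  calc _ ≤ ∑ i, ∑ j, (1 / 2 * (v i ^ 2 * (∑ k, 𝔞.kil (F j k) (F j k) + ‖D j‖ ^ 2)) +
      1 / 2 * (v j ^ 2 * (∑ k, 𝔞.kil (F i k) (F i k) + ‖D i‖ ^ 2))) :=
        Finset.sum_le_sum fun i _ => Finset.sum_le_sum fun j _ => key i j
    _ = _ := by
      simp only [Finset.sum_add_distrib, ← Finset.mul_sum, ← Finset.sum_mul]
      ring

end GaugeAlgebra

/-! ### The Yang–Mills–Higgs flow as a stress balance -/

section Flow

open Filter Topology

variable {n : ℕ} {E : Type*} [NormedAddCommGroup E] [NormedSpace ℝ E] [FiniteDimensional ℝ E]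
  (G : Type*) [TopologicalSpace G] [ChartedSpace E G] [Group G] [LieGroup 𝓘(ℝ, E) ∞ G]
  {V : Type*} [NormedAddCommGroup V] [InnerProductSpace ℝ V]

/-- The dissipation density `∑ⱼ |∂ₜAⱼ|² + |∂ₜu|²`. -/
def dissipation (A : Fin n → Spacetime n → E) (u : Spacetime n → V) (p : Spacetime n) : ℝ :=
  ∑ k, kilL G (dt (A k) p) (dt (A k) p) + ‖dt u p‖ ^ 2

variable {G} (ρ : G →* (V →L[ℝ] V))

/-- The energy flux `∑ⱼ ⟨Fᵢⱼ, ∂ₜAⱼ⟩ + ⟨∇ᵢu, ∂ₜu⟩`. -/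
def energyFlux (A : Fin n → Spacetime n → E) (u : Spacetime n → V) (i : Fin n)
    (p : Spacetime n) : ℝ :=
  ∑ k, kilL G (curv G A i k p) (dt (A k) p) + inner ℝ (covV ρ A i u p) (dt u p)

/-- The stress `∑ₖ ⟨Fᵢₖ, Fⱼₖ⟩ + ⟨∇ᵢu, ∇ⱼu⟩`. -/
def stress (A : Fin n → Spacetime n → E) (u : Spacetime n → V) (i j : Fin n)
    (p : Spacetime n) : ℝ :=
  ∑ k, kilL G (curv G A i k p) (curv G A j k p) + inner ℝ (covV ρ A i u p) (covV ρ A j u p)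

/-- The density `∑ᵢ |∇ᵢu|² + 4 W(|u|²)`. -/
def scalarDensity (W : ℝ → ℝ) (A : Fin n → Spacetime n → E) (u : Spacetime n → V)
    (p : Spacetime n) : ℝ :=
  ∑ i, ‖covV ρ A i u p‖ ^ 2 + 4 * W (‖u p‖ ^ 2)

lemma curv_antisymm (A : Fin n → Spacetime n → E) (i j : Fin n) (p : Spacetime n) :
    curv G A j i p = -curv G A i j p := by
  simp only [curv, ← brL_apply]
  rw [brL_skew]
  abel

lemma energyDensity_eq (W : ℝ → ℝ) (A : Fin n → Spacetime n → E) (u : Spacetime n → V)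
    (p : Spacetime n) : energyDensity ρ W A u p =
      1 / 2 * (1 / 2 * ∑ i, ∑ k, kilL G (curv G A i k p) (curv G A i k p) +
        ∑ i, ‖covV ρ A i u p‖ ^ 2) + W (‖u p‖ ^ 2) := by
  rw [← sum_sum_Ioi_of_symm]
  · rfl
  · intro i j
    rw [curv_antisymm]
    simp
  · intro i
    have h : curv G A i i p = 0 := by
      have h1 := curv_antisymm (G := G) A i i p
      have h2 : (2 : ℝ) • curv G A i i p = 0 := by
        rw [two_smul]
        nth_rewrite 1 [h1]
        simp
      simpa using h2
    simp [h]

variable [CompactSpace G] [LieAlgebra.IsSemisimple ℝ (GroupLieAlgebra 𝓘(ℝ, E) G)]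

variable [FiniteDimensional ℝ V]

/-- The gauge algebra of a compact semisimple Lie group with an orthogonal representation. -/
def gaugeAlgebra (hρ : ContMDiff 𝓘(ℝ, E) 𝓘(ℝ, V →L[ℝ] V) ∞ (fun g : G => ρ g))
    (hinv : ∀ (g : G) (v w : V), inner ℝ (ρ g v) (ρ g w) = inner ℝ v w) : GaugeAlgebra E V where
  br := brL G
  kil := kilL G
  act := actL ρ
  od := fun v w => odot ρ v w
  br_skew := brL_skew G
  jacobi := brL_jacobi G
  kil_comm := kilL_comm G
  kil_br := kilL_brL G
  kil_nonneg := kilL_self_nonneg G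
  act_br := fun x y v => by
    have h := congrArg (fun f : V →L[ℝ] V => f v) (actL_lieBr ρ hρ x y)
    exact h
  act_skew := actL_skew ρ hρ hinv
  kil_od := odot_spec G ρ

variable {ρ} (hρ : ContMDiff 𝓘(ℝ, E) 𝓘(ℝ, V →L[ℝ] V) ∞ (fun g : G => ρ g))
  (hinv : ∀ (g : G) (v w : V), inner ℝ (ρ g v) (ρ g w) = inner ℝ v w)
  {W : ℝ → ℝ} {A : Fin n → Spacetime n → E} {u : Spacetime n → V}

include hρ hinv

/-- The choice `s = 1`, `v` the drift gives `∑|Sⱼ|² + |J|²`, and `s = 0` gives the square of the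
radial parts. -/
lemma sum_square_eq (s : ℝ) (v : Fin n → ℝ) (p : Spacetime n) :
    (∑ k, kilL G (s • dt (A k) p + ∑ i, v i • curv G A i k p)
      (s • dt (A k) p + ∑ i, v i • curv G A i k p)) +
      ‖s • dt u p + ∑ i, v i • covV ρ A i u p‖ ^ 2 =
    s ^ 2 * dissipation G A u p + 2 * s * ∑ i, v i * energyFlux ρ A u i p +
      ∑ i, ∑ j, v i * v j * stress ρ A u i j p :=
  (gaugeAlgebra ρ hρ hinv).expand_square s v (fun k => dt (A k) p) (fun i k => curv G A i k p)
    (dt u p) (fun i => covV ρ A i u p)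

lemma lhsIntegrand_eq (X : EuclideanSpace ℝ (Fin n)) (T : ℝ) (p : Spacetime n) :
    lhsIntegrand ρ W X T A u p = energyDensity ρ W A u p * (((n : ℝ) - 4) / (2 * (T - p.2))) -
      ∑ i, (p.1 i - X i) / (2 * (p.2 - T)) * energyFlux ρ A u i p -
      ∑ i, ∑ j, (p.1 i - X i) / (2 * (p.2 - T)) * ((p.1 j - X j) / (2 * (p.2 - T))) *
        stress ρ A u i j p := by
  have h1 := sum_square_eq hρ hinv (A := A) (u := u) 1 (fun i => (p.1 i - X i) / (2 * (p.2 - T))) p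
  have h2 := sum_square_eq hρ hinv (A := A) (u := u) 0 (fun i => (p.1 i - X i) / (2 * (p.2 - T))) p
  -- Polarisation: `⟨R, S⟩ = (|S|² + |R|² - |S - R|²)/2`, where `S - R` is the time derivative.
  have h3 : ∑ k, kilL G (radialCurv G X T A k p) (SA G X T A k p) +
      inner ℝ (radialCovV ρ X T A u p) (Ju ρ X T A u p) =
      1 / 2 * ((∑ k, kilL G (SA G X T A k p) (SA G X T A k p) + ‖Ju ρ X T A u p‖ ^ 2) +
        (∑ k, kilL G (radialCurv G X T A k p) (radialCurv G X T A k p) +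
          ‖radialCovV ρ X T A u p‖ ^ 2) - dissipation G A u p) := by
    simp only [dissipation, SA, Ju, map_add, add_apply, Finset.sum_add_distrib, norm_add_sq_real,
      inner_add_right, real_inner_self_eq_norm_sq]
    have h4 : ∑ k, kilL G (dt (A k) p) (radialCurv G X T A k p) =
      ∑ k, kilL G (radialCurv G X T A k p) (dt (A k) p) :=
        Finset.sum_congr rfl fun k _ => kilL_comm G _ _
    rw [h4, real_inner_comm]
    ring
  have h4 : ∑ k, kilL G (SA G X T A k p) (SA G X T A k p) + ‖Ju ρ X T A u p‖ ^ 2 =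
    1 ^ 2 * dissipation G A u p +
      2 * 1 * ∑ i, (p.1 i - X i) / (2 * (p.2 - T)) * energyFlux ρ A u i p +
      ∑ i, ∑ j, (p.1 i - X i) / (2 * (p.2 - T)) * ((p.1 j - X j) / (2 * (p.2 - T))) *
        stress ρ A u i j p := by
    rw [← h1]
    simp only [one_smul]
    rfl
  have h5 : ∑ k, kilL G (radialCurv G X T A k p) (radialCurv G X T A k p) +
      ‖radialCovV ρ X T A u p‖ ^ 2 = 0 ^ 2 * dissipation G A u p +
      2 * 0 * ∑ i, (p.1 i - X i) / (2 * (p.2 - T)) * energyFlux ρ A u i p +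
      ∑ i, ∑ j, (p.1 i - X i) / (2 * (p.2 - T)) * ((p.1 j - X j) / (2 * (p.2 - T))) *
        stress ρ A u i j p := by
    rw [← h2]
    simp only [zero_smul, zero_add]
    rfl
  rw [h4, h5] at h3
  have h6 : lhsIntegrand ρ W X T A u p =
      energyDensity ρ W A u p * (((n : ℝ) - 4) / (2 * (T - p.2))) -
      (∑ k, kilL G (radialCurv G X T A k p) (SA G X T A k p) +
      inner ℝ (radialCovV ρ X T A u p) (Ju ρ X T A u p)) := by
    rw [← sub_sub]
    rfl
  rw [h6, h3]
  ring

lemma rhsIntegrand_eq (X : EuclideanSpace ℝ (Fin n)) (T : ℝ) (p : Spacetime n) :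
    rhsIntegrand ρ W X T A u p = scalarDensity ρ W A u p / (2 * (T - p.2)) +
      (dissipation G A u p +
        2 * ∑ i, (p.1 i - X i) / (2 * (p.2 - T)) * energyFlux ρ A u i p +
        ∑ i, ∑ j, (p.1 i - X i) / (2 * (p.2 - T)) * ((p.1 j - X j) / (2 * (p.2 - T))) *
          stress ρ A u i j p) := by
  have h1 := sum_square_eq hρ hinv (A := A) (u := u) 1 (fun i => (p.1 i - X i) / (2 * (p.2 - T))) p
  simp only [one_smul, one_pow, one_mul, mul_one] at h1
  rw [← h1, ← add_assoc]
  rfl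

/-- Both conservation laws come from the stress identity with the Euler–Lagrange expressions
replaced by time derivatives. The remaining clauses are algebra of squares. -/
lemma isStressBalance (hW : ContDiff ℝ 1 W) (hW_nonneg : ∀ s, 0 ≤ W s) {a T : ℝ}
    (hflow : IsYMHFlow ρ W A u a T) :
    IsStressBalance (energyDensity ρ W A u) (dissipation G A u) (scalarDensity ρ W A u)
      (energyFlux ρ A u) (stress ρ A u) a T := by
  set 𝔞 := gaugeAlgebra ρ hρ hinv with h𝔞
  have hU : IsOpen (univ ×ˢ Ioo a T : Set (Spacetime n)) := isOpen_univ.prod isOpen_Ioo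
  have hUn : ∀ p ∈ (univ ×ˢ Ioo a T : Set (Spacetime n)), univ ×ˢ Ico a T ∈ 𝓝 p := fun p hp =>
    mem_of_superset (hU.mem_nhds hp) (prod_mono le_rfl Ioo_subset_Ico_self)
  have hA : ∀ p ∈ (univ ×ˢ Ioo a T : Set (Spacetime n)), ∀ i, ContDiffAt ℝ ∞ (A i) p :=
    fun p hp i => (hflow.smooth_gauge i).contDiffAt (hUn p hp)
  have hu : ∀ p ∈ (univ ×ˢ Ioo a T : Set (Spacetime n)), ContDiffAt ℝ ∞ u p :=
    fun p hp => hflow.smooth_scalar.contDiffAt (hUn p hp)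
  have hcurv : ∀ p ∈ (univ ×ˢ Ioo a T : Set (Spacetime n)), ∀ i j,
      ContDiffAt ℝ ∞ (curv G A i j) p := fun p hp i j =>
    GaugeAlgebra.contDiffAt_curv (𝔞 := 𝔞) (m := ∞) (by simp) (hA p hp i) (hA p hp j)
  have hcov : ∀ p ∈ (univ ×ˢ Ioo a T : Set (Spacetime n)), ∀ i,
      ContDiffAt ℝ ∞ (covV ρ A i u) p := fun p hp i =>
    GaugeAlgebra.contDiffAt_covV (𝔞 := 𝔞) (m := ∞) (by simp) (hA p hp i) (hu p hp)
  have hdA : ∀ p ∈ (univ ×ˢ Ioo a T : Set (Spacetime n)), ∀ i,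
      ContDiffAt ℝ ∞ (dt (A i)) p := fun p hp i =>
    contDiffAt_dirDeriv (m := ∞) (0, 1) (hA p hp i) (by simp)
  have hdu : ∀ p ∈ (univ ×ˢ Ioo a T : Set (Spacetime n)), ContDiffAt ℝ ∞ (dt u) p := fun p hp =>
    contDiffAt_dirDeriv (m := ∞) (0, 1) (hu p hp) (by simp)
  have hWu : ∀ p ∈ (univ ×ˢ Ioo a T : Set (Spacetime n)),
      ContDiffAt ℝ 1 (fun q => W (‖u q‖ ^ 2)) p := fun p hp =>
    hW.contDiffAt.comp p (((hu p hp).of_le (by simp)).norm_sq ℝ)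
  have hscal : ∀ p ∈ (univ ×ˢ Ioo a T : Set (Spacetime n)),
      ContDiffAt ℝ 1 (fun q => ∑ i, ‖covV ρ A i u q‖ ^ 2) p := fun p hp =>
    ContDiffAt.sum fun i _ => ((hcov p hp i).of_le (by simp)).norm_sq ℝ
  have heq : energyDensity ρ W A u = fun p =>
      1 / 2 * (1 / 2 * ∑ i, ∑ k, kilL G (curv G A i k p) (curv G A i k p) +
        ∑ i, ‖covV ρ A i u p‖ ^ 2) + W (‖u p‖ ^ 2) := funext fun p => energyDensity_eq ρ W A u p
  have hform : ∀ p (s : ℝ) (v : Fin n → ℝ), 0 ≤ s ^ 2 * dissipation G A u p +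
      2 * s * ∑ i, v i * energyFlux ρ A u i p + ∑ i, ∑ j, v i * v j * stress ρ A u i j p := by
    intro p s v
    rw [← sum_square_eq hρ hinv]
    exact add_nonneg (Finset.sum_nonneg fun k _ => kilL_self_nonneg G _) (by positivity)
  have hYM : ∀ p ∈ (univ ×ˢ Ioo a T : Set (Spacetime n)), ∀ k,
      ∑ i, 𝔞.covE (EuclideanSpace.single i 1, 0) (A i) (curv G A i k) p -
        𝔞.od (u p) (covV ρ A k u p) = dt (A k) p := fun p hp k => (hflow.gauge_eq p hp k).symm
  have hH : ∀ p ∈ (univ ×ˢ Ioo a T : Set (Spacetime n)),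
      ∑ i, 𝔞.covV (EuclideanSpace.single i 1, 0) (A i) (covV ρ A i u) p -
        (2 * deriv W (‖u p‖ ^ 2)) • u p = dt u p := fun p hp => (hflow.scalar_eq p hp).symm
  -- The direction `z` and the potential `b` along it stay free, so that one identity serves time
  -- and space.
  have hdiv : ∀ p ∈ (univ ×ˢ Ioo a T : Set (Spacetime n)), ∀ (z : Spacetime n)
      (b : Spacetime n → E), ContDiffAt ℝ ∞ b p →
      ∑ i, dx i (fun q =>
        ∑ k, kilL G (curv G A i k q) (𝔞.curv z b (EuclideanSpace.single k 1, 0) (A k) q) +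
          inner ℝ (covV ρ A i u q) (𝔞.covV z b u q)) p -
        dirDeriv z (energyDensity ρ W A u) p =
      ∑ k, kilL G (dt (A k) p) (𝔞.curv z b (EuclideanSpace.single k 1, 0) (A k) p) +
        inner ℝ (dt u p) (𝔞.covV z b u p) := by
    intro p hp z b hb
    have h2 : (2 : ℕ∞ω) ≤ ∞ := by
      have := minSmoothness_two_le_infty
      rwa [minSmoothness_of_isRCLikeNormedField] at this
    have h := GaugeAlgebra.div_stress (𝔞 := 𝔞) (p := p) (u := u) (b := b) (z := z)
      (fun i : Fin n => ((EuclideanSpace.single i 1, 0) : Spacetime n)) A hW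
      (fun i => (hA p hp i).of_le h2) (hb.of_le h2) ((hu p hp).of_le h2)
    rw [heq, ← hH p hp]
    simp only [← hYM p hp]
    exact h
  refine ⟨?_, ?_, ?_, ?_, ?_, ?_, ?_, ?_, ?_, hform, ?_, ?_, ?_⟩
  · intro p hp
    rw [heq]
    refine ContDiffAt.contDiffWithinAt ?_
    refine ContDiffAt.add (contDiffAt_const.mul (ContDiffAt.add (contDiffAt_const.mul ?_)
      (hscal p hp))) (hWu p hp)
    exact ContDiffAt.sum fun i _ => ContDiffAt.sum fun k _ =>
      contDiffAt_bilin _ ((hcurv p hp i k).of_le (by simp)) ((hcurv p hp i k).of_le (by simp))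
  · intro i p hp
    refine ContDiffAt.contDiffWithinAt ?_
    refine ContDiffAt.add (ContDiffAt.sum fun k _ => contDiffAt_bilin _
      ((hcurv p hp i k).of_le (by simp)) ((hdA p hp k).of_le (by simp))) ?_
    exact ((hcov p hp i).of_le (by simp)).inner ℝ ((hdu p hp).of_le (by simp))
  · intro i j p hp
    refine ContDiffAt.contDiffWithinAt ?_
    refine ContDiffAt.add (ContDiffAt.sum fun k _ => contDiffAt_bilin _
      ((hcurv p hp i k).of_le (by simp)) ((hcurv p hp j k).of_le (by simp))) ?_
    exact ((hcov p hp i).of_le (by simp)).inner ℝ ((hcov p hp j).of_le (by simp))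
  · intro p hp
    refine ContinuousAt.continuousWithinAt ?_
    have h : ContDiffAt ℝ 1 (dissipation G A u) p := by
      refine ContDiffAt.add (ContDiffAt.sum fun k _ => contDiffAt_bilin _
        ((hdA p hp k).of_le (by simp)) ((hdA p hp k).of_le (by simp))) ?_
      exact ((hdu p hp).of_le (by simp)).norm_sq ℝ
    exact h.continuousAt
  · intro p hp
    refine ContinuousAt.continuousWithinAt ?_
    have h : ContDiffAt ℝ 1 (scalarDensity ρ W A u) p :=
      (hscal p hp).add (contDiffAt_const.mul (hWu p hp))
    exact h.continuousAt
  · intro p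
    rw [energyDensity_eq]
    have h1 : 0 ≤ ∑ i, ∑ k, kilL G (curv G A i k p) (curv G A i k p) :=
      Finset.sum_nonneg fun i _ => Finset.sum_nonneg fun k _ => kilL_self_nonneg G _
    have h2 : 0 ≤ ∑ i, ‖covV ρ A i u p‖ ^ 2 := Finset.sum_nonneg fun i _ => by positivity
    have h3 := hW_nonneg (‖u p‖ ^ 2)
    positivity
  · intro p
    have h2 : 0 ≤ ∑ i, ‖covV ρ A i u p‖ ^ 2 := Finset.sum_nonneg fun i _ => by positivity
    have h3 := hW_nonneg (‖u p‖ ^ 2)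
    simp only [scalarDensity]
    positivity
  · intro p hp
    -- In the time direction with zero time potential (temporal gauge), the mixed curvature is
    -- `∂ₜAₖ` and the covariant derivative of `u` is `∂ₜu`: this is the energy law.
    have h := hdiv p hp (0, 1) (fun _ => 0) contDiffAt_const
    have h1 : ∀ k, 𝔞.curv ((0, 1) : Spacetime n) (fun _ => 0) (EuclideanSpace.single k 1, 0)
        (A k) = dt (A k) := by
      intro k
      ext q
      have h0 : dirDeriv ((EuclideanSpace.single k 1, 0) : Spacetime n)
          (fun _ : Spacetime n => (0 : E)) q = 0 := by
        rw [dirDeriv_eq_fderiv (differentiableAt_const _)]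
        simp
      simp only [GaugeAlgebra.curv, h0, map_zero, zero_apply]
      simp only [sub_zero, add_zero]
      rfl
    have h2 : 𝔞.covV ((0, 1) : Spacetime n) (fun _ => 0) u = dt u := by
      ext q
      simp only [GaugeAlgebra.covV, map_zero, zero_apply, add_zero]
      rfl
    simp only [h1, h2, real_inner_self_eq_norm_sq] at h
    have h3 : ∑ i, dx i (energyFlux ρ A u i) p - dt (energyDensity ρ W A u) p =
      dissipation G A u p := h
    linarith
  · intro p hp j
    -- In a spatial direction with its own potential, the same identity is the stress law.
    have h := hdiv p hp (EuclideanSpace.single j 1, 0) (A j) (hA p hp j)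
    have h3 : ∑ i, dx i (stress ρ A u i j) p - dx j (energyDensity ρ W A u) p =
      ∑ k, kilL G (dt (A k) p) (curv G A j k p) + inner ℝ (dt u p) (covV ρ A j u p) := h
    rw [h3, energyFlux, real_inner_comm]
    congr 1
    exact Finset.sum_congr rfl fun k _ => kilL_comm G _ _
  · intro p v
    have h := 𝔞.stress_sum_le v (fun i k => curv G A i k p) (fun i => covV ρ A i u p)
    refine h.trans ?_
    rw [energyDensity_eq, mul_comm]
    have h0 : 0 ≤ ∑ i, v i ^ 2 := Finset.sum_nonneg fun i _ => by positivity
    refine mul_le_mul_of_nonneg_right ?_ h0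
    have h2 : 0 ≤ ∑ i, ‖covV ρ A i u p‖ ^ 2 := Finset.sum_nonneg fun i _ => by positivity
    have h3 := hW_nonneg (‖u p‖ ^ 2)
    have h4 : ∀ i k, 𝔞.kil (curv G A i k p) (curv G A i k p) =
      kilL G (curv G A i k p) (curv G A i k p) := fun i k => rfl
    simp only [h4]
    linarith
  · intro i j p
    simp only [stress]
    rw [real_inner_comm]
    congr 1
    exact Finset.sum_congr rfl fun k _ => kilL_comm G _ _
  · intro p
    rw [energyDensity_eq]
    simp only [stress, scalarDensity, real_inner_self_eq_norm_sq, Finset.sum_add_distrib]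
    ring

end Flow

/-! ### Integration over time slices and the tested energy and dilation identities -/

section Slices

open Filter Topology

variable {n : ℕ} {a b : ℝ} {X : EuclideanSpace ℝ (Fin n)} {R : ℝ}

lemma isOpen_slab : IsOpen (univ ×ˢ Ioo a b : Set (Spacetime n)) := isOpen_univ.prod isOpen_Ioo

lemma slab_mem_nhds {p : Spacetime n} (hp : p.2 ∈ Ioo a b) :
    (univ ×ˢ Ioo a b : Set (Spacetime n)) ∈ 𝓝 p := isOpen_slab.mem_nhds ⟨mem_univ _, hp⟩

lemma continuous_slice {F : Type*} [TopologicalSpace F] {g : Spacetime n → F}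
    (hg : ContinuousOn g (univ ×ˢ Ioo a b)) {t : ℝ} (ht : t ∈ Ioo a b) :
    Continuous fun x => g (x, t) := by
  rw [continuous_iff_continuousAt]
  intro x
  have h1 : ContinuousAt g (x, t) := hg.continuousAt (slab_mem_nhds ht)
  exact ContinuousAt.comp (f := fun x : EuclideanSpace ℝ (Fin n) => (x, t)) h1
    (Continuous.prodMk_left t).continuousAt

lemma hasCompactSupport_slice {g : Spacetime n → ℝ} {t : ℝ}
    (hs : ∀ x, x ∉ Metric.closedBall X R → g (x, t) = 0) :
    HasCompactSupport fun x => g (x, t) :=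
  HasCompactSupport.intro (isCompact_closedBall X R) hs

lemma integrable_slice {g : Spacetime n → ℝ} (hg : ContinuousOn g (univ ×ˢ Ioo a b)) {t : ℝ}
    (ht : t ∈ Ioo a b) (hs : ∀ x, x ∉ Metric.closedBall X R → g (x, t) = 0) :
    Integrable fun x => g (x, t) :=
  (continuous_slice hg ht).integrable_of_hasCompactSupport (hasCompactSupport_slice hs)

lemma continuousOn_dirDeriv {g : Spacetime n → ℝ} (hg : ContDiffOn ℝ 1 g (univ ×ˢ Ioo a b))
    (v : Spacetime n) : ContinuousOn (dirDeriv v g) (univ ×ˢ Ioo a b) := by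
  have h1 := (hg.continuousOn_fderiv_of_isOpen isOpen_slab (by simp)).clm_apply
    (continuousOn_const (c := v))
  refine h1.congr fun p hp => ?_
  exact dirDeriv_eq_fderiv ((hg.contDiffAt (isOpen_slab.mem_nhds hp)).differentiableAt (by simp))

lemma hasDerivAt_time {g : Spacetime n → ℝ} (hg : ContDiffOn ℝ 1 g (univ ×ˢ Ioo a b))
    (x : EuclideanSpace ℝ (Fin n)) {t : ℝ} (ht : t ∈ Ioo a b) :
    HasDerivAt (fun s => g (x, s)) (dt g (x, t)) t := by
  have h1 : DifferentiableAt ℝ g (x, t) :=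
    (hg.contDiffAt (slab_mem_nhds ht)).differentiableAt (by simp)
  have h2 : HasDerivAt (fun s : ℝ => ((x, s) : Spacetime n)) (0, 1) t :=
    (hasDerivAt_const t x).prodMk (hasDerivAt_id t)
  have h3 := h1.hasFDerivAt.comp_hasDerivAt t h2
  rw [← dirDeriv_eq_fderiv h1] at h3
  exact h3

lemma dt_eq_zero_of_support {g : Spacetime n → ℝ} (hg : ContDiffOn ℝ 1 g (univ ×ˢ Ioo a b))
    (hs : ∀ x, x ∉ Metric.closedBall X R → ∀ t ∈ Ioo a b, g (x, t) = 0)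
    {x : EuclideanSpace ℝ (Fin n)} (hx : x ∉ Metric.closedBall X R) {t : ℝ} (ht : t ∈ Ioo a b) :
    dt g (x, t) = 0 := by
  refine (hasDerivAt_time hg x ht).unique ((hasDerivAt_const t (0 : ℝ)).congr_of_eventuallyEq ?_)
  filter_upwards [Ioo_mem_nhds ht.1 ht.2] with s hs'
  exact hs x hx s hs'

/-- Differentiation under the integral over a time slice. -/
lemma hasDerivAt_integral_slice {g : Spacetime n → ℝ} (hg : ContDiffOn ℝ 1 g (univ ×ˢ Ioo a b))
    (hs : ∀ x, x ∉ Metric.closedBall X R → ∀ t ∈ Ioo a b, g (x, t) = 0)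
    {t : ℝ} (ht : t ∈ Ioo a b) :
    HasDerivAt (fun s => ∫ x, g (x, s)) (∫ x, dt g (x, t)) t := by
  have hd : ContinuousOn (dt g) (univ ×ˢ Ioo a b) := continuousOn_dirDeriv hg (0, 1)
  obtain ⟨δ, hδ, hδI⟩ := Metric.nhds_basis_closedBall.mem_iff.mp (Ioo_mem_nhds ht.1 ht.2)
  have hK : IsCompact (Metric.closedBall X R ×ˢ Metric.closedBall t δ) :=
    (isCompact_closedBall X R).prod (isCompact_closedBall t δ)
  obtain ⟨C, hC⟩ := hK.exists_bound_of_continuousOn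
    (hd.mono (prod_mono (subset_univ _) hδI))
  have hball : Metric.ball t δ ⊆ Ioo a b := Metric.ball_subset_closedBall.trans hδI
  refine (hasDerivAt_integral_of_dominated_loc_of_deriv_le (F := fun s x => g (x, s))
    (F' := fun s x => dt g (x, s))
    (bound := (Metric.closedBall X R).indicator fun _ => C) (Metric.ball_mem_nhds t hδ) ?_ ?_ ?_
    ?_ ?_ ?_).2
  · filter_upwards [Ioo_mem_nhds ht.1 ht.2] with s hs'
    exact (continuous_slice hg.continuousOn hs').aestronglyMeasurable
  · exact integrable_slice hg.continuousOn ht fun x hx => hs x hx t ht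
  · exact (continuous_slice hd ht).aestronglyMeasurable
  · refine ae_of_all _ fun x s hs' => ?_
    by_cases hx : x ∈ Metric.closedBall X R
    · rw [indicator_of_mem hx]
      exact hC (x, s) ⟨hx, Metric.ball_subset_closedBall hs'⟩
    · rw [indicator_of_notMem hx, dt_eq_zero_of_support hg hs hx (hball hs'), norm_zero]
  · rw [integrable_indicator_iff measurableSet_closedBall]
    exact integrableOn_const measure_closedBall_lt_top.ne
  · exact ae_of_all _ fun x s hs' => hasDerivAt_time hg x (hball hs')

/-- The spatial divergence of a compactly supported field integrates to zero. -/
lemma integral_dx_slice {g : Spacetime n → ℝ} (hg : ContDiffOn ℝ 1 g (univ ×ˢ Ioo a b))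
    {t : ℝ} (ht : t ∈ Ioo a b) (hs : ∀ x, x ∉ Metric.closedBall X R → g (x, t) = 0) (i : Fin n) :
    Integrable (fun x => dx i g (x, t)) ∧ ∫ x, dx i g (x, t) = 0 := by
  set f : EuclideanSpace ℝ (Fin n) → ℝ := fun x => g (x, t) with hf
  have hfd : ContDiff ℝ 1 f := by
    rw [contDiff_iff_contDiffAt]
    intro x
    have h1 : ContDiffAt ℝ 1 g (x, t) := hg.contDiffAt (slab_mem_nhds ht)
    exact ContDiffAt.comp (f := fun x : EuclideanSpace ℝ (Fin n) => (x, t)) x h1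
      (contDiff_id.prodMk contDiff_const).contDiffAt
  have hfs : HasCompactSupport f := hasCompactSupport_slice hs
  have hfd' : ∀ x, dx i g (x, t) = fderiv ℝ f x (EuclideanSpace.single i 1) := by
    intro x
    have h1 : DifferentiableAt ℝ g (x, t) :=
      (hg.contDiffAt (slab_mem_nhds ht)).differentiableAt (by simp)
    have h2 : HasFDerivAt (fun x : EuclideanSpace ℝ (Fin n) => ((x, t) : Spacetime n))
        (ContinuousLinearMap.inl ℝ _ ℝ) x := hasFDerivAt_prodMk_left x t
    have h3 := HasFDerivAt.comp (f := fun x : EuclideanSpace ℝ (Fin n) => ((x, t) : Spacetime n))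
      x h1.hasFDerivAt h2
    have h4 : fderiv ℝ f x = (fderiv ℝ g (x, t)).comp (ContinuousLinearMap.inl ℝ _ ℝ) := h3.fderiv
    rw [h4]
    exact dirDeriv_eq_fderiv h1
  have hint : Integrable fun x => fderiv ℝ f x (EuclideanSpace.single i 1) :=
    ((hfd.continuous_fderiv (by simp)).clm_apply continuous_const).integrable_of_hasCompactSupport
      (hfs.fderiv_apply ℝ _)
  simp only [hfd']
  refine ⟨hint, ?_⟩
  -- Integration by parts against the constant function `1`.
  have h := integral_mul_fderiv_eq_neg_fderiv_mul_of_integrable (μ := volume)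
    (f := fun _ : EuclideanSpace ℝ (Fin n) => (1 : ℝ)) (g := f) (v := EuclideanSpace.single i 1)
    (by simp) (by simpa using hint)
    (by simpa using hfd.continuous.integrable_of_hasCompactSupport hfs)
    (fun x _ => differentiableAt_const _) (fun x _ => hfd.differentiable (by simp) x)
  simpa using h

end Slices

namespace IsStressBalance

open Filter Topology

variable {n : ℕ} {e K w : Spacetime n → ℝ} {P : Fin n → Spacetime n → ℝ}
  {Q : Fin n → Fin n → Spacetime n → ℝ} {a T : ℝ} (hB : IsStressBalance e K w P Q a T)
  (X : EuclideanSpace ℝ (Fin n)) {R : ℝ}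

include hB

/-- Evolution of `∫ e η` over time slices, with a multiple `β` of the dilation identity added. -/
lemma hasDerivAt_integral_mul {η : Spacetime n → ℝ}
    (hη : ContDiffOn ℝ 1 η (univ ×ˢ Ioo a T))
    (hs : ∀ x, x ∉ Metric.closedBall X R → ∀ t ∈ Ioo a T, η (x, t) = 0)
    {t : ℝ} (ht : t ∈ Ioo a T) (β : ℝ) :
    Integrable (fun x => e (x, t) * dt η (x, t) - ∑ i, P i (x, t) * dx i η (x, t) -
        K (x, t) * η (x, t) - β * (η (x, t) * ∑ j, P j (x, t) * (x j - X j) -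
          η (x, t) * ((n - 4) * e (x, t) + w (x, t)) +
          ∑ i, (∑ j, Q i j (x, t) * (x j - X j) - e (x, t) * (x i - X i)) * dx i η (x, t))) ∧
    HasDerivAt (fun s => ∫ x, e (x, s) * η (x, s))
      (∫ x, (e (x, t) * dt η (x, t) - ∑ i, P i (x, t) * dx i η (x, t) -
        K (x, t) * η (x, t) - β * (η (x, t) * ∑ j, P j (x, t) * (x j - X j) -
          η (x, t) * ((n - 4) * e (x, t) + w (x, t)) +
          ∑ i, (∑ j, Q i j (x, t) * (x j - X j) - e (x, t) * (x i - X i)) * dx i η (x, t)))) t := by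
  have hy : ∀ j : Fin n, ContDiff ℝ 1 (fun p : Spacetime n => p.1 j - X j) := fun j => by fun_prop
  -- The total flux: the energy flux plus `β` times the dilation flux `Qy - ey`, cut off by `η`. The
  -- claimed integrand is `∂ₜ(eη) - div Φ`, and the divergence integrates to zero.
  set Φ : Fin n → Spacetime n → ℝ := fun i p =>
    (P i p + β * (∑ j, Q i j p * (p.1 j - X j) - e p * (p.1 i - X i))) * η p with hΦ
  have hΦ1 : ∀ i, ContDiffOn ℝ 1 (fun p => P i p +
      β * (∑ j, Q i j p * (p.1 j - X j) - e p * (p.1 i - X i))) (univ ×ˢ Ioo a T) := fun i =>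
    (hB.P_smooth i).add (contDiffOn_const.mul ((ContDiffOn.sum fun j _ =>
      (hB.Q_smooth i j).mul (hy j).contDiffOn).sub (hB.e_smooth.mul (hy i).contDiffOn)))
  have hΦ2 : ∀ i, ContDiffOn ℝ 1 (Φ i) (univ ×ˢ Ioo a T) := fun i => (hΦ1 i).mul hη
  have heη : ContDiffOn ℝ 1 (fun p => e p * η p) (univ ×ˢ Ioo a T) := hB.e_smooth.mul hη
  have heηs : ∀ x, x ∉ Metric.closedBall X R → ∀ t ∈ Ioo a T, e (x, t) * η (x, t) = 0 :=
    fun x hx s hs' => by rw [hs x hx s hs', mul_zero]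
  have hΦs : ∀ i x, x ∉ Metric.closedBall X R → Φ i (x, t) = 0 := fun i x hx => by
    simp only [hΦ, hs x hx t ht, mul_zero]
  have hpt : ∀ x, e (x, t) * dt η (x, t) - ∑ i, P i (x, t) * dx i η (x, t) -
        K (x, t) * η (x, t) - β * (η (x, t) * ∑ j, P j (x, t) * (x j - X j) -
          η (x, t) * ((n - 4) * e (x, t) + w (x, t)) +
          ∑ i, (∑ j, Q i j (x, t) * (x j - X j) - e (x, t) * (x i - X i)) * dx i η (x, t)) =
      dt (fun p => e p * η p) (x, t) - ∑ i, dx i (Φ i) (x, t) := by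
    intro x
    have hd : ∀ {g : Spacetime n → ℝ}, ContDiffOn ℝ 1 g (univ ×ˢ Ioo a T) →
        DifferentiableAt ℝ g (x, t) := fun hg =>
      (hg.contDiffAt (slab_mem_nhds ht)).differentiableAt (by simp)
    have h1 : dt (fun p => e p * η p) (x, t) = e (x, t) * dt η (x, t) + η (x, t) * dt e (x, t) :=
      dirDeriv_mul (hd hB.e_smooth) (hd hη)
    have hdy : ∀ i j : Fin n, dirDeriv ((EuclideanSpace.single i 1, 0) : Spacetime n)
        (fun p : Spacetime n => p.1 j - X j) (x, t) = if j = i then 1 else 0 := by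
      intro i j
      have h : HasFDerivAt (fun p : Spacetime n => p.1 j - X j)
          ((EuclideanSpace.proj j : EuclideanSpace ℝ (Fin n) →L[ℝ] ℝ).comp
            (ContinuousLinearMap.fst ℝ _ ℝ)) (x, t) :=
        (((EuclideanSpace.proj j : EuclideanSpace ℝ (Fin n) →L[ℝ] ℝ).comp
            (ContinuousLinearMap.fst ℝ _ ℝ)).hasFDerivAt).sub_const _
      rw [dirDeriv_eq_fderiv h.differentiableAt, h.fderiv]
      simp
    have h2 : ∀ i, dx i (Φ i) (x, t) = (P i (x, t) + β * (∑ j, Q i j (x, t) * (x j - X j) -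
          e (x, t) * (x i - X i))) * dx i η (x, t) + η (x, t) * (dx i (P i) (x, t) +
          β * (∑ j, (x j - X j) * dx i (Q i j) (x, t) + Q i i (x, t) -
            ((x i - X i) * dx i e (x, t) + e (x, t)))) := by
      intro i
      have h3 : ∀ j, dirDeriv ((EuclideanSpace.single i 1, 0) : Spacetime n)
          (fun p : Spacetime n => Q i j p * (p.1 j - X j)) (x, t) =
          (x j - X j) * dx i (Q i j) (x, t) + if j = i then Q i j (x, t) else 0 := by
        intro j
        rw [dirDeriv_mul (hd (hB.Q_smooth i j)) (hd (hy j).contDiffOn), hdy]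
        split_ifs <;> simp [dx, dirDeriv, add_comm]
      have h4 : dirDeriv ((EuclideanSpace.single i 1, 0) : Spacetime n)
          (fun p : Spacetime n => e p * (p.1 i - X i)) (x, t) =
          (x i - X i) * dx i e (x, t) + e (x, t) := by
        rw [dirDeriv_mul (hd hB.e_smooth) (hd (hy i).contDiffOn), hdy]
        simp [dx, dirDeriv, add_comm]
      have h5 : ∀ j, DifferentiableAt ℝ (fun p : Spacetime n => Q i j p * (p.1 j - X j)) (x, t) :=
        fun j => hd ((hB.Q_smooth i j).mul (hy j).contDiffOn)
      have h6 : DifferentiableAt ℝ (fun p : Spacetime n => e p * (p.1 i - X i)) (x, t) :=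
        hd (hB.e_smooth.mul (hy i).contDiffOn)
      have h7 : DifferentiableAt ℝ (fun p : Spacetime n => ∑ j, Q i j p * (p.1 j - X j)) (x, t) :=
        DifferentiableAt.fun_sum fun j _ => h5 j
      have h8 : dx i (Φ i) (x, t) = _ := dirDeriv_mul (hd (hΦ1 i)) (hd hη)
      rw [h8, dirDeriv_add (hd (hB.P_smooth i)) ((h7.fun_sub h6).const_mul β),
        dirDeriv_const_mul _ (h7.fun_sub h6), dirDeriv_sub h7 h6, dirDeriv_sum fun j _ => h5 j, h4]
      simp only [h3, Finset.sum_add_distrib, Finset.sum_ite_eq', Finset.mem_univ, if_true]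
      rfl
    have hE := hB.energy_eq (x, t) ⟨mem_univ _, ht⟩
    have hS := hB.stress_eq (x, t) ⟨mem_univ _, ht⟩
    have hT := hB.trace (x, t)
    rw [h1, hE]
    simp only [h2, Finset.sum_add_distrib, ← Finset.mul_sum, Finset.sum_sub_distrib,
      Finset.sum_const, Finset.card_univ, Fintype.card_fin, nsmul_eq_mul, hT]
    -- The stress law contracted with the position vector; the derivatives of `e` cancel against
    -- those in `div (ey)`.
    have hS' : ∑ i, ∑ j, (x j - X j) * dx i (Q i j) (x, t) =
        ∑ j, P j (x, t) * (x j - X j) + ∑ j, (x j - X j) * dx j e (x, t) := by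
      rw [Finset.sum_comm, ← Finset.sum_add_distrib]
      refine Finset.sum_congr rfl fun j _ => ?_
      rw [← hS j, ← Finset.mul_sum]
      ring
    rw [hS']
    have h9 : ∑ i, (P i (x, t) + β * (∑ j, Q i j (x, t) * (x j - X j) -
        e (x, t) * (x i - X i))) * dx i η (x, t) = ∑ i, P i (x, t) * dx i η (x, t) +
        β * ∑ i, (∑ j, Q i j (x, t) * (x j - X j) - e (x, t) * (x i - X i)) * dx i η (x, t) := by
      rw [Finset.mul_sum, ← Finset.sum_add_distrib]
      exact Finset.sum_congr rfl fun i _ => by ring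
    rw [h9]
    ring
  have hid : Integrable fun x => dt (fun p => e p * η p) (x, t) :=
    integrable_slice (X := X) (R := R) (continuousOn_dirDeriv heη (0, 1)) ht fun x hx =>
      dt_eq_zero_of_support heη heηs hx ht
  have hΦi := fun i => integral_dx_slice (hΦ2 i) ht (hΦs i) i
  have hsum : Integrable fun x => ∑ i, dx i (Φ i) (x, t) :=
    integrable_finsetSum _ fun i _ => (hΦi i).1
  simp only [hpt]
  refine ⟨hid.sub hsum, ?_⟩
  rw [integral_sub hid hsum, integral_finsetSum _ fun i _ => (hΦi i).1]
  simp only [(hΦi _).2, Finset.sum_const_zero, sub_zero]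
  exact hasDerivAt_integral_slice heη heηs ht

end IsStressBalance

/-! ### The logarithm of the backward heat kernel -/

section LogKernel

variable {n : ℕ} {X : EuclideanSpace ℝ (Fin n)} {T : ℝ}

/-- The logarithm of the weighted backward heat kernel. -/
def logKernel (X : EuclideanSpace ℝ (Fin n)) (T : ℝ) (p : Spacetime n) : ℝ :=
  -(((n : ℝ) - 4) / 2) * Real.log (4 * Real.pi * (T - p.2)) - ‖p.1 - X‖ ^ 2 / (4 * (T - p.2))

/-- The spatial gradient of the logarithm of the backward heat kernel. -/
def drift (X : EuclideanSpace ℝ (Fin n)) (T : ℝ) (p : Spacetime n) (i : Fin n) : ℝ :=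
  (p.1 i - X i) / (2 * (p.2 - T))

lemma heatKernel_eq_exp {p : Spacetime n} (hp : p.2 < T) :
    heatKernel X T p = Real.exp (logKernel X T p) := by
  have h : 0 < 4 * Real.pi * (T - p.2) := mul_pos (by positivity) (sub_pos.mpr hp)
  have h2 : ‖p.1 - X‖ ^ 2 / (4 * (p.2 - T)) = -(‖p.1 - X‖ ^ 2 / (4 * (T - p.2))) := by
    rw [← div_neg]; ring_nf
  rw [heatKernel, logKernel, h2, Real.rpow_def_of_pos h, one_div, ← Real.exp_neg, ← Real.exp_add]
  ring_nf

lemma mem_heatBall_iff {r : ℝ} (hr : 0 < r) {p : Spacetime n} :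
    p ∈ heatBall X T r ↔ p.2 < T ∧ 0 < ((n : ℝ) - 4) * Real.log r + logKernel X T p := by
  refine and_congr_right fun hp => ?_
  rw [heatKernel_eq_exp hp, Real.rpow_def_of_pos hr, one_div, ← Real.exp_neg, Real.exp_lt_exp]
  constructor <;> intro h <;> linarith

lemma contDiffOn_logKernel {a b : ℝ} (hb : b ≤ T) :
    ContDiffOn ℝ 1 (logKernel X T) (univ ×ˢ Ioo a b) := by
  have h0 : ∀ p ∈ (univ ×ˢ Ioo a b : Set (Spacetime n)), T - p.2 ≠ 0 := fun p hp => by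
    have := hp.2.2
    exact (sub_pos.mpr (lt_of_lt_of_le this hb)).ne'
  unfold logKernel
  refine ContDiffOn.sub (contDiffOn_const.mul (ContDiffOn.log (by fun_prop) fun p hp => ?_))
    (ContDiffOn.div ?_ (by fun_prop) fun p hp => ?_)
  · exact mul_ne_zero (by positivity) (h0 p hp)
  · exact ((contDiff_fst.sub contDiff_const).norm_sq ℝ).contDiffOn
  · exact mul_ne_zero (by norm_num) (h0 p hp)

lemma differentiableAt_logKernel {p : Spacetime n} (hp : p.2 < T) :
    DifferentiableAt ℝ (logKernel X T) p :=
  ((contDiffOn_logKernel (a := p.2 - 1) le_rfl).contDiffAt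
    (slab_mem_nhds ⟨by linarith, hp⟩)).differentiableAt (by simp)

lemma dx_logKernel {p : Spacetime n} (hp : p.2 < T) (i : Fin n) :
    dx i (logKernel X T) p = drift X T p i := by
  have h1 : HasDerivAt (fun s : ℝ => p.1 + s • EuclideanSpace.single i (1 : ℝ) - X)
      (EuclideanSpace.single i 1) 0 := by
    simpa using (((hasDerivAt_id (0 : ℝ)).smul_const
      (EuclideanSpace.single i (1 : ℝ))).const_add p.1).sub_const X
  have h2 := (h1.norm_sq.div_const (4 * (T - p.2))).const_sub
    (-(((n : ℝ) - 4) / 2) * Real.log (4 * Real.pi * (T - p.2)))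
  have h3 : HasLineDerivAt ℝ (logKernel X T) (drift X T p i) p
      (EuclideanSpace.single i 1, 0) := by
    unfold HasLineDerivAt logKernel
    have h4 : p.2 - T ≠ 0 := (sub_neg.mpr hp).ne
    have h5 : T - p.2 ≠ 0 := (sub_pos.mpr hp).ne'
    convert h2 using 1
    · ext s; simp
    · simp only [drift, zero_smul, add_zero, EuclideanSpace.inner_single_right]
      simp
      field_simp
      ring
  exact h3.lineDeriv

lemma norm_sub_sq_eq_sum (x X : EuclideanSpace ℝ (Fin n)) :
    ‖x - X‖ ^ 2 = ∑ i, (x i - X i) ^ 2 := by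
  rw [EuclideanSpace.norm_sq_eq]
  simp

lemma sum_drift_sq (p : Spacetime n) :
    ∑ i, drift X T p i ^ 2 = ‖p.1 - X‖ ^ 2 / (4 * (T - p.2) ^ 2) := by
  simp only [drift, div_pow]
  rw [← Finset.sum_div, ← norm_sub_sq_eq_sum]
  congr 1
  ring

/-- The summand `-|ν|²` is the one that the dilation identity cancels, since `e |ν|²` appears there
with the opposite sign. -/
lemma dt_logKernel {p : Spacetime n} (hp : p.2 < T) :
    dt (logKernel X T) p = ((n : ℝ) - 4) / (2 * (T - p.2)) - ∑ i, drift X T p i ^ 2 := by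
  have h5 : 0 < T - p.2 := sub_pos.mpr hp
  have h1 : HasDerivAt (fun s : ℝ => T - (p.2 + s)) (-1) 0 := by
    simpa using ((hasDerivAt_id (0 : ℝ)).const_add p.2).const_sub T
  have h2 := (((h1.const_mul (4 * Real.pi)).log (by simp [h5.ne'])).const_mul
    (-(((n : ℝ) - 4) / 2))).sub (((hasDerivAt_const (0 : ℝ) (‖p.1 - X‖ ^ 2)).div
      (h1.const_mul 4) (by simp [h5.ne'])))
  have h3 : HasLineDerivAt ℝ (logKernel X T)
      (((n : ℝ) - 4) / (2 * (T - p.2)) - ∑ i, drift X T p i ^ 2) p (0, 1) := by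
    unfold HasLineDerivAt logKernel
    convert h2 using 1
    · ext s; simp
    · rw [sum_drift_sq]
      simp only [add_zero]
      field_simp
      ring
  exact h3.lineDeriv

end LogKernel

section ChainRule

variable {n : ℕ}

lemma dirDeriv_comp {f : ℝ → ℝ} {f' : ℝ} {g : Spacetime n → ℝ} {p : Spacetime n}
    (hf : HasDerivAt f f' (g p)) (hg : DifferentiableAt ℝ g p) (v : Spacetime n) :
    dirDeriv v (fun q => f (g q)) p = f' * dirDeriv v g p := by
  have h := hf.comp_hasFDerivAt p hg.hasFDerivAt
  have h2 : fderiv ℝ (fun q => f (g q)) p = f' • fderiv ℝ g p := h.fderiv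
  have h3 : DifferentiableAt ℝ (fun q => f (g q)) p := h.differentiableAt
  rw [dirDeriv_eq_fderiv h3, h2, dirDeriv_eq_fderiv hg]
  rfl

/-- The integrand of the evolution identity, when the gradient of the test function is
`F • ν + g` and the position vector is `-2τ • ν`. -/
lemma slice_integrand_eq (e K w η dη F τ : ℝ) (P ν g D y : Fin n → ℝ) (Q : Fin n → Fin n → ℝ)
    (hτ : τ ≠ 0) (hy : ∀ j, y j = -(2 * τ) * ν j) (hD : ∀ i, D i = F * ν i + g i) :
    e * dη - ∑ i, P i * D i - K * η - (-(1 / (2 * τ))) * (η * ∑ j, P j * y j -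
        η * ((n - 4) * e + w) + ∑ i, (∑ j, Q i j * y j - e * y i) * D i) =
      e * dη - F * ∑ i, ν i * P i - ∑ i, g i * P i - K * η - η * ∑ i, ν i * P i
        - η * ((n - 4) * e + w) / (2 * τ) - F * ∑ i, ∑ j, ν i * ν j * Q i j
        - ∑ i, ∑ j, g i * ν j * Q i j + e * F * ∑ i, ν i ^ 2 + e * ∑ i, ν i * g i := by
  have h1 : ∑ i, P i * D i = F * ∑ i, ν i * P i + ∑ i, g i * P i := by
    rw [Finset.mul_sum, ← Finset.sum_add_distrib]
    exact Finset.sum_congr rfl fun i _ => by rw [hD]; ring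
  have h2 : ∑ j, P j * y j = -(2 * τ) * ∑ i, ν i * P i := by
    rw [Finset.mul_sum]
    exact Finset.sum_congr rfl fun i _ => by rw [hy]; ring
  have h3 : ∑ i, (∑ j, Q i j * y j - e * y i) * D i =
      -(2 * τ) * (F * ∑ i, ∑ j, ν i * ν j * Q i j + ∑ i, ∑ j, g i * ν j * Q i j
        - e * F * ∑ i, ν i ^ 2 - e * ∑ i, ν i * g i) := by
    simp only [Finset.mul_sum, ← Finset.sum_add_distrib, ← Finset.sum_sub_distrib]
    refine Finset.sum_congr rfl fun i _ => ?_
    have h4 : ∑ j, Q i j * y j = -(2 * τ) * ∑ j, ν j * Q i j := by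
      rw [Finset.mul_sum]
      exact Finset.sum_congr rfl fun j _ => by rw [hy]; ring
    have h5 : ∑ j, F * (ν i * ν j * Q i j) = F * ν i * ∑ j, ν j * Q i j := by
      rw [Finset.mul_sum]
      exact Finset.sum_congr rfl fun j _ => by ring
    have h6 : ∑ j, g i * ν j * Q i j = g i * ∑ j, ν j * Q i j := by
      rw [Finset.mul_sum]
      exact Finset.sum_congr rfl fun j _ => by ring
    rw [h4, hy, hD]
    simp only [Finset.sum_add_distrib, h5, h6]
    ring
  rw [h1, h2, h3]
  field_simp
  ring

end ChainRule

/-! ### Integration over slabs and the time-integrated evolution inequality -/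

section Fubini

variable {n : ℕ} {a b : ℝ} {X : EuclideanSpace ℝ (Fin n)} {R : ℝ}

lemma volume_restrict_univ_prod (I : Set ℝ) :
    (volume : Measure (Spacetime n)).restrict (univ ×ˢ I) =
      (volume : Measure (EuclideanSpace ℝ (Fin n))).prod (volume.restrict I) := by
  rw [Measure.volume_eq_prod, ← Measure.prod_restrict, Measure.restrict_univ]

lemma indicator_prod_univ_apply {α β : Type*} (f : α × β → ℝ) (S : Set α) (x : α) (t : β) :
    (S ×ˢ (univ : Set β)).indicator f (x, t) = S.indicator (fun x => f (x, t)) x := by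
  classical
  simp only [indicator_apply, mem_prod, mem_univ, and_true]

/-- A function continuous on a slab is integrable on compact time intervals if it is supported
in a fixed ball. -/
lemma integrableOn_univ_prod_Ioc {g : Spacetime n → ℝ}
    (hg : ContinuousOn g (univ ×ˢ Ioo a b))
    (hs : ∀ x, x ∉ Metric.closedBall X R → ∀ t ∈ Ioo a b, g (x, t) = 0) {c d : ℝ} (hc : a < c)
    (hd : d < b) : IntegrableOn g (univ ×ˢ Ioc c d) := by
  have hsub : Icc c d ⊆ Ioo a b := fun t ht => ⟨hc.trans_le ht.1, ht.2.trans_lt hd⟩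
  have h1 : IntegrableOn g (Metric.closedBall X R ×ˢ Icc c d) :=
    (hg.mono (prod_mono (subset_univ _) hsub)).integrableOn_compact
      ((isCompact_closedBall X R).prod isCompact_Icc)
  have h2 : IntegrableOn g (univ ×ˢ Icc c d) := by
    refine h1.of_forall_sdiff_eq_zero (MeasurableSet.univ.prod measurableSet_Icc) ?_
    rintro ⟨x, t⟩ ⟨⟨-, ht⟩, hx⟩
    exact hs x (fun hx' => hx ⟨hx', ht⟩) t (hsub ht)
  exact h2.mono_set (prod_mono le_rfl Ioc_subset_Icc_self)

end Fubini

namespace IsStressBalance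

open Filter Topology

variable {n : ℕ} {e K w : Spacetime n → ℝ} {P : Fin n → Spacetime n → ℝ}
  {Q : Fin n → Fin n → Spacetime n → ℝ} {a T : ℝ} (hB : IsStressBalance e K w P Q a T)
  (X : EuclideanSpace ℝ (Fin n)) {R R₂ t₁ : ℝ}

include hB

lemma continuousOn_e : ContinuousOn e (univ ×ˢ Ioo a T) := hB.e_smooth.continuousOn

lemma setIntegral_ball_le (he : IntegrableOn e (Metric.ball X R₂ ×ˢ Ioo t₁ T)) {s : ℝ}
    (hs : s < T) : ∫ p in Metric.ball X R₂ ×ˢ Ioc t₁ s, e p ≤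
      ∫ p in Metric.ball X R₂ ×ˢ Ioo t₁ T, e p := by
  refine setIntegral_mono_set he (ae_of_all _ hB.e_nonneg) (LE.le.eventuallyLE ?_)
  exact prod_mono le_rfl fun t ht => ⟨ht.1, ht.2.trans_lt hs⟩

/-- The evolution identity, integrated in time, when its integrand is bounded above by
`C e - k`. -/
lemma integral_mul_add_le {η k : Spacetime n → ℝ}
    (hη : ContDiffOn ℝ 1 η (univ ×ˢ Ioo a T))
    (hηs : ∀ x, x ∉ Metric.closedBall X R → ∀ t ∈ Ioo a T, η (x, t) = 0)
    (hk : ContinuousOn k (univ ×ˢ Ioo a T))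
    (hks : ∀ x, x ∉ Metric.closedBall X R → ∀ t ∈ Ioo a T, k (x, t) = 0)
    (ht₁ : a < t₁) (he : IntegrableOn e (Metric.ball X R₂ ×ˢ Ioo t₁ T)) {C : ℝ} (hC : 0 ≤ C)
    (β : ℝ → ℝ) {s : ℝ} (hs : s ∈ Ioo t₁ T)
    (hle : ∀ x, ∀ t ∈ Ioo t₁ s, e (x, t) * dt η (x, t) - ∑ i, P i (x, t) * dx i η (x, t) -
        K (x, t) * η (x, t) - β t * (η (x, t) * ∑ j, P j (x, t) * (x j - X j) -
          η (x, t) * ((n - 4) * e (x, t) + w (x, t)) +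
          ∑ i, (∑ j, Q i j (x, t) * (x j - X j) - e (x, t) * (x i - X i)) * dx i η (x, t)) ≤
        C * (Metric.ball X R₂).indicator (fun x => e (x, t)) x - k (x, t)) :
    (∫ x, e (x, s) * η (x, s)) + ∫ p in univ ×ˢ Ioc t₁ s, k p ≤
      (∫ x, e (x, t₁) * η (x, t₁)) + C * ∫ p in Metric.ball X R₂ ×ˢ Ioo t₁ T, e p := by
  set F : Spacetime n → ℝ := fun p => (Metric.ball X R₂ ×ˢ univ).indicator e p with hF
  have hFt : ∀ t x, F (x, t) = (Metric.ball X R₂).indicator (fun x => e (x, t)) x :=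
    fun t x => indicator_prod_univ_apply e _ x t
  have hmeas : MeasurableSet (Metric.ball X R₂ ×ˢ univ : Set (Spacetime n)) :=
    measurableSet_ball.prod MeasurableSet.univ
  have hinter : (Metric.ball X R₂ ×ˢ univ : Set (Spacetime n)) ∩ (univ ×ˢ Ioc t₁ s) =
      Metric.ball X R₂ ×ˢ Ioc t₁ s := by
    rw [prod_inter_prod, inter_univ, univ_inter]
  have hFint : IntegrableOn F (univ ×ˢ Ioc t₁ s) := by
    rw [hF, IntegrableOn, integrable_indicator_iff hmeas, IntegrableOn,
      Measure.restrict_restrict hmeas, hinter]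
    exact he.mono_set (prod_mono le_rfl fun t ht => ⟨ht.1, ht.2.trans_lt hs.2⟩)
  have hkint : IntegrableOn k (univ ×ˢ Ioc t₁ s) :=
    integrableOn_univ_prod_Ioc hk hks ht₁ hs.2
  have hGint : IntegrableOn (fun p => C * F p - k p) (univ ×ˢ Ioc t₁ s) :=
    (hFint.const_mul C).sub hkint
  have hGprod := hGint
  rw [IntegrableOn, volume_restrict_univ_prod] at hGprod
  have hsub : ∀ {t}, t ∈ Icc t₁ s → t ∈ Ioo a T := fun ht =>
    ⟨ht₁.trans_le ht.1, ht.2.trans_lt hs.2⟩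
  -- This form of the fundamental theorem needs only an integrable upper bound for the derivative,
  -- not integrability of the derivative itself.
  have h1 := intervalIntegral.sub_le_integral_of_hasDeriv_right_of_le
    (g := fun t => ∫ x, e (x, t) * η (x, t)) (φ := fun t => ∫ x, (C * F (x, t) - k (x, t))) hs.1.le
    (fun t ht => ((hB.hasDerivAt_integral_mul X hη hηs (hsub ht)
      (β t)).2.continuousAt.continuousWithinAt))
    (fun t ht => (hB.hasDerivAt_integral_mul X hη hηs (hsub (Ioo_subset_Icc_self ht))
      (β t)).2.hasDerivWithinAt)
    (by
      rw [integrableOn_Icc_iff_integrableOn_Ioc]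
      exact hGprod.integral_prod_right)
    (fun t ht => by
      have ht' := hsub (Ioo_subset_Icc_self ht)
      refine integral_mono (hB.hasDerivAt_integral_mul X hη hηs ht' (β t)).1 ?_ fun x => ?_
      · refine Integrable.sub (Integrable.const_mul ?_ C) (integrable_slice hk ht' fun x hx =>
          hks x hx t ht')
        simp only [hFt]
        rw [integrable_indicator_iff measurableSet_ball]
        exact ((continuous_slice hB.continuousOn_e ht').continuousOn.integrableOn_compact
          (isCompact_closedBall X R₂)).mono_set Metric.ball_subset_closedBall
      · simp only [hFt]
        exact hle x t ht)
  have h2 : ∫ t in t₁..s, ∫ x, (C * F (x, t) - k (x, t)) =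
      ∫ p in univ ×ˢ Ioc t₁ s, (C * F p - k p) := by
    rw [intervalIntegral.integral_of_le hs.1.le, volume_restrict_univ_prod,
      integral_prod_symm _ hGprod]
  have h3 : ∫ p in univ ×ˢ Ioc t₁ s, (C * F p - k p) =
      C * (∫ p in Metric.ball X R₂ ×ˢ Ioc t₁ s, e p) - ∫ p in univ ×ˢ Ioc t₁ s, k p := by
    rw [integral_sub (hFint.const_mul C) hkint, integral_const_mul, hF,
      integral_indicator hmeas, Measure.restrict_restrict hmeas, hinter]
  rw [h2, h3] at h1
  have h4 := mul_le_mul_of_nonneg_left (hB.setIntegral_ball_le X he hs.2) hC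
  linarith

end IsStressBalance

/-! ### Cut-off estimates: dissipation and kernel-weighted energy up to the final time -/

section Cutoff

variable {n : ℕ} (X : EuclideanSpace ℝ (Fin n)) {R R₂ : ℝ}

/-- A time-independent cut-off function on space-time. -/
structure IsCutoff (X : EuclideanSpace ℝ (Fin n)) (R R₁ C : ℝ) (χ : Spacetime n → ℝ) : Prop where
  contDiff : ContDiff ℝ 1 χ
  nonneg : ∀ p, 0 ≤ χ p
  le_one : ∀ p, χ p ≤ 1
  eq_one : ∀ x ∈ Metric.closedBall X R, ∀ t, χ (x, t) = 1
  eq_zero : ∀ x ∉ Metric.closedBall X R₁, ∀ t, χ (x, t) = 0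
  dt_eq : ∀ p, dt χ p = 0
  dx_eq_zero_of_mem : ∀ x ∈ Metric.ball X R, ∀ t i, dx i χ (x, t) = 0
  dx_eq_zero_of_notMem : ∀ x ∉ Metric.closedBall X R₁, ∀ t i, dx i χ (x, t) = 0
  sum_dx_sq_le : ∀ p, ∑ i, dx i χ p ^ 2 ≤ C

lemma exists_isCutoff (hR : 0 < R) (hR₂ : R < R₂) : ∃ R₁ C χ, R₁ < R₂ ∧ IsCutoff X R R₁ C χ := by
  set f : ContDiffBump X := ⟨R, (R + R₂) / 2, hR, by linarith⟩ with hf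
  have hfd : ContDiff ℝ 1 f := f.contDiff
  have hdx : ∀ (i : Fin n) (x : EuclideanSpace ℝ (Fin n)) (t : ℝ),
      dx i (fun p : Spacetime n => f p.1) (x, t) = fderiv ℝ f x (EuclideanSpace.single i 1) := by
    intro i x t
    rw [← (hfd.differentiable (by simp) x).lineDeriv_eq_fderiv]
    rfl
  have hb : ∀ i : Fin n, ∃ C, ∀ x, ‖fderiv ℝ f x (EuclideanSpace.single i 1)‖ ≤ C := fun i =>
    ((hfd.continuous_fderiv (by simp)).clm_apply
      continuous_const).bounded_above_of_compact_support (f.hasCompactSupport.fderiv_apply ℝ _)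
  choose C hC using hb
  refine ⟨(R + R₂) / 2, ∑ i, C i ^ 2, fun p => f p.1, by linarith, ?_, fun p => f.nonneg,
    fun p => f.le_one, fun x hx t => f.one_of_mem_closedBall hx, ?_, ?_, ?_, ?_, ?_⟩
  · exact hfd.comp contDiff_fst
  · intro x hx t
    rw [Metric.mem_closedBall, not_le] at hx
    exact f.zero_of_le_dist hx.le
  · intro p
    simp [dt, lineDeriv]
  · intro x hx t i
    have h : (f : EuclideanSpace ℝ (Fin n) → ℝ) =ᶠ[nhds x] fun _ => (1 : ℝ) := by
      filter_upwards [Metric.isOpen_ball.mem_nhds hx] with y hy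
      exact f.one_of_mem_closedBall (Metric.ball_subset_closedBall hy)
    rw [hdx, h.fderiv_eq]
    simp
  · intro x hx t i
    have h : (f : EuclideanSpace ℝ (Fin n) → ℝ) =ᶠ[nhds x] fun _ => (0 : ℝ) := by
      filter_upwards [Metric.isClosed_closedBall.isOpen_compl.mem_nhds hx] with y hy
      rw [mem_compl_iff, Metric.mem_closedBall, not_le] at hy
      exact f.zero_of_le_dist hy.le
    rw [hdx, h.fderiv_eq]
    simp
  · rintro ⟨x, t⟩
    refine Finset.sum_le_sum fun i _ => ?_
    rw [hdx]
    exact sq_le_sq' (by linarith [neg_le_of_abs_le (hC i x)]) (le_of_abs_le (hC i x))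

lemma IsCutoff.dx_eq_zero_of_notMem_ball {R₁ C : ℝ} {χ : Spacetime n → ℝ} (h : IsCutoff X R R₁ C χ)
    (hR : R₁ < R₂) (x : EuclideanSpace ℝ (Fin n)) (hx : x ∉ Metric.ball X R₂) (t : ℝ) (i : Fin n) :
    dx i χ (x, t) = 0 :=
  h.dx_eq_zero_of_notMem x (fun hx' => hx (lt_of_le_of_lt hx' hR)) t i

/-- Away from its centre the heat kernel is bounded, also after division by the elapsed time. -/
lemma exists_exp_logKernel_le (hn : 4 < n) (hR : 0 < R) : ∃ C, 0 ≤ C ∧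
    ∀ (T : ℝ) (p : Spacetime n), p.2 < T → R ≤ ‖p.1 - X‖ →
      Real.exp (logKernel X T p) * (1 + 1 / (T - p.2)) ≤ C := by
  have key : ∀ k : ℝ, 0 < k → ∃ C, ∀ u : ℝ, 0 < u →
      Real.exp (-k * Real.log u - Real.pi * R ^ 2 / u) ≤ C := by
    intro k hk
    -- The point where `-k log u - πR²/u` is maximal; the bound is its value there, obtained from
    -- `log (δ/u) ≤ δ/u - 1`.
    set δ := Real.pi * R ^ 2 / k with hδ
    have hδ0 : 0 < δ := by positivity
    refine ⟨Real.exp (-k - k * Real.log δ), fun u hu => Real.exp_le_exp.mpr ?_⟩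
    have h1 := Real.log_le_sub_one_of_pos (div_pos hδ0 hu)
    rw [Real.log_div hδ0.ne' hu.ne'] at h1
    have h2 := mul_le_mul_of_nonneg_left h1 hk.le
    have h3 : k * (δ / u) = Real.pi * R ^ 2 / u := by rw [hδ]; field_simp
    linarith [h3, mul_sub k (δ / u) 1, mul_sub k (Real.log δ) (Real.log u)]
  have hm : (0 : ℝ) < ((n : ℝ) - 4) / 2 := by
    have : (4 : ℝ) < n := by exact_mod_cast hn
    linarith
  obtain ⟨C₁, hC₁⟩ := key _ hm
  -- Raising the exponent by one accounts for the factor `1/(T - t)`, which is `4π/u` for `u = 4π(T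
  -- - t)`.
  obtain ⟨C₂, hC₂⟩ := key (((n : ℝ) - 4) / 2 + 1) (by linarith)
  have hC₁0 : 0 ≤ C₁ := (Real.exp_pos _).le.trans (hC₁ 1 one_pos)
  have hC₂0 : 0 ≤ C₂ := (Real.exp_pos _).le.trans (hC₂ 1 one_pos)
  refine ⟨C₁ + 4 * Real.pi * C₂, by positivity, fun T p hp hRp => ?_⟩
  have hτ : 0 < T - p.2 := sub_pos.mpr hp
  have hu : 0 < 4 * Real.pi * (T - p.2) := by positivity
  have h1 : logKernel X T p ≤ -(((n : ℝ) - 4) / 2) * Real.log (4 * Real.pi * (T - p.2)) -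
      Real.pi * R ^ 2 / (4 * Real.pi * (T - p.2)) := by
    have h2 : Real.pi * R ^ 2 / (4 * Real.pi * (T - p.2)) = R ^ 2 / (4 * (T - p.2)) := by
      field_simp
    rw [h2, logKernel]
    have h3 : R ^ 2 / (4 * (T - p.2)) ≤ ‖p.1 - X‖ ^ 2 / (4 * (T - p.2)) := by gcongr
    linarith
  have h4 := (Real.exp_le_exp.mpr h1).trans (hC₁ _ hu)
  have h5 : Real.exp (logKernel X T p) * (1 / (T - p.2)) ≤ 4 * Real.pi * C₂ := by
    have h6 : 1 / (T - p.2) = 4 * Real.pi * Real.exp (-Real.log (4 * Real.pi * (T - p.2))) := by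
      rw [Real.exp_neg, Real.exp_log hu]
      field_simp
    rw [h6, mul_left_comm, ← Real.exp_add]
    refine mul_le_mul_of_nonneg_left ?_ (by positivity)
    refine (Real.exp_le_exp.mpr ?_).trans (hC₂ _ hu)
    linarith
  rw [mul_add, mul_one]
  linarith

lemma sum_add_mul_eq (c : ℝ) (v g P : Fin n → ℝ) :
    ∑ i, (c * v i + g i) * P i = c * ∑ i, v i * P i + ∑ i, g i * P i := by
  rw [Finset.mul_sum, ← Finset.sum_add_distrib]
  exact Finset.sum_congr rfl fun i _ => by ring

lemma sum_sum_add_mul_eq {Q : Fin n → Fin n → ℝ} (hQ : ∀ i j, Q i j = Q j i) (c : ℝ)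
    (v g : Fin n → ℝ) :
    ∑ i, ∑ j, (c * v i + g i) * (c * v j + g j) * Q i j =
      c ^ 2 * ∑ i, ∑ j, v i * v j * Q i j + 2 * c * ∑ i, ∑ j, g i * v j * Q i j +
        ∑ i, ∑ j, g i * g j * Q i j := by
  have h : ∑ i, ∑ j, v i * g j * Q i j = ∑ i, ∑ j, g i * v j * Q i j := by
    rw [Finset.sum_comm]
    refine Finset.sum_congr rfl fun i _ => Finset.sum_congr rfl fun j _ => ?_
    rw [hQ]
    ring
  have h2 : 2 * c * ∑ i, ∑ j, g i * v j * Q i j =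
      c * ∑ i, ∑ j, v i * g j * Q i j + c * ∑ i, ∑ j, g i * v j * Q i j := by rw [h]; ring
  rw [h2]
  simp only [Finset.mul_sum, ← Finset.sum_add_distrib]
  exact Finset.sum_congr rfl fun i _ => Finset.sum_congr rfl fun j _ => by ring

end Cutoff

namespace IsStressBalance

open Filter Topology

variable {n : ℕ} {e K w : Spacetime n → ℝ} {P : Fin n → Spacetime n → ℝ}
  {Q : Fin n → Fin n → Spacetime n → ℝ} {a T : ℝ} (hB : IsStressBalance e K w P Q a T)
  (X : EuclideanSpace ℝ (Fin n)) {R R₂ t₁ : ℝ}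

include hB

lemma K_nonneg (p : Spacetime n) : 0 ≤ K p := by
  simpa using hB.form_nonneg p 1 0

/-- The energy law tested with `χ²`, without the dilation term. Half of the dissipation absorbs the
flux through `∇χ`, at a cost bounded by a multiple of `e`, which is integrable up to `T`. -/
lemma integrableOn_K (hR : 0 < R) (hR₂ : R < R₂) (ht₁ : t₁ ∈ Ioo a T)
    (he : IntegrableOn e (Metric.ball X R₂ ×ˢ Ioo t₁ T)) :
    IntegrableOn K (Metric.ball X R ×ˢ Ioo t₁ T) := by
  obtain ⟨R₁, C, χ, hR₁, hχ⟩ := exists_isCutoff X hR hR₂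
  have hχc := hχ.contDiff
  have hχd : ∀ p, DifferentiableAt ℝ χ p := hχc.differentiable (by simp)
  have hC : 0 ≤ C := (Finset.sum_nonneg fun i _ => sq_nonneg _).trans (hχ.sum_dx_sq_le (X, 0))
  set k : Spacetime n → ℝ := fun p => K p * (χ p * χ p) / 2 with hk
  have hkc : ContinuousOn k (univ ×ˢ Ioo a T) :=
    (hB.K_cont.mul (hχc.continuous.mul hχc.continuous).continuousOn).div_const 2
  have hks : ∀ x, x ∉ Metric.closedBall X R₁ → ∀ t ∈ Ioo a T, k (x, t) = 0 := fun x hx t _ => by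
    simp [hk, hχ.eq_zero x hx t]
  have hmain : ∀ s ∈ Ioo t₁ T, ∫ p in univ ×ˢ Ioc t₁ s, k p ≤
      (∫ x, e (x, t₁) * (χ (x, t₁) * χ (x, t₁))) +
        (8 * C) * ∫ p in Metric.ball X R₂ ×ˢ Ioo t₁ T, e p := by
    intro s hs
    have h := hB.integral_mul_add_le X (η := fun p => χ p * χ p) (k := k) (R := R₁) (R₂ := R₂)
      (hχc.mul hχc).contDiffOn
      (fun x hx t _ => by simp [hχ.eq_zero x hx t]) hkc hks ht₁.1 he (C := 8 * C) (by positivity)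
      (fun _ => 0) hs (fun x t ht => ?_)
    · have h0 : 0 ≤ ∫ x, e (x, s) * (χ (x, s) * χ (x, s)) :=
        integral_nonneg fun x => mul_nonneg (hB.e_nonneg _) (mul_self_nonneg _)
      linarith
    · have h1 : dt (fun p => χ p * χ p) (x, t) = 0 := by
        have : dt (fun p => χ p * χ p) (x, t) = _ := dirDeriv_mul (hχd (x, t)) (hχd (x, t))
        have h0 := hχ.dt_eq (x, t)
        rw [dt] at h0
        rw [this]
        simp [dirDeriv, h0]
      have h2 : ∀ i, dx i (fun p => χ p * χ p) (x, t) = 2 * χ (x, t) * dx i χ (x, t) := by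
        intro i
        have : dx i (fun p => χ p * χ p) (x, t) = _ := dirDeriv_mul (hχd (x, t)) (hχd (x, t))
        rw [this, dx, dirDeriv]
        ring
      -- Half of this square reads `-2χ ∇χ·P ≤ χ²K/2 + 2Q(∇χ,∇χ)`, and `2Q(∇χ,∇χ) ≤ 8 C e` by the
      -- stress bound.
      have hform := hB.form_nonneg (x, t) (χ (x, t)) (fun i => 2 * dx i χ (x, t))
      have h3 : ∑ i, ∑ j, 2 * dx i χ (x, t) * (2 * dx j χ (x, t)) * Q i j (x, t) ≤
          16 * C * (Metric.ball X R₂).indicator (fun x => e (x, t)) x := by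
        by_cases hx : x ∈ Metric.ball X R₂
        · rw [indicator_of_mem hx]
          refine (hB.stress_le (x, t) fun i => 2 * dx i χ (x, t)).trans ?_
          simp only [mul_pow, ← Finset.mul_sum]
          nlinarith [mul_le_mul_of_nonneg_left (hχ.sum_dx_sq_le (x, t)) (hB.e_nonneg (x, t))]
        · simp [hχ.dx_eq_zero_of_notMem_ball X hR₁ x hx t, hx, indicator]
      have h4 : ∑ i, P i (x, t) * (2 * χ (x, t) * dx i χ (x, t)) =
          χ (x, t) * ∑ i, 2 * dx i χ (x, t) * P i (x, t) := by
        rw [Finset.mul_sum]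
        exact Finset.sum_congr rfl fun i _ => by ring
      simp only [h1, h2, h4, zero_mul, hk]
      nlinarith [h3, hform]
  -- The bound does not depend on the end time `s < T`, so exhausting the slab by such times gives
  -- integrability up to `T`.
  have hkint : IntegrableOn k (univ ×ˢ Ioo t₁ T) := by
    obtain ⟨s, -, hsI, hsT⟩ := exists_seq_strictMono_tendsto' ht₁.2
    have hcov : AECover (volume.restrict (univ ×ˢ Ioo t₁ T : Set (Spacetime n))) atTop
        (fun j => (univ ×ˢ Iic (s j) : Set (Spacetime n))) := by
      refine ⟨?_, fun j => MeasurableSet.univ.prod measurableSet_Iic⟩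
      filter_upwards [ae_restrict_mem (MeasurableSet.univ.prod measurableSet_Ioo)] with p hp
      filter_upwards [hsT.eventually (lt_mem_nhds hp.2.2)] with j hj
      exact ⟨mem_univ _, hj.le⟩
    have hinter : ∀ j, (univ ×ˢ Iic (s j) : Set (Spacetime n)) ∩ (univ ×ˢ Ioo t₁ T) =
        univ ×ˢ Ioc t₁ (s j) := by
      intro j
      rw [prod_inter_prod, inter_univ]
      congr 1
      ext t
      simp only [mem_inter_iff, mem_Iic, mem_Ioo, mem_Ioc]
      exact ⟨fun h => ⟨h.2.1, h.1⟩, fun h => ⟨h.2, h.1, h.2.trans_lt (hsI j).2⟩⟩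
    have hres : ∀ j, (volume.restrict (univ ×ˢ Ioo t₁ T : Set (Spacetime n))).restrict
        (univ ×ˢ Iic (s j)) = volume.restrict (univ ×ˢ Ioc t₁ (s j)) := fun j => by
      rw [Measure.restrict_restrict (MeasurableSet.univ.prod measurableSet_Iic), hinter]
    refine hcov.integrable_of_integral_bounded_of_nonneg_ae
      ((∫ x, e (x, t₁) * (χ (x, t₁) * χ (x, t₁))) +
        (8 * C) * ∫ p in Metric.ball X R₂ ×ˢ Ioo t₁ T, e p) (fun j => ?_)
      (ae_of_all _ fun p => ?_) (Eventually.of_forall fun j => ?_)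
    · rw [IntegrableOn, hres]
      exact integrableOn_univ_prod_Ioc hkc hks ht₁.1 (hsI j).2
    · exact div_nonneg (mul_nonneg (hB.K_nonneg p) (mul_self_nonneg _)) zero_le_two
    · rw [hres]
      exact hmain (s j) (hsI j)
  have h2 : IntegrableOn (fun p => 2 * k p) (Metric.ball X R ×ˢ Ioo t₁ T) :=
    (hkint.mono_set (prod_mono (subset_univ _) le_rfl)).const_mul 2
  refine h2.congr_fun (fun p hp => ?_) (measurableSet_ball.prod measurableSet_Ioo)
  have h3 : χ p = 1 := hχ.eq_one p.1 (Metric.ball_subset_closedBall hp.1) p.2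
  simp only [hk, h3]
  ring

/-- The heat-kernel-weighted energy stays bounded up to the final time, uniformly in the
singular time of the kernel. -/
lemma exists_integral_exp_logKernel_le (hn : 4 < n) (hR : 0 < R) (hR₂ : R < R₂)
    (ht₁ : t₁ ∈ Ioo a T) (he : IntegrableOn e (Metric.ball X R₂ ×ˢ Ioo t₁ T)) :
    ∃ M, ∀ s ∈ Ioo t₁ T, ∀ T' ≥ T,
      ∫ x in Metric.ball X R, e (x, s) * Real.exp (logKernel X T' (x, s)) ≤ M := by
  obtain ⟨R₁, C, χ, hR₁, hχ⟩ := exists_isCutoff X hR hR₂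
  have hχc := hχ.contDiff
  have hχd : ∀ p, DifferentiableAt ℝ χ p := hχc.differentiable (by simp)
  have hC : 0 ≤ C := (Finset.sum_nonneg fun i _ => sq_nonneg _).trans (hχ.sum_dx_sq_le (X, 0))
  obtain ⟨D, hD0, hD⟩ := exists_exp_logKernel_le X hn hR
  have hm : (0 : ℝ) < (n : ℝ) - 4 := sub_pos.mpr (by exact_mod_cast hn)
  have hint0 : Integrable fun x => e (x, t₁) * (χ (x, t₁) * χ (x, t₁)) :=
    integrable_slice (X := X) (R := R₁) (g := fun p => e p * (χ p * χ p))
      (hB.continuousOn_e.mul (hχc.mul hχc).continuous.continuousOn) ht₁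
      fun x hx => by simp [hχ.eq_zero x hx t₁]
  refine ⟨Real.exp (-(((n : ℝ) - 4) / 2) * Real.log (4 * Real.pi * (T - t₁))) *
    (∫ x, e (x, t₁) * (χ (x, t₁) * χ (x, t₁))) +
      ((4 * C + R₂ ^ 2) * D) * ∫ p in Metric.ball X R₂ ×ˢ Ioo t₁ T, e p, fun s hs T' hT' => ?_⟩
  set Ψ : Spacetime n → ℝ := logKernel X T' with hΨ
  have hΨc : ContDiffOn ℝ 1 Ψ (univ ×ˢ Ioo a T) := contDiffOn_logKernel hT'
  have hηc : ContDiffOn ℝ 1 (fun p => χ p * χ p * Real.exp (Ψ p)) (univ ×ˢ Ioo a T) :=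
    (hχc.mul hχc).contDiffOn.mul hΨc.exp
  have hηs : ∀ x, x ∉ Metric.closedBall X R₁ → ∀ t ∈ Ioo a T,
      χ (x, t) * χ (x, t) * Real.exp (Ψ (x, t)) = 0 := fun x hx t _ => by
    simp [hχ.eq_zero x hx t]
  -- The multiple `-1/(2(T' - t))` turns the dilation field `x - X` into the gradient of `Ψ`.
  have h := hB.integral_mul_add_le X (η := fun p => χ p * χ p * Real.exp (Ψ p)) (k := fun _ => 0)
      (R := R₁) (R₂ := R₂) hηc hηs continuousOn_const (fun _ _ _ _ => rfl) ht₁.1 he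
      (C := (4 * C + R₂ ^ 2) * D) (by positivity) (fun t => -(1 / (2 * (T' - t)))) hs
      (fun x t ht => ?_)
  · have hsI : s ∈ Ioo a T := ⟨ht₁.1.trans hs.1, hs.2⟩
    have h0 : ∫ x in Metric.ball X R, e (x, s) * Real.exp (Ψ (x, s)) ≤
        ∫ x, e (x, s) * (χ (x, s) * χ (x, s) * Real.exp (Ψ (x, s))) := by
      have hi : Integrable fun x => e (x, s) * (χ (x, s) * χ (x, s) * Real.exp (Ψ (x, s))) :=
        integrable_slice (X := X) (R := R₁) (g := fun p => e p * (χ p * χ p * Real.exp (Ψ p)))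
          (hB.continuousOn_e.mul hηc.continuousOn) hsI
          fun x hx => by simp [hχ.eq_zero x hx s]
      refine le_trans (le_of_eq ?_) (setIntegral_le_integral (s := Metric.ball X R) hi
        (ae_of_all _ fun x => ?_))
      · refine setIntegral_congr_fun measurableSet_ball fun x hx => ?_
        simp [hχ.eq_one x (Metric.ball_subset_closedBall hx) s]
      · exact mul_nonneg (hB.e_nonneg _) (mul_nonneg (mul_self_nonneg _) (Real.exp_pos _).le)
    have h1 : ∫ x, e (x, t₁) * (χ (x, t₁) * χ (x, t₁) * Real.exp (Ψ (x, t₁))) ≤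
        Real.exp (-(((n : ℝ) - 4) / 2) * Real.log (4 * Real.pi * (T - t₁))) *
          (∫ x, e (x, t₁) * (χ (x, t₁) * χ (x, t₁))) := by
      rw [← integral_const_mul]
      refine integral_mono (integrable_slice (X := X) (R := R₁)
        (g := fun p => e p * (χ p * χ p * Real.exp (Ψ p)))
          (hB.continuousOn_e.mul hηc.continuousOn) ht₁
          fun x hx => by simp [hχ.eq_zero x hx t₁]) (hint0.const_mul _) fun x => ?_
      -- At the initial time `T' - t₁ ≥ T - t₁`, so the kernel is bounded independently of `T'`.
      have h2 : Ψ (x, t₁) ≤ -(((n : ℝ) - 4) / 2) * Real.log (4 * Real.pi * (T - t₁)) := by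
        have hp : 0 < T - t₁ := sub_pos.mpr ht₁.2
        have hp' : T - t₁ ≤ T' - t₁ := by linarith
        have h3 : Real.log (4 * Real.pi * (T - t₁)) ≤ Real.log (4 * Real.pi * (T' - t₁)) :=
          Real.log_le_log (by positivity) (by gcongr)
        have h4 : 0 ≤ ‖x - X‖ ^ 2 / (4 * (T' - t₁)) :=
          div_nonneg (sq_nonneg _) (by linarith)
        simp only [hΨ, logKernel]
        nlinarith
      have h3 := Real.exp_le_exp.mpr h2
      have h4 : 0 ≤ e (x, t₁) * (χ (x, t₁) * χ (x, t₁)) :=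
        mul_nonneg (hB.e_nonneg _) (mul_self_nonneg _)
      calc e (x, t₁) * (χ (x, t₁) * χ (x, t₁) * Real.exp (Ψ (x, t₁)))
          = e (x, t₁) * (χ (x, t₁) * χ (x, t₁)) * Real.exp (Ψ (x, t₁)) := by ring
        _ ≤ _ := by
          rw [mul_comm (Real.exp _)]
          exact mul_le_mul_of_nonneg_left h3 h4
    simp only [integral_zero, add_zero] at h
    linarith
  · have htT' : t < T' := (ht.2.trans hs.2).trans_le hT'
    have hτ : 0 < T' - t := sub_pos.mpr htT'
    have hΨd : DifferentiableAt ℝ Ψ (x, t) := differentiableAt_logKernel htT'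
    have hed : ∀ v, dirDeriv v (fun p => Real.exp (Ψ p)) (x, t) =
        Real.exp (Ψ (x, t)) * dirDeriv v Ψ (x, t) := fun v =>
      dirDeriv_comp (Real.hasDerivAt_exp _) hΨd v
    have hd : ∀ v, dirDeriv v (fun p => χ p * χ p * Real.exp (Ψ p)) (x, t) =
        Real.exp (Ψ (x, t)) * (χ (x, t) * χ (x, t) * dirDeriv v Ψ (x, t) +
          2 * χ (x, t) * dirDeriv v χ (x, t)) := by
      intro v
      rw [dirDeriv_mul (f := fun p => χ p * χ p) ((hχd _).fun_mul (hχd _)) hΨd.exp, hed,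
        dirDeriv_mul (hχd _) (hχd _)]
      ring
    have h1 : dt (fun p => χ p * χ p * Real.exp (Ψ p)) (x, t) = Real.exp (Ψ (x, t)) *
        (χ (x, t) * χ (x, t) * (((n : ℝ) - 4) / (2 * (T' - t)) -
          ∑ i, drift X T' (x, t) i ^ 2)) := by
      have h2 := hd (0, 1)
      have h3 : dirDeriv ((0, 1) : Spacetime n) χ (x, t) = 0 := hχ.dt_eq (x, t)
      have h4 : dirDeriv ((0, 1) : Spacetime n) Ψ (x, t) = _ := dt_logKernel (X := X) htT'
      rw [h3, h4, mul_zero, add_zero] at h2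
      exact h2
    have h2 : ∀ i, dx i (fun p => χ p * χ p * Real.exp (Ψ p)) (x, t) =
        (Real.exp (Ψ (x, t)) * (χ (x, t) * χ (x, t))) * drift X T' (x, t) i +
          Real.exp (Ψ (x, t)) * (2 * χ (x, t)) * dx i χ (x, t) := by
      intro i
      have h2 : dx i (fun p => χ p * χ p * Real.exp (Ψ p)) (x, t) = _ :=
        hd (EuclideanSpace.single i 1, 0)
      have h4 : dirDeriv ((EuclideanSpace.single i 1, 0) : Spacetime n) Ψ (x, t) = _ :=
        dx_logKernel (X := X) htT' i
      rw [h2, h4, dx, dirDeriv]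
      ring
    have hy : ∀ j, x j - X j = -(2 * (T' - t)) * drift X T' (x, t) j := by
      intro j
      have : t - T' ≠ 0 := (sub_neg.mpr htT').ne
      simp only [drift]
      field_simp
      ring
    rw [slice_integrand_eq (e (x, t)) (K (x, t)) (w (x, t)) _ _ _ (T' - t) (fun i => P i (x, t))
      (drift X T' (x, t)) _ _ _ (fun i j => Q i j (x, t)) hτ.ne' hy h2, h1, sub_zero]
    set p : Spacetime n := (x, t)
    set ν := drift X T' p
    have e1 : ∑ i, Real.exp (Ψ p) * (2 * χ p) * dx i χ p * P i p =
        Real.exp (Ψ p) * (2 * χ p) * ∑ i, dx i χ p * P i p := by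
      rw [Finset.mul_sum]
      exact Finset.sum_congr rfl fun i _ => by ring
    have e2 : ∑ i, ∑ j, Real.exp (Ψ p) * (2 * χ p) * dx i χ p * ν j * Q i j p =
        Real.exp (Ψ p) * (2 * χ p) * ∑ i, ∑ j, dx i χ p * ν j * Q i j p := by
      simp only [Finset.mul_sum]
      exact Finset.sum_congr rfl fun i _ => Finset.sum_congr rfl fun j _ => by ring
    have e3 : ∑ i, ν i * (Real.exp (Ψ p) * (2 * χ p) * dx i χ p) =
        Real.exp (Ψ p) * (2 * χ p) * ∑ i, ν i * dx i χ p := by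
      rw [Finset.mul_sum]
      exact Finset.sum_congr rfl fun i _ => by ring
    -- Completing the square with `∇χ` included: the integrand becomes minus this square, minus a
    -- `w` term, plus the remainder `Q(∇χ,∇χ) + 2eχ ν·∇χ`, all weighted by `exp Ψ`.
    have hform := hB.form_nonneg p (χ p) (fun i => χ p * ν i + dx i χ p)
    rw [sum_add_mul_eq, sum_sum_add_mul_eq (hB.symm · · p)] at hform
    rw [e1, e2, e3]
    have hw : 0 ≤ χ p * χ p * Real.exp (Ψ p) * w p / (2 * (T' - t)) :=
      div_nonneg (mul_nonneg (mul_nonneg (mul_self_nonneg _) (Real.exp_pos _).le) (hB.w_nonneg p))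
        (by positivity)
    have hform' := mul_nonneg (Real.exp_pos (Ψ p)).le hform
    -- The remainder lives where `∇χ ≠ 0`, hence at distance at least `R` from `X`. There `exp Ψ (1
    -- + 1/(T' - t))` is bounded, and the second factor controls the size of `ν`.
    have hgrad : Real.exp (Ψ p) * (∑ i, ∑ j, dx i χ p * dx j χ p * Q i j p +
        e p * (2 * χ p) * ∑ i, ν i * dx i χ p) ≤
          (4 * C + R₂ ^ 2) * D * (Metric.ball X R₂).indicator (fun x => e (x, t)) x := by
      have hS := hχ.sum_dx_sq_le p
      have hQ := hB.stress_le p fun i => dx i χ p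
      by_cases hxR : x ∈ Metric.ball X R
      · have h0 : ∀ i, dx i χ p = 0 := hχ.dx_eq_zero_of_mem x hxR t
        simp only [h0, zero_mul, mul_zero, Finset.sum_const_zero, add_zero]
        exact mul_nonneg (by positivity) (indicator_nonneg (fun x _ => hB.e_nonneg _) x)
      by_cases hx : x ∈ Metric.ball X R₂
      · rw [indicator_of_mem hx]
        rw [Metric.mem_ball, dist_eq_norm] at hx
        rw [Metric.mem_ball, dist_eq_norm, not_lt] at hxR
        have hDp := hD T' p htT' hxR
        have h3 : ∑ i, ν i * dx i χ p ≤ (R₂ ^ 2 + C) * (1 / (4 * (T' - t))) := by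
          have h4 : ∀ i, ν i * dx i χ p ≤
              ((x i - X i) ^ 2 + dx i χ p ^ 2) * (1 / (4 * (T' - t))) := by
            intro i
            have h5 : ν i = -(x i - X i) * (2 * (1 / (4 * (T' - t)))) := by
              rw [hy i]
              field_simp
              ring
            have h6 : 0 ≤ 1 / (4 * (T' - t)) := by positivity
            rw [h5]
            nlinarith [mul_nonneg (sq_nonneg ((x i - X i) + dx i χ p)) h6]
          refine (Finset.sum_le_sum fun i _ => h4 i).trans ?_
          rw [← Finset.sum_mul, Finset.sum_add_distrib, ← norm_sub_sq_eq_sum]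
          gcongr
        have h4 : e p * (2 * χ p) * ∑ i, ν i * dx i χ p ≤
            e p * ((R₂ ^ 2 + C) * (1 / (T' - t))) := by
          have h5 : 0 ≤ (R₂ ^ 2 + C) * (1 / (4 * (T' - t))) := by positivity
          have h6 : (R₂ ^ 2 + C) * (1 / (T' - t)) = 4 * ((R₂ ^ 2 + C) * (1 / (4 * (T' - t)))) := by
            field_simp
          rw [mul_assoc, h6]
          refine mul_le_mul_of_nonneg_left ?_ (hB.e_nonneg p)
          have h7 := hχ.nonneg p
          have h8 := hχ.le_one p
          calc 2 * χ p * ∑ i, ν i * dx i χ p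
              ≤ 2 * χ p * ((R₂ ^ 2 + C) * (1 / (4 * (T' - t)))) := by gcongr
            _ ≤ 2 * 1 * ((R₂ ^ 2 + C) * (1 / (4 * (T' - t)))) := by gcongr
            _ ≤ _ := by linarith
        have h5 : 0 ≤ 1 / (T' - t) := by positivity
        have hDp' : Real.exp (Ψ p) * (1 + 1 / (T' - t)) ≤ D := hDp
        have he0 : 0 ≤ e p := hB.e_nonneg p
        calc Real.exp (Ψ p) * (∑ i, ∑ j, dx i χ p * dx j χ p * Q i j p +
              e p * (2 * χ p) * ∑ i, ν i * dx i χ p)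
            ≤ Real.exp (Ψ p) * (4 * e p * C + e p * ((R₂ ^ 2 + C) * (1 / (T' - t)))) := by
              gcongr
              exact hQ.trans (by gcongr)
          _ ≤ Real.exp (Ψ p) * (e p * ((4 * C + R₂ ^ 2) * (1 + 1 / (T' - t)))) := by
              gcongr
              have h6 : 0 ≤ e p * R₂ ^ 2 := by positivity
              have h7 : 0 ≤ e p * (3 * C * (1 / (T' - t))) := by positivity
              linarith
          _ = (4 * C + R₂ ^ 2) * (Real.exp (Ψ p) * (1 + 1 / (T' - t))) * e p := by ring
          _ ≤ _ := by gcongr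
      · have h0 : ∀ i, dx i χ p = 0 := hχ.dx_eq_zero_of_notMem_ball X hR₁ x hx t
        simp only [h0, zero_mul, mul_zero, Finset.sum_const_zero, add_zero]
        exact mul_nonneg (by positivity) (indicator_nonneg (fun x _ => hB.e_nonneg _) x)
    refine le_trans ?_ hgrad
    have hdiv : χ p * χ p * Real.exp (Ψ p) * ((n - 4) * e p + w p) / (2 * (T' - t)) =
        e p * (Real.exp (Ψ p) * (χ p * χ p * (((n : ℝ) - 4) / (2 * (T' - t))))) +
          χ p * χ p * Real.exp (Ψ p) * w p / (2 * (T' - t)) := by ring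
    rw [hdiv]
    linear_combination hform' + hw

end IsStressBalance

/-! ### Geometry of heat balls -/

section HeatBallGeometry

variable {n : ℕ} {X : EuclideanSpace ℝ (Fin n)} {T r : ℝ} {p : Spacetime n}

lemma sub_four_pos (hn : 4 < n) : (0 : ℝ) < (n : ℝ) - 4 := sub_pos.mpr (by exact_mod_cast hn)

lemma one_le_sub_four (hn : 4 < n) : (1 : ℝ) ≤ (n : ℝ) - 4 := by
  have : (5 : ℝ) ≤ n := by exact_mod_cast hn
  linarith

lemma isOpen_heatBall (hr : 0 < r) : IsOpen (heatBall X T r) := by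
  have h1 : IsOpen {p : Spacetime n | p.2 < T} := isOpen_lt continuous_snd continuous_const
  have h2 : ContinuousOn (fun p => ((n : ℝ) - 4) * Real.log r + logKernel X T p)
      {p : Spacetime n | p.2 < T} := fun p hp =>
    ((differentiableAt_logKernel hp).continuousAt.const_add _).continuousWithinAt
  convert h2.isOpen_inter_preimage h1 (isOpen_Ioi (a := (0 : ℝ))) using 1
  ext p
  rw [mem_heatBall_iff hr]
  rfl

lemma heatBall_mono {ρ : ℝ} (hn : 4 < n) (hρ : 0 < ρ) (h : ρ ≤ r) :
    heatBall X T ρ ⊆ heatBall X T r := by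
  intro p hp
  rw [mem_heatBall_iff (hρ.trans_le h)]
  rw [mem_heatBall_iff hρ] at hp
  have := mul_le_mul_of_nonneg_left (Real.log_le_log hρ h) (sub_four_pos hn).le
  exact ⟨hp.1, by linarith⟩

/-- The logarithm of `Φ > r⁻ᵐ`, solved for the distance. The three size bounds below estimate the
logarithm on the right in different ways. -/
lemma norm_sq_lt_of_mem_heatBall (hr : 0 < r) (hp : p ∈ heatBall X T r) :
    ‖p.1 - X‖ ^ 2 <
      2 * ((n : ℝ) - 4) * (T - p.2) * Real.log (r ^ 2 / (4 * Real.pi * (T - p.2))) := by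
  rw [mem_heatBall_iff hr] at hp
  have hτ : 0 < T - p.2 := sub_pos.mpr hp.1
  have h := hp.2
  have h4 : 0 < 4 * Real.pi * (T - p.2) := by positivity
  rw [Real.log_div (by positivity) h4.ne', Real.log_pow]
  rw [logKernel] at h
  push_cast
  have h5 : ‖p.1 - X‖ ^ 2 = 4 * (T - p.2) * (‖p.1 - X‖ ^ 2 / (4 * (T - p.2))) := by
    field_simp
  rw [h5]
  have h6 := mul_lt_mul_of_pos_left (sub_pos.mp (by linarith :
    0 < (((n : ℝ) - 4) * Real.log r - (((n : ℝ) - 4) / 2) * Real.log (4 * Real.pi * (T - p.2))) -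
      ‖p.1 - X‖ ^ 2 / (4 * (T - p.2)))) (by positivity : 0 < 4 * (T - p.2))
  linarith

lemma lt_snd_of_mem_heatBall (hn : 4 < n) (hr : 0 < r) (hp : p ∈ heatBall X T r) :
    T - r ^ 2 / (4 * Real.pi) < p.2 := by
  have h1 := norm_sq_lt_of_mem_heatBall hr hp
  have hτ : 0 < T - p.2 := sub_pos.mpr hp.1
  have hm := sub_four_pos hn
  have h2 : 0 < Real.log (r ^ 2 / (4 * Real.pi * (T - p.2))) := by
    by_contra h
    have h3 := mul_nonpos_of_nonneg_of_nonpos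
      (by positivity : 0 ≤ 2 * ((n : ℝ) - 4) * (T - p.2)) (not_lt.mp h)
    linarith [sq_nonneg ‖p.1 - X‖]
  rw [Real.log_pos_iff (by positivity), lt_div_iff₀ (by positivity), one_mul] at h2
  have h3 : T - p.2 < r ^ 2 / (4 * Real.pi) := by
    rw [lt_div_iff₀ (by positivity)]
    linarith
  linarith

/-- The inequality `log q ≤ q/e` makes the time cancel and produces exactly `cₙ² r²`. -/
lemma norm_lt_of_mem_heatBall (hn : 4 < n) (hr : 0 < r) (hp : p ∈ heatBall X T r) :
    ‖p.1 - X‖ < cConst n * r := by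
  have h1 := norm_sq_lt_of_mem_heatBall hr hp
  have hτ : 0 < T - p.2 := sub_pos.mpr hp.1
  have hm := sub_four_pos hn
  have he := Real.exp_pos 1
  set q := r ^ 2 / (4 * Real.pi * (T - p.2)) with hq
  have hq0 : 0 < q := by positivity
  have h2 : Real.log q ≤ q / Real.exp 1 := by
    have h3 := Real.log_le_sub_one_of_pos (div_pos hq0 he)
    rw [Real.log_div hq0.ne' he.ne', Real.log_exp] at h3
    linarith
  have h3 : ‖p.1 - X‖ ^ 2 < (cConst n * r) ^ 2 := by
    rw [cConst, mul_pow, Real.sq_sqrt (by positivity)]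
    refine h1.trans_le ((mul_le_mul_of_nonneg_left h2 (by positivity)).trans (le_of_eq ?_))
    rw [hq]
    field_simp
    ring
  exact lt_of_pow_lt_pow_left₀ 2 (mul_nonneg (Real.sqrt_nonneg _) hr.le) h3

lemma heatBall_subset (hn : 4 < n) (hr : 0 < r) : heatBall X T r ⊆
    Metric.ball X (cConst n * r) ×ˢ Ioo (T - r ^ 2 / (4 * Real.pi)) T := fun p hp =>
  ⟨by rw [Metric.mem_ball, dist_eq_norm]; exact norm_lt_of_mem_heatBall hn hr hp,
    lt_snd_of_mem_heatBall hn hr hp, hp.1⟩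

/-- The slices shrink slightly more slowly than parabolically. Bounding the logarithm by the power
`1/4` replaces `τ log (1/τ)` by `τ^(3/4)`. -/
lemma exists_norm_sq_le_rpow (hn : 4 < n) (hr : 0 < r) : ∃ C, 0 ≤ C ∧
    ∀ p ∈ heatBall X T r, ‖p.1 - X‖ ^ 2 ≤ C * (T - p.2) ^ (3 / 4 : ℝ) := by
  have hm := sub_four_pos hn
  refine ⟨2 * ((n : ℝ) - 4) * ((r ^ 2 / (4 * Real.pi)) ^ (1 / 4 : ℝ) / (1 / 4)), by positivity,
    fun p hp => ?_⟩
  have hτ : 0 < T - p.2 := sub_pos.mpr hp.1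
  have h1 := norm_sq_lt_of_mem_heatBall hr hp
  have h2 : Real.log (r ^ 2 / (4 * Real.pi * (T - p.2))) ≤ _ :=
    Real.log_le_rpow_div (by positivity) (by norm_num : (0 : ℝ) < 1 / 4)
  refine h1.le.trans ((mul_le_mul_of_nonneg_left h2 (by positivity)).trans (le_of_eq ?_))
  rw [← div_div, Real.div_rpow (by positivity) hτ.le]
  have h3 : (T - p.2) ^ (3 / 4 : ℝ) * (T - p.2) ^ (1 / 4 : ℝ) = T - p.2 := by
    rw [← Real.rpow_add hτ]
    norm_num
  have h4 : 0 < (T - p.2) ^ (1 / 4 : ℝ) := by positivity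
  generalize (r ^ 2 / (4 * Real.pi)) ^ (1 / 4 : ℝ) = B at *
  generalize (T - p.2) ^ (3 / 4 : ℝ) = A at *
  generalize (T - p.2) ^ (1 / 4 : ℝ) = D at *
  rw [← h3]
  field_simp

lemma aestronglyMeasurable_heatBall {a R t₁ : ℝ} {g : Spacetime n → ℝ} (ht₁ : a < t₁) (hr : 0 < r)
    (hsub : heatBall X T r ⊆ Metric.ball X R ×ˢ Ioo t₁ T)
    (hg : ContinuousOn g (univ ×ˢ Ioo a T)) :
    AEStronglyMeasurable g (volume.restrict (heatBall X T r)) :=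
  (hg.mono fun _ hp => ⟨mem_univ _, ht₁.trans (hsub hp).2.1, (hsub hp).2.2⟩).aestronglyMeasurable
    (isOpen_heatBall hr).measurableSet

end HeatBallGeometry

/-! ### Decay and integrability of the energy in a heat ball -/

namespace IsStressBalance

open Filter Topology

variable {n : ℕ} {e K w : Spacetime n → ℝ} {P : Fin n → Spacetime n → ℝ}
  {Q : Fin n → Fin n → Spacetime n → ℝ} {a T : ℝ} (hB : IsStressBalance e K w P Q a T)
  {X : EuclideanSpace ℝ (Fin n)} {R R₂ t₁ r : ℝ}

include hB

lemma integrable_indicator_slice (hr : 0 < r)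
    (hsub : heatBall X T r ⊆ Metric.ball X R ×ˢ Ioo t₁ T) {s : ℝ} (hs : s ∈ Ioo a T) :
    Integrable fun x => (heatBall X T r).indicator e (x, s) := by
  have hm : MeasurableSet {x : EuclideanSpace ℝ (Fin n) | (x, s) ∈ heatBall X T r} :=
    ((isOpen_heatBall hr).preimage (Continuous.prodMk_left s)).measurableSet
  have h1 : IntegrableOn (fun x => e (x, s)) {x | (x, s) ∈ heatBall X T r} :=
    ((continuous_slice hB.continuousOn_e hs).continuousOn.integrableOn_compact
      (isCompact_closedBall X R)).mono_set fun x hx =>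
        Metric.ball_subset_closedBall (hsub hx).1
  exact (integrable_indicator_iff hm).mpr h1

/-- The energy in the time slices of a heat ball decays. -/
lemma exists_integral_heatBall_slice_le (hn : 4 < n) (hR : 0 < R) (hR₂ : R < R₂)
    (ht₁ : t₁ ∈ Ioo a T) (he : IntegrableOn e (Metric.ball X R₂ ×ˢ Ioo t₁ T)) (hr : 0 < r)
    (hsub : heatBall X T r ⊆ Metric.ball X R ×ˢ Ioo t₁ T) :
    ∃ C, 0 ≤ C ∧ ∀ s ∈ Ioo t₁ T,
      ∫ x, (heatBall X T r).indicator e (x, s) ≤ C * (T - s) ^ (3 / 8 : ℝ) := by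
  obtain ⟨M, hM⟩ := hB.exists_integral_exp_logKernel_le X hn hR hR₂ ht₁ he
  obtain ⟨C, hC0, hC⟩ := exists_norm_sq_le_rpow (X := X) (T := T) hn hr
  have hδ : 0 < T - t₁ := sub_pos.mpr ht₁.2
  have hm := one_le_sub_four hn
  set m := (n : ℝ) - 4 with hmdef
  -- The comparison kernel at time `s` has singular time `s + τ'`, `τ' = l (T - s)^(3/4)`. This `l`
  -- is just large enough for `s + τ' ≥ T`, as the weighted bound requires.
  set l := (T - t₁) ^ (1 / 4 : ℝ) with hl
  have hl0 : 0 < l := by positivity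
  set c := m / 2 * Real.log (4 * Real.pi * l) + C / (4 * l) with hc
  refine ⟨Real.exp c * (T - t₁) ^ (3 / 8 * (m - 1)) * |M|, by positivity, fun s hs => ?_⟩
  have hτ : 0 < T - s := sub_pos.mpr hs.2
  have hτδ : T - s ≤ T - t₁ := by linarith [hs.1]
  have hsI : s ∈ Ioo a T := ⟨ht₁.1.trans hs.1, hs.2⟩
  set τ' := l * (T - s) ^ (3 / 4 : ℝ) with hτ'
  have hτ'0 : 0 < τ' := by positivity
  have hT' : T ≤ s + τ' := by
    have h1 : (T - s) ^ (1 / 4 : ℝ) * (T - s) ^ (3 / 4 : ℝ) = T - s := by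
      rw [← Real.rpow_add hτ]
      norm_num
    have h2 : (T - s) ^ (1 / 4 : ℝ) ≤ l := Real.rpow_le_rpow hτ.le hτδ (by norm_num)
    have h3 : T - s ≤ τ' := by
      calc T - s = _ := h1.symm
        _ ≤ _ := by rw [hτ']; gcongr
    linarith
  have hMs := hM s hs (s + τ') hT'
  -- On the slice `|x - X|²/τ'` is bounded, so the kernel is at least a constant times `τ'^(-m/2)`,
  -- that is, `(T - s)^(-3m/8)`.
  have hpt : ∀ x, (x, s) ∈ heatBall X T r → e (x, s) ≤
      Real.exp (c + 3 / 8 * m * Real.log (T - s)) *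
        (e (x, s) * Real.exp (logKernel X (s + τ') (x, s))) := by
    intro x hx
    have h1 := hC _ hx
    have h2 : 0 ≤ c + 3 / 8 * m * Real.log (T - s) + logKernel X (s + τ') (x, s) := by
      simp only [logKernel, add_sub_cancel_left, ← hmdef]
      have h3 : Real.log (4 * Real.pi * τ') =
          Real.log (4 * Real.pi * l) + 3 / 4 * Real.log (T - s) := by
        rw [hτ', ← mul_assoc, Real.log_mul (by positivity) (by positivity), Real.log_rpow hτ]
      have h4 : ‖x - X‖ ^ 2 / (4 * τ') ≤ C / (4 * l) := by
        calc ‖x - X‖ ^ 2 / (4 * τ') ≤ C * (T - s) ^ (3 / 4 : ℝ) / (4 * τ') := by gcongr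
          _ = C / (4 * l) := by rw [hτ']; field_simp
      rw [h3, hc]
      linarith
    have h3 := mul_le_mul_of_nonneg_left (Real.one_le_exp h2) (hB.e_nonneg (x, s))
    rw [Real.exp_add, mul_one] at h3
    linarith
  have hint : IntegrableOn (fun x => e (x, s) * Real.exp (logKernel X (s + τ') (x, s)))
      (Metric.ball X R) := by
    have h1 : ContinuousOn (fun p => e p * Real.exp (logKernel X (s + τ') p))
        (univ ×ˢ Ioo a T) := hB.continuousOn_e.mul
      ((contDiffOn_logKernel hT').continuousOn.rexp)
    exact ((continuous_slice h1 hsI).continuousOn.integrableOn_compact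
      (isCompact_closedBall X R)).mono_set Metric.ball_subset_closedBall
  calc ∫ x, (heatBall X T r).indicator e (x, s)
      ≤ ∫ x, (Metric.ball X R).indicator (fun x => Real.exp (c + 3 / 8 * m * Real.log (T - s)) *
        (e (x, s) * Real.exp (logKernel X (s + τ') (x, s)))) x := by
        refine integral_mono (hB.integrable_indicator_slice hr hsub hsI)
          ((integrable_indicator_iff measurableSet_ball).mpr (hint.const_mul _)) fun x => ?_
        by_cases hx : (x, s) ∈ heatBall X T r
        · simp only [indicator_of_mem hx, indicator_of_mem (hsub hx).1]
          exact hpt x hx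
        · simp only [indicator_of_notMem hx]
          exact indicator_nonneg (fun x _ => mul_nonneg (Real.exp_pos _).le
            (mul_nonneg (hB.e_nonneg _) (Real.exp_pos _).le)) x
    _ = Real.exp (c + 3 / 8 * m * Real.log (T - s)) *
          ∫ x in Metric.ball X R, e (x, s) * Real.exp (logKernel X (s + τ') (x, s)) := by
        rw [integral_indicator measurableSet_ball, integral_const_mul]
    _ ≤ Real.exp (c + 3 / 8 * m * Real.log (T - s)) * |M| := by
        gcongr
        exact hMs.trans (le_abs_self M)
    -- Since `m ≥ 1`, the power `(T - s)^(3m/8)` splits into a bounded factor and `(T - s)^(3/8)`.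
    _ = Real.exp c * ((T - s) ^ (3 / 8 * (m - 1)) * (T - s) ^ (3 / 8 : ℝ)) * |M| := by
        rw [Real.exp_add, ← Real.rpow_add hτ, Real.rpow_def_of_pos hτ]
        ring_nf
    _ ≤ Real.exp c * ((T - t₁) ^ (3 / 8 * (m - 1)) * (T - s) ^ (3 / 8 : ℝ)) * |M| := by
        have : 0 ≤ 3 / 8 * (m - 1) := by linarith
        gcongr
    _ = _ := by ring

/-- The exponent is dictated by `|ν|² = |x - X|²/(4τ²) = O(τ^(3/4 - 2))`. Slice by slice the weight
leaves `τ^(3/8 - 5/4) = τ^(-7/8)`, integrable at `τ = 0`. -/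
lemma integrableOn_e_mul_rpow (hn : 4 < n) (hR : 0 < R) (hR₂ : R < R₂)
    (ht₁ : t₁ ∈ Ioo a T) (he : IntegrableOn e (Metric.ball X R₂ ×ˢ Ioo t₁ T)) (hr : 0 < r)
    (hsub : heatBall X T r ⊆ Metric.ball X R ×ˢ Ioo t₁ T) :
    IntegrableOn (fun p => e p * (T - p.2) ^ (-5 / 4 : ℝ)) (heatBall X T r) := by
  obtain ⟨C, hC0, hC⟩ := hB.exists_integral_heatBall_slice_le hn hR hR₂ ht₁ he hr hsub
  have hmeas := (isOpen_heatBall (X := X) (T := T) hr).measurableSet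
  have hg : ContinuousOn (fun p : Spacetime n => e p * (T - p.2) ^ (-5 / 4 : ℝ))
      (univ ×ˢ Ioo a T) := hB.continuousOn_e.mul
    (ContinuousOn.rpow_const (by fun_prop) fun p hp => Or.inl (sub_pos.mpr hp.2.2).ne')
  have hae := aestronglyMeasurable_heatBall ht₁.1 hr hsub hg
  rw [← integrable_indicator_iff hmeas]
  rw [← aestronglyMeasurable_indicator_iff hmeas] at hae
  have hslice : ∀ t x, (heatBall X T r).indicator
      (fun p => e p * (T - p.2) ^ (-5 / 4 : ℝ)) (x, t) =
        (heatBall X T r).indicator e (x, t) * (T - t) ^ (-5 / 4 : ℝ) := by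
    intro t x
    by_cases hx : (x, t) ∈ heatBall X T r
    · simp only [indicator_of_mem hx]
    · simp only [indicator_of_notMem hx, zero_mul]
  have hzero : ∀ t ∉ Ioo t₁ T, ∀ x, (heatBall X T r).indicator e (x, t) = 0 := fun t ht x =>
    indicator_of_notMem (fun hx => ht (hsub hx).2) e
  rw [Measure.volume_eq_prod] at hae ⊢
  rw [integrable_prod_iff' hae]
  simp only [hslice]
  constructor
  · refine ae_of_all _ fun t => ?_
    by_cases ht : t ∈ Ioo t₁ T
    · exact (hB.integrable_indicator_slice hr hsub ⟨ht₁.1.trans ht.1, ht.2⟩).mul_const _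
    · simp [hzero t ht]
  · have hrpow : Integrable ((Ioo t₁ T).indicator fun t => C * (T - t) ^ (-7 / 8 : ℝ)) := by
      rw [integrable_indicator_iff measurableSet_Ioo]
      have h1 := (intervalIntegral.intervalIntegrable_rpow' (a := T - t₁) (b := 0)
        (by norm_num : (-1 : ℝ) < -7 / 8)).comp_sub_left T
      simp only [sub_sub_cancel, sub_zero] at h1
      exact (((intervalIntegrable_iff_integrableOn_Ioo_of_le ht₁.2.le).mp h1).const_mul C)
    have hmeas2 := hae.norm.prod_swap.integral_prod_right'
    refine hrpow.mono' ?_ (ae_of_all _ fun t => ?_)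
    · simpa only [Function.comp, Prod.swap_prod_mk, hslice, Prod.swap] using hmeas2
    · rw [Real.norm_of_nonneg (integral_nonneg fun x => norm_nonneg _)]
      by_cases ht : t ∈ Ioo t₁ T
      · rw [indicator_of_mem ht]
        have hτ : 0 < T - t := sub_pos.mpr ht.2
        have h1 : ∀ x, ‖(heatBall X T r).indicator e (x, t) * (T - t) ^ (-5 / 4 : ℝ)‖ =
            (heatBall X T r).indicator e (x, t) * (T - t) ^ (-5 / 4 : ℝ) := fun x =>
          Real.norm_of_nonneg (mul_nonneg (indicator_nonneg (fun p _ => hB.e_nonneg p) _)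
            (by positivity))
        simp only [h1]
        rw [integral_mul_const]
        refine (mul_le_mul_of_nonneg_right (hC t ht) (by positivity)).trans (le_of_eq ?_)
        rw [mul_assoc, ← Real.rpow_add hτ]
        norm_num
      · simp [hzero t ht, indicator_of_notMem ht]

/-- The density that dominates all integrands of the monotonicity formula is integrable. -/
lemma integrableOn_dominating (hn : 4 < n) (hR : 0 < R) (hR₂ : R < R₂)
    (ht₁ : t₁ ∈ Ioo a T) (he : IntegrableOn e (Metric.ball X R₂ ×ˢ Ioo t₁ T)) (hr : 0 < r)
    (hsub : heatBall X T r ⊆ Metric.ball X R ×ˢ Ioo t₁ T) :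
    IntegrableOn (fun p => K p + e p * (∑ i, drift X T p i ^ 2 + 1 / (T - p.2)))
      (heatBall X T r) := by
  obtain ⟨C, hC0, hC⟩ := exists_norm_sq_le_rpow (X := X) (T := T) hn hr
  have hmeas := (isOpen_heatBall (X := X) (T := T) hr).measurableSet
  refine Integrable.add ((hB.integrableOn_K X hR hR₂ ht₁ he).mono_set hsub) ?_
  have hν : ContinuousOn (fun p : Spacetime n => ∑ i, drift X T p i ^ 2 + 1 / (T - p.2))
      (univ ×ˢ Ioo a T) := by
    have h1 : ContinuousOn (fun p : Spacetime n => ‖p.1 - X‖ ^ 2 / (4 * (T - p.2) ^ 2) +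
        1 / (T - p.2)) (univ ×ˢ Ioo a T) := by
      refine ContinuousOn.add (ContinuousOn.div (by fun_prop) (by fun_prop) fun p hp => ?_)
        (ContinuousOn.div (by fun_prop) (by fun_prop) fun p hp => (sub_pos.mpr hp.2.2).ne')
      have : 0 < T - p.2 := sub_pos.mpr hp.2.2
      positivity
    exact h1.congr fun p hp => by simp only [sum_drift_sq]
  have hae := aestronglyMeasurable_heatBall ht₁.1 hr hsub (hB.continuousOn_e.mul hν)
  have hi := (hB.integrableOn_e_mul_rpow hn hR hR₂ ht₁ he hr hsub).mul_const
    (C / 4 + (T - t₁) ^ (1 / 4 : ℝ))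
  refine Integrable.mono' hi hae ?_
  filter_upwards [ae_restrict_mem hmeas] with p hp
  have hτ : 0 < T - p.2 := sub_pos.mpr hp.1
  have he0 := hB.e_nonneg p
  have h1 : 0 ≤ ∑ i, drift X T p i ^ 2 + 1 / (T - p.2) :=
    add_nonneg (Finset.sum_nonneg fun i _ => sq_nonneg _) (by positivity)
  rw [Real.norm_of_nonneg (mul_nonneg he0 h1), mul_assoc]
  refine mul_le_mul_of_nonneg_left ?_ he0
  rw [sum_drift_sq, mul_add]
  refine add_le_add ?_ ?_
  · have h2 : (T - p.2) ^ (3 / 4 : ℝ) = (T - p.2) ^ (-5 / 4 : ℝ) * (T - p.2) ^ 2 := by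
      rw [← Real.rpow_natCast, ← Real.rpow_add hτ]
      norm_num
    rw [div_le_iff₀ (by positivity)]
    refine (hC p hp).trans (le_of_eq ?_)
    rw [h2]
    ring
  · have h2 : 1 / (T - p.2) = (T - p.2) ^ (-5 / 4 : ℝ) * (T - p.2) ^ (1 / 4 : ℝ) := by
      rw [← Real.rpow_add hτ, one_div, ← Real.rpow_neg_one]
      norm_num
    rw [h2]
    have h3 : T - p.2 ≤ T - t₁ := by linarith [(hsub hp).2.1]
    gcongr

end IsStressBalance

/-! ### The densities on heat balls and the weak monotonicity formula -/

section Densities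

variable {n : ℕ}

/-- The integrand of the local monotone quantity. -/
def localDensity (X : EuclideanSpace ℝ (Fin n)) (T : ℝ) (e : Spacetime n → ℝ)
    (P : Fin n → Spacetime n → ℝ) (Q : Fin n → Fin n → Spacetime n → ℝ) (p : Spacetime n) : ℝ :=
  e p * (((n : ℝ) - 4) / (2 * (T - p.2))) - ∑ i, drift X T p i * P i p -
    ∑ i, ∑ j, drift X T p i * drift X T p j * Q i j p

/-- The integrand of the derivative of the local monotone quantity. -/
def growthDensity (X : EuclideanSpace ℝ (Fin n)) (T : ℝ) (K w : Spacetime n → ℝ)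
    (P : Fin n → Spacetime n → ℝ) (Q : Fin n → Fin n → Spacetime n → ℝ) (p : Spacetime n) : ℝ :=
  w p / (2 * (T - p.2)) + (K p + 2 * ∑ i, drift X T p i * P i p +
    ∑ i, ∑ j, drift X T p i * drift X T p j * Q i j p)

/-- The sum of `localDensity` and `growthDensity`. -/
def totalDensity (X : EuclideanSpace ℝ (Fin n)) (T : ℝ) (e K w : Spacetime n → ℝ)
    (P : Fin n → Spacetime n → ℝ) (p : Spacetime n) : ℝ :=
  K p + ∑ i, drift X T p i * P i p + (((n : ℝ) - 4) * e p + w p) / (2 * (T - p.2))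

lemma totalDensity_sub_localDensity (X : EuclideanSpace ℝ (Fin n)) (T : ℝ)
    (e K w : Spacetime n → ℝ) (P : Fin n → Spacetime n → ℝ) (Q : Fin n → Fin n → Spacetime n → ℝ)
    (p : Spacetime n) : totalDensity X T e K w P p - localDensity X T e P Q p =
      growthDensity X T K w P Q p := by
  simp only [totalDensity, localDensity, growthDensity]
  ring

lemma continuousOn_drift (X : EuclideanSpace ℝ (Fin n)) (a T : ℝ) (i : Fin n) :
    ContinuousOn (fun p : Spacetime n => drift X T p i) (univ ×ˢ Ioo a T) := by
  unfold drift
  refine ContinuousOn.div (by fun_prop) (by fun_prop) fun p hp => ?_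
  have : p.2 - T < 0 := sub_neg.mpr hp.2.2
  simpa using this.ne

/-- Boundedness of `f` is essential, because the logarithm of the kernel is unbounded near `(X, T)`.
-/
lemma integrableOn_comp_logKernel_mul {X : EuclideanSpace ℝ (Fin n)} {a T R t₁ r : ℝ}
    (ht₁ : a < t₁) (hr : 0 < r) (hsub : heatBall X T r ⊆ Metric.ball X R ×ˢ Ioo t₁ T)
    {f : ℝ → ℝ} (hf : Continuous f) {M : ℝ} (hM : ∀ z, |f z| ≤ M)
    {g : Spacetime n → ℝ} (hg : ContinuousOn g (univ ×ˢ Ioo a T))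
    (hgi : IntegrableOn g (heatBall X T r)) (c : ℝ) :
    IntegrableOn (fun p => f (c + logKernel X T p) * g p) (heatBall X T r) := by
  have hc : ContinuousOn (fun p => f (c + logKernel X T p)) (univ ×ˢ Ioo a T) :=
    hf.comp_continuousOn (continuousOn_const.add (contDiffOn_logKernel le_rfl).continuousOn)
  refine Integrable.mono' (hgi.norm.const_mul M)
    (aestronglyMeasurable_heatBall ht₁ hr hsub (hc.mul hg)) (ae_of_all _ fun p => ?_)
  rw [norm_mul]
  exact mul_le_mul_of_nonneg_right (hM _) (norm_nonneg _)

end Densities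

namespace IsStressBalance

open Filter Topology

variable {n : ℕ} {e K w : Spacetime n → ℝ} {P : Fin n → Spacetime n → ℝ}
  {Q : Fin n → Fin n → Spacetime n → ℝ} {a T : ℝ} (hB : IsStressBalance e K w P Q a T)
  {X : EuclideanSpace ℝ (Fin n)} {R R₂ t₁ r : ℝ}

include hB

lemma continuousOn_localDensity (X : EuclideanSpace ℝ (Fin n)) :
    ContinuousOn (localDensity X T e P Q) (univ ×ˢ Ioo a T) := by
  unfold localDensity
  refine ((hB.continuousOn_e.mul (ContinuousOn.div (by fun_prop) (by fun_prop) fun p hp => ?_)).sub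
    (continuousOn_finsetSum _ fun i _ => (continuousOn_drift X a T i).mul
      (hB.P_smooth i).continuousOn)).sub (continuousOn_finsetSum _ fun i _ =>
    continuousOn_finsetSum _ fun j _ => ((continuousOn_drift X a T i).mul
      (continuousOn_drift X a T j)).mul (hB.Q_smooth i j).continuousOn)
  have : 0 < T - p.2 := sub_pos.mpr hp.2.2
  positivity

lemma continuousOn_totalDensity (X : EuclideanSpace ℝ (Fin n)) :
    ContinuousOn (totalDensity X T e K w P) (univ ×ˢ Ioo a T) := by
  unfold totalDensity
  refine (hB.K_cont.add (continuousOn_finsetSum _ fun i _ => (continuousOn_drift X a T i).mul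
      (hB.P_smooth i).continuousOn)).add (ContinuousOn.div
        ((continuousOn_const.mul hB.continuousOn_e).add hB.w_cont) (by fun_prop) fun p hp => ?_)
  have : 0 < T - p.2 := sub_pos.mpr hp.2.2
  positivity

/-- The diagonal entries of `Q` are values of the nonnegative form, so `4e - w = tr Q ≥ 0`. -/
lemma w_le (p : Spacetime n) : w p ≤ 4 * e p := by
  have h1 : ∀ i, 0 ≤ Q i i p := by
    intro i
    have := hB.form_nonneg p 0 (Pi.single i 1)
    simpa [Pi.single_apply] using this
  have h2 := hB.trace p
  have h3 : 0 ≤ ∑ i, Q i i p := Finset.sum_nonneg fun i _ => h1 i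
  linarith

/-- The nonnegative form at `s = 1` and `s = -1` bounds the flux from both sides; at `s = 0` it
gives the lower bound for the stress. -/
lemma abs_sum_drift_mul_le (p : Spacetime n) (ν : Fin n → ℝ) :
    |∑ i, ν i * P i p| ≤ K p + 2 * (e p * ∑ i, ν i ^ 2) ∧
      |∑ i, ∑ j, ν i * ν j * Q i j p| ≤ 4 * (e p * ∑ i, ν i ^ 2) := by
  have h1 := hB.form_nonneg p 1 ν
  have h2 := hB.form_nonneg p (-1) ν
  have h3 := hB.form_nonneg p 0 ν
  have h4 := hB.stress_le p ν
  have h5 := hB.K_nonneg p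
  refine ⟨abs_le.mpr ⟨by linarith, by linarith⟩, abs_le.mpr ⟨?_, by linarith⟩⟩
  have h6 : 0 ≤ e p * ∑ i, ν i ^ 2 :=
    mul_nonneg (hB.e_nonneg p) (Finset.sum_nonneg fun i _ => sq_nonneg _)
  linarith

lemma abs_density_le (hn : 4 < n) {p : Spacetime n} (hp : p.2 < T) :
    |localDensity X T e P Q p| ≤
        (n + 10) * (K p + e p * (∑ i, drift X T p i ^ 2 + 1 / (T - p.2))) ∧
      |totalDensity X T e K w P p| ≤
        (n + 10) * (K p + e p * (∑ i, drift X T p i ^ 2 + 1 / (T - p.2))) := by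
  have hm := sub_four_pos hn
  have hτ : 0 < T - p.2 := sub_pos.mpr hp
  obtain ⟨h1, h2⟩ := hB.abs_sum_drift_mul_le p (drift X T p)
  have he := hB.e_nonneg p
  have hK := hB.K_nonneg p
  have hw := hB.w_le p
  have hw0 := hB.w_nonneg p
  have hN : 0 ≤ e p * ∑ i, drift X T p i ^ 2 :=
    mul_nonneg he (Finset.sum_nonneg fun i _ => sq_nonneg _)
  have hE : 0 ≤ e p * (1 / (T - p.2)) := mul_nonneg he (by positivity)
  have hnn : (0 : ℝ) ≤ n := Nat.cast_nonneg n
  have hsplit : (n + 10) * (K p + e p * (∑ i, drift X T p i ^ 2 + 1 / (T - p.2))) =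
      (n + 10) * K p + (n + 10) * (e p * ∑ i, drift X T p i ^ 2) +
        (n + 10) * (e p * (1 / (T - p.2))) := by ring
  have hnK := mul_nonneg hnn hK
  have hnN := mul_nonneg hnn hN
  have hnE := mul_nonneg hnn hE
  rw [hsplit]
  constructor
  · have h3 : e p * (((n : ℝ) - 4) / (2 * (T - p.2))) =
        ((n : ℝ) - 4) / 2 * (e p * (1 / (T - p.2))) := by
      field_simp
    have h4 : 0 ≤ ((n : ℝ) - 4) / 2 * (e p * (1 / (T - p.2))) := by positivity
    rw [localDensity, h3]
    refine (abs_sub _ _).trans ((add_le_add (abs_sub _ _) le_rfl).trans ?_)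
    rw [abs_of_nonneg h4]
    linarith
  · have h3 : (((n : ℝ) - 4) * e p + w p) / (2 * (T - p.2)) =
        ((n : ℝ) - 4) / 2 * (e p * (1 / (T - p.2))) + w p * (1 / (T - p.2)) / 2 := by
      field_simp
    have h4 : 0 ≤ ((n : ℝ) - 4) / 2 * (e p * (1 / (T - p.2))) := by positivity
    have h5 : 0 ≤ w p * (1 / (T - p.2)) := by positivity
    have h6 : w p * (1 / (T - p.2)) ≤ 4 * e p * (1 / (T - p.2)) := by gcongr
    rw [totalDensity, h3]
    refine (abs_add_le _ _).trans ((add_le_add (abs_add_le _ _) le_rfl).trans ?_)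
    rw [abs_of_nonneg hK, abs_of_nonneg (add_nonneg h4 (by linarith))]
    linarith

section

variable (hn : 4 < n) (hR : 0 < R) (hR₂ : R < R₂) (ht₁ : t₁ ∈ Ioo a T)
  (he : IntegrableOn e (Metric.ball X R₂ ×ˢ Ioo t₁ T)) (hr : 0 < r)
  (hsub : heatBall X T r ⊆ Metric.ball X R ×ˢ Ioo t₁ T)

include hn hR hR₂ ht₁ he hr hsub

lemma integrableOn_localDensity : IntegrableOn (localDensity X T e P Q) (heatBall X T r) := by
  refine Integrable.mono' ((hB.integrableOn_dominating hn hR hR₂ ht₁ he hr hsub).const_mul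
    ((n : ℝ) + 10)) (aestronglyMeasurable_heatBall ht₁.1 hr hsub
      (hB.continuousOn_localDensity X)) ?_
  filter_upwards [ae_restrict_mem (isOpen_heatBall hr).measurableSet] with p hp
  exact (hB.abs_density_le hn hp.1).1

lemma integrableOn_totalDensity : IntegrableOn (totalDensity X T e K w P) (heatBall X T r) := by
  refine Integrable.mono' ((hB.integrableOn_dominating hn hR hR₂ ht₁ he hr hsub).const_mul
    ((n : ℝ) + 10)) (aestronglyMeasurable_heatBall ht₁.1 hr hsub
      (hB.continuousOn_totalDensity X)) ?_
  filter_upwards [ae_restrict_mem (isOpen_heatBall hr).measurableSet] with p hp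
  exact (hB.abs_density_le hn hp.1).2

/-- The weak form of the monotonicity formula: superpose the test functions `f (log (rᵐ Φ))`. -/
lemma integral_comp_logKernel_mul {f f' : ℝ → ℝ} (hf : ∀ z, HasDerivAt f (f' z) z)
    (hf'c : Continuous f') (hf0 : ∀ z ≤ 0, f z = 0) (hf'0 : ∀ z ≤ 0, f' z = 0) {M : ℝ}
    (hM : ∀ z, |f z| ≤ M) (hM' : ∀ z, |f' z| ≤ M) :
    ∫ p in heatBall X T r,
        f' (((n : ℝ) - 4) * Real.log r + logKernel X T p) * localDensity X T e P Q p =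
      ∫ p in heatBall X T r,
        f (((n : ℝ) - 4) * Real.log r + logKernel X T p) * totalDensity X T e K w P p := by
  set c := ((n : ℝ) - 4) * Real.log r with hc
  have hmeas := (isOpen_heatBall (X := X) (T := T) hr).measurableSet
  have hfc : ContDiff ℝ 1 f := by
    rw [contDiff_one_iff_deriv]
    have : deriv f = f' := funext fun z => (hf z).deriv
    exact ⟨fun z => (hf z).differentiableAt, this ▸ hf'c⟩
  have hi1 := integrableOn_comp_logKernel_mul ht₁.1 hr hsub hf'c hM'
    (hB.continuousOn_localDensity X) (hB.integrableOn_localDensity hn hR hR₂ ht₁ he hr hsub) c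
  have hi2 := integrableOn_comp_logKernel_mul ht₁.1 hr hsub hfc.continuous hM
    (hB.continuousOn_totalDensity X) (hB.integrableOn_totalDensity hn hR hR₂ ht₁ he hr hsub) c
  rw [← sub_eq_zero, ← integral_sub hi1 hi2]
  have hψ0 : ∀ p : Spacetime n, p.2 < T → p ∉ heatBall X T r → c + logKernel X T p ≤ 0 := by
    intro p hp hp'
    rw [mem_heatBall_iff hr] at hp'
    by_contra h
    exact hp' ⟨hp, not_le.mp h⟩
  have hηc : ContDiffOn ℝ 1 (fun p => f (c + logKernel X T p)) (univ ×ˢ Ioo a T) :=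
    hfc.comp_contDiffOn (contDiffOn_const.add (contDiffOn_logKernel le_rfl))
  have hηs : ∀ x, x ∉ Metric.closedBall X R → ∀ t ∈ Ioo a T, f (c + logKernel X T (x, t)) = 0 :=
    fun x hx t ht => hf0 _ (hψ0 _ ht.2 fun h => hx (Metric.ball_subset_closedBall (hsub h).1))
  set H : Spacetime n → ℝ := (heatBall X T r).indicator fun p =>
    f' (c + logKernel X T p) * localDensity X T e P Q p -
      f (c + logKernel X T p) * totalDensity X T e K w P p with hH
  have hHi : Integrable H := (integrable_indicator_iff hmeas).mpr (hi1.sub hi2)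
  have hderiv : ∀ t ∈ Ioo a T, HasDerivAt (fun s => ∫ x, e (x, s) * f (c + logKernel X T (x, s)))
      (∫ x, H (x, t)) t := by
    intro t ht
    -- With this multiple the terms `e f' |ν|²` cancel. What remains is `f'` times the local density
    -- minus `f` times the total density.
    have h1 := (hB.hasDerivAt_integral_mul X hηc hηs ht (-(1 / (2 * (T - t))))).2
    convert h1 using 2
    ext x
    have hτ : 0 < T - t := sub_pos.mpr ht.2
    have hd : DifferentiableAt ℝ (logKernel X T) (x, t) := differentiableAt_logKernel ht.2
    have hv : ∀ v, dirDeriv v (fun p => f (c + logKernel X T p)) (x, t) =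
        f' (c + logKernel X T (x, t)) * dirDeriv v (logKernel X T) (x, t) := fun v =>
      dirDeriv_comp (f := fun z => f (c + z))
        (by simpa using (hf (c + logKernel X T (x, t))).comp_const_add c _) hd v
    have h2 : dt (fun p => f (c + logKernel X T p)) (x, t) = _ := hv (0, 1)
    have h3 : dirDeriv ((0, 1) : Spacetime n) (logKernel X T) (x, t) = _ :=
      dt_logKernel (X := X) ht.2
    rw [h3] at h2
    have h4 : ∀ i, dx i (fun p => f (c + logKernel X T p)) (x, t) =
        f' (c + logKernel X T (x, t)) * drift X T (x, t) i + 0 := by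
      intro i
      have h4 : dx i (fun p => f (c + logKernel X T p)) (x, t) = _ :=
        hv (EuclideanSpace.single i 1, 0)
      have h5 : dirDeriv ((EuclideanSpace.single i 1, 0) : Spacetime n) (logKernel X T) (x, t) = _ :=
        dx_logKernel (X := X) ht.2 i
      rw [h4, h5, add_zero]
    have hy : ∀ j, x j - X j = -(2 * (T - t)) * drift X T (x, t) j := by
      intro j
      have : t - T ≠ 0 := (sub_neg.mpr ht.2).ne
      simp only [drift]
      field_simp
      ring
    rw [slice_integrand_eq (e (x, t)) (K (x, t)) (w (x, t)) _ _ _ (T - t) (fun i => P i (x, t))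
      (drift X T (x, t)) (fun _ => 0) _ _ (fun i j => Q i j (x, t)) hτ.ne' hy h4, h2]
    simp only [zero_mul, mul_zero, Finset.sum_const_zero]
    by_cases hx : (x, t) ∈ heatBall X T r
    · rw [hH, indicator_of_mem hx]
      simp only [localDensity, totalDensity]
      ring
    · have h5 := hψ0 (x, t) ht.2 hx
      rw [hH, indicator_of_notMem hx, hf0 _ h5, hf'0 _ h5]
      ring
  have hzero : ∀ t ∉ Ioo t₁ T, ∀ x, (x, t) ∉ heatBall X T r := fun t ht x hx => ht (hsub hx).2
  -- The heat ball has empty slice at `t₁`, so the test function vanishes there.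
  have hleft : Tendsto (fun s => ∫ x, e (x, s) * f (c + logKernel X T (x, s))) (𝓝[>] t₁) (𝓝 0) := by
    have h1 := (hderiv t₁ ht₁).continuousAt.tendsto
    have h2 : ∫ x, e (x, t₁) * f (c + logKernel X T (x, t₁)) = 0 := by
      have : ∀ x, e (x, t₁) * f (c + logKernel X T (x, t₁)) = 0 := fun x => by
        rw [hf0 _ (hψ0 (x, t₁) ht₁.2 (hzero t₁ (fun h => lt_irrefl _ h.1) x)), mul_zero]
      simp [this]
    rw [h2] at h1
    exact h1.mono_left nhdsWithin_le_nhds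
  -- At the possibly singular final time the boundary term vanishes because `f` is bounded and the
  -- energy of the slices is `O((T - s)^(3/8))`.
  have hright : Tendsto (fun s => ∫ x, e (x, s) * f (c + logKernel X T (x, s)))
      (𝓝[<] T) (𝓝 0) := by
    obtain ⟨C, hC0, hC⟩ := hB.exists_integral_heatBall_slice_le hn hR hR₂ ht₁ he hr hsub
    have hlim : Tendsto (fun s : ℝ => M * (C * (T - s) ^ (3 / 8 : ℝ))) (𝓝[<] T) (𝓝 0) := by
      have h1 : Continuous fun s : ℝ => M * (C * (T - s) ^ (3 / 8 : ℝ)) :=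
        continuous_const.mul (continuous_const.mul
          ((continuous_const.sub continuous_id).rpow_const fun _ => Or.inr (by norm_num)))
      have h2 := h1.tendsto T
      rw [sub_self, Real.zero_rpow (by norm_num), mul_zero, mul_zero] at h2
      exact h2.mono_left nhdsWithin_le_nhds
    refine squeeze_zero_norm' ?_ hlim
    filter_upwards [Ioo_mem_nhdsLT ht₁.2] with s hs
    have hsI : s ∈ Ioo a T := ⟨ht₁.1.trans hs.1, hs.2⟩
    have hM0 : 0 ≤ M := (abs_nonneg _).trans (hM 0)
    refine (norm_integral_le_of_norm_le ((hB.integrable_indicator_slice hr hsub hsI).const_mul M)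
      (ae_of_all _ fun x => ?_)).trans ?_
    · by_cases hx : (x, s) ∈ heatBall X T r
      · rw [indicator_of_mem hx, norm_mul, Real.norm_of_nonneg (hB.e_nonneg _), mul_comm]
        exact mul_le_mul_of_nonneg_right (hM _) (hB.e_nonneg _)
      · rw [hf0 _ (hψ0 (x, s) hs.2 hx), indicator_of_notMem hx]
        simp
    · rw [integral_const_mul]
      exact mul_le_mul_of_nonneg_left (hC s hs) hM0
  have hHprod := hHi
  rw [Measure.volume_eq_prod] at hHprod
  have hftc := intervalIntegral.integral_eq_sub_of_hasDerivAt_of_tendsto ht₁.2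
    (fun t ht => hderiv t ⟨ht₁.1.trans ht.1, ht.2⟩)
    (hHprod.integral_prod_right.intervalIntegrable) hleft hright
  rw [← integral_indicator hmeas, ← hH, Measure.volume_eq_prod, integral_prod_symm _ hHprod,
    ← setIntegral_eq_integral_of_forall_compl_eq_zero (s := Ioc t₁ T) fun t ht => ?_,
    ← intervalIntegral.integral_of_le ht₁.2.le, hftc, sub_zero]
  have : ∀ x, H (x, t) = 0 := fun x =>
    indicator_of_notMem (hzero t (fun h => ht ⟨h.1, h.2.le⟩) x) _
  simp [this]

end

end IsStressBalance

/-! ### Smooth approximation of the positive part and nullity of kernel level sets -/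

section PositivePart

open Filter Topology

/-- Approximation of the positive part by `C¹` functions with uniformly bounded derivative. -/
lemma exists_approx_posPart : ∃ (g b : ℕ → ℝ → ℝ) (B : ℝ),
    (∀ k z, HasDerivAt (g k) (b k z) z) ∧ (∀ k, Continuous (b k)) ∧ (∀ k, ∀ z ≤ 0, g k z = 0) ∧
    (∀ k, ∀ z ≤ 0, b k z = 0) ∧ (∀ k z, |b k z| ≤ B) ∧
    (∀ z, Tendsto (fun k => b k z) atTop (𝓝 (if 0 < z then 1 else 0))) ∧
    (∀ z, Tendsto (fun k => g k z) atTop (𝓝 (max z 0))) := by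
  set S := Real.smoothTransition with hS
  have hSc : ContDiff ℝ 1 S := Real.smoothTransition.contDiff
  have hSd : ∀ z, HasDerivAt S (deriv S z) z := fun z =>
    (hSc.differentiable (by simp) z).hasDerivAt
  have hS'c : Continuous (deriv S) := hSc.continuous_deriv le_rfl
  set β : ℝ → ℝ := fun x => S x + x * deriv S x with hβ
  have hβc : Continuous β := hSc.continuous.add (continuous_id.mul hS'c)
  have hβ0 : ∀ x ≤ 0, β x = 0 := by
    intro x hx
    have h1 : S x = 0 := Real.smoothTransition.zero_of_nonpos hx
    rcases hx.lt_or_eq with hx | rfl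
    · have h2 : S =ᶠ[𝓝 x] fun _ => 0 := by
        filter_upwards [Iio_mem_nhds hx] with y hy
        exact Real.smoothTransition.zero_of_nonpos (le_of_lt hy)
      simp [hβ, h1, h2.deriv_eq]
    · simp [hβ, h1]
  have hβ1 : ∀ x, 1 < x → β x = 1 := by
    intro x hx
    have h1 : S x = 1 := Real.smoothTransition.one_of_one_le hx.le
    have h2 : S =ᶠ[𝓝 x] fun _ => 1 := by
      filter_upwards [Ioi_mem_nhds hx] with y hy
      exact Real.smoothTransition.one_of_one_le (le_of_lt hy)
    simp [hβ, h1, h2.deriv_eq]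
  obtain ⟨C, hC⟩ := (isCompact_Icc (a := (0 : ℝ)) (b := 1)).exists_bound_of_continuousOn
    hβc.continuousOn
  have hβb : ∀ x, |β x| ≤ max C 1 := by
    intro x
    rcases le_or_gt x 0 with hx | hx
    · rw [hβ0 x hx, abs_zero]
      positivity
    rcases le_or_gt x 1 with hx1 | hx1
    · exact (hC x ⟨hx.le, hx1⟩).trans (le_max_left _ _)
    · rw [hβ1 x hx1, abs_one]
      exact le_max_right _ _
  have hlarge : ∀ z : ℝ, 0 < z → ∀ᶠ k : ℕ in atTop, 1 < ((k : ℝ) + 1) * z := by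
    intro z hz
    have h1 : Tendsto (fun k : ℕ => ((k : ℝ) + 1) * z) atTop atTop :=
      (tendsto_natCast_atTop_atTop.atTop_add tendsto_const_nhds).atTop_mul_const hz
    exact h1.eventually_gt_atTop 1
  have hneg : ∀ (k : ℕ) (z : ℝ), z ≤ 0 → ((k : ℝ) + 1) * z ≤ 0 := fun k z hz =>
    mul_nonpos_of_nonneg_of_nonpos (by positivity) hz
  -- For a smooth step `S` the derivative of `z S((k+1)z)` is a rescaling of one bounded function
  -- `β(x) = S(x) + x S'(x)`, so its bound does not depend on `k`.
  refine ⟨fun k z => z * S (((k : ℝ) + 1) * z), fun k z => β (((k : ℝ) + 1) * z), max C 1, ?_,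
    fun k => hβc.comp (continuous_const.mul continuous_id), fun k z hz => ?_,
    fun k z hz => hβ0 _ (hneg k z hz), fun k z => hβb _, fun z => ?_, fun z => ?_⟩
  · intro k z
    have h1 : HasDerivAt (fun z : ℝ => ((k : ℝ) + 1) * z) ((k : ℝ) + 1) z := by
      simpa using (hasDerivAt_id z).const_mul ((k : ℝ) + 1)
    have h2 := (hasDerivAt_id z).mul ((hSd (((k : ℝ) + 1) * z)).comp z h1)
    refine h2.congr_deriv ?_
    change 1 * S (((k : ℝ) + 1) * z) + z * (deriv S (((k : ℝ) + 1) * z) * ((k : ℝ) + 1)) =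
      S (((k : ℝ) + 1) * z) + ((k : ℝ) + 1) * z * deriv S (((k : ℝ) + 1) * z)
    ring
  · change z * S _ = 0
    rw [hS, Real.smoothTransition.zero_of_nonpos (hneg k z hz), mul_zero]
  · split_ifs with hz
    · refine tendsto_const_nhds.congr' ?_
      filter_upwards [hlarge z hz] with k hk
      exact (hβ1 _ hk).symm
    · refine tendsto_const_nhds.congr fun k => ?_
      exact (hβ0 _ (hneg k z (not_lt.mp hz))).symm
  · rcases le_or_gt z 0 with hz | hz
    · rw [max_eq_right hz]
      refine tendsto_const_nhds.congr fun k => ?_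
      change 0 = z * S _
      rw [hS, Real.smoothTransition.zero_of_nonpos (hneg k z hz), mul_zero]
    · rw [max_eq_left hz.le]
      refine tendsto_const_nhds.congr' ?_
      filter_upwards [hlarge z hz] with k hk
      rw [hS, Real.smoothTransition.one_of_one_le hk.le, mul_one]

lemma abs_log_sub_log_le {c x y : ℝ} (hc : 0 < c) (hx : c ≤ x) (hy : c ≤ y) :
    |Real.log x - Real.log y| ≤ 1 / c * |x - y| := by
  have key : ∀ x y : ℝ, c ≤ x → c ≤ y → Real.log x - Real.log y ≤ 1 / c * |x - y| := by
    intro x y hx hy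
    have hx0 := hc.trans_le hx
    have hy0 := hc.trans_le hy
    have h1 := Real.log_le_sub_one_of_pos (div_pos hx0 hy0)
    rw [Real.log_div hx0.ne' hy0.ne'] at h1
    have h2 : x / y - 1 = 1 / y * (x - y) := by field_simp
    rw [h2] at h1
    calc _ ≤ _ := h1
      _ ≤ 1 / y * |x - y| := by gcongr; exact le_abs_self _
      _ ≤ _ := by gcongr
  refine abs_sub_le_iff.mpr ⟨key x y hx hy, ?_⟩
  rw [abs_sub_comm]
  exact key y x hy hx

end PositivePart

section LevelSet

variable {n : ℕ}

/-- Each time slice lies in a sphere, which is a null set; Fubini does the rest. This discards the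
points where the positive part fails to be differentiable in the radius. -/
lemma volume_logKernel_level_eq_zero (hn : 4 < n) (X : EuclideanSpace ℝ (Fin n)) (T c : ℝ) :
    volume {p : Spacetime n | p.2 < T ∧ c + logKernel X T p = 0} = 0 := by
  have hne : Nonempty (Fin n) := ⟨⟨0, by omega⟩⟩
  have hmeas : MeasurableSet {p : Spacetime n | p.2 < T ∧ c + logKernel X T p = 0} := by
    have h1 : Measurable (logKernel X T) := by
      unfold logKernel
      fun_prop
    exact (measurableSet_lt measurable_snd measurable_const).inter
      ((h1.const_add c) (measurableSet_singleton 0))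
  rw [Measure.volume_eq_prod, Measure.prod_apply_symm hmeas, lintegral_eq_zero_iff'
    (measurable_measure_prodMk_right hmeas).aemeasurable]
  refine ae_of_all _ fun t => ?_
  by_cases ht : t < T
  · have hτ : 0 < T - t := sub_pos.mpr ht
    refine measure_mono_null (t := Metric.sphere X (√(4 * (T - t) *
      (c - (((n : ℝ) - 4) / 2) * Real.log (4 * Real.pi * (T - t)))))) ?_
      (Measure.addHaar_sphere _ _ _)
    intro x hx
    have h1 : c + logKernel X T (x, t) = 0 := hx.2
    simp only [logKernel] at h1
    have h2 : 4 * (T - t) * (c - (((n : ℝ) - 4) / 2) * Real.log (4 * Real.pi * (T - t))) =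
        ‖x - X‖ ^ 2 := by
      have h3 : ‖x - X‖ ^ 2 = 4 * (T - t) * (‖x - X‖ ^ 2 / (4 * (T - t))) := by field_simp
      rw [h3]
      congr 1
      linarith
    rw [mem_sphere_iff_norm, h2, Real.sqrt_sq (norm_nonneg _)]
  · have : (fun x => (x, t)) ⁻¹' {p : Spacetime n | p.2 < T ∧ c + logKernel X T p = 0} = ∅ := by
      ext x
      simp [ht]
    change volume ((fun x => (x, t)) ⁻¹' _) = 0
    rw [this, measure_empty]

end LevelSet

/-! ### Differentiation in the radius -/

namespace IsStressBalance

open Filter Topology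

variable {n : ℕ} {e K w : Spacetime n → ℝ} {P : Fin n → Spacetime n → ℝ}
  {Q : Fin n → Fin n → Spacetime n → ℝ} {a T : ℝ} (hB : IsStressBalance e K w P Q a T)
  {X : EuclideanSpace ℝ (Fin n)} {R R₂ t₁ r : ℝ}

include hB

section

variable (hn : 4 < n) (hR : 0 < R) (hR₂ : R < R₂) (ht₁ : t₁ ∈ Ioo a T)
  (he : IntegrableOn e (Metric.ball X R₂ ×ˢ Ioo t₁ T)) (hr : 0 < r)
  (hsub : heatBall X T r ⊆ Metric.ball X R ×ˢ Ioo t₁ T)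

include hn hR hR₂ ht₁ he hr hsub

/-- The growth of the integral of the local density over heat balls. -/
lemma integral_localDensity_sub {ρ : ℝ} (hρ : 0 < ρ) (hρr : ρ ≤ r) :
    (∫ p in heatBall X T r, localDensity X T e P Q p) -
        ∫ p in heatBall X T ρ, localDensity X T e P Q p =
      ∫ p in heatBall X T r, (max (((n : ℝ) - 4) * Real.log r + logKernel X T p) 0 -
        max (((n : ℝ) - 4) * Real.log ρ + logKernel X T p) 0) * totalDensity X T e K w P p := by
  obtain ⟨g, b, B, hgd, hbc, hg0, hb0, hbB, hblim, hglim⟩ := exists_approx_posPart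
  set c := ((n : ℝ) - 4) * Real.log r with hc
  set d := ((n : ℝ) - 4) * Real.log ρ with hd
  have hdc : d ≤ c := mul_le_mul_of_nonneg_left (Real.log_le_log hρ hρr) (sub_four_pos hn).le
  have hB0 : 0 ≤ B := (abs_nonneg _).trans (hbB 0 0)
  have hmeasr := (isOpen_heatBall (X := X) (T := T) hr).measurableSet
  have hmeasρ := (isOpen_heatBall (X := X) (T := T) hρ).measurableSet
  have hL := hB.integrableOn_localDensity hn hR hR₂ ht₁ he hr hsub
  have hG := hB.integrableOn_totalDensity hn hR hR₂ ht₁ he hr hsub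
  have hgc : ∀ k, Continuous (g k) := fun k =>
    continuous_iff_continuousAt.mpr fun z => (hgd k z).continuousAt
  have hshift : ∀ k z, HasDerivAt (fun z => g k (z - (c - d))) (b k (z - (c - d))) z := fun k z => by
    simpa using (hgd k (z - (c - d))).comp_sub_const z (c - d)
  -- A single `g k` is unbounded along the kernel. Its difference with a translate is bounded
  -- uniformly in `k`, which makes it an admissible test function and allows dominated convergence.
  have hgdiff : ∀ k z, |g k z - g k (z - (c - d))| ≤ B * (c - d) := by
    intro k z
    have h := convex_univ.norm_image_sub_le_of_norm_hasDerivWithin_le (f := g k) (f' := b k)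
      (C := B) (fun x _ => (hgd k x).hasDerivWithinAt) (fun x _ => hbB k x)
      (mem_univ (z - (c - d))) (mem_univ z)
    rwa [sub_sub_cancel, Real.norm_eq_abs, Real.norm_of_nonneg (sub_nonneg.mpr hdc)] at h
  have hbdiff : ∀ k z, |b k z - b k (z - (c - d))| ≤ 2 * B := fun k z => by
    have h1 := abs_sub (b k z) (b k (z - (c - d)))
    linarith [hbB k z, hbB k (z - (c - d))]
  have hweak : ∀ k, ∫ p in heatBall X T r,
        (b k (c + logKernel X T p) - b k (c + logKernel X T p - (c - d))) *
          localDensity X T e P Q p =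
      ∫ p in heatBall X T r, (g k (c + logKernel X T p) - g k (c + logKernel X T p - (c - d))) *
        totalDensity X T e K w P p := fun k =>
    hB.integral_comp_logKernel_mul hn hR hR₂ ht₁ he hr hsub
      (f := fun z => g k z - g k (z - (c - d))) (f' := fun z => b k z - b k (z - (c - d)))
      (M := max (B * (c - d)) (2 * B))
      (fun z => (hgd k z).sub (hshift k z))
      ((hbc k).sub ((hbc k).comp (continuous_id.sub continuous_const)))
      (fun z hz => by rw [hg0 k z hz, hg0 k _ (by linarith), sub_zero])
      (fun z hz => by rw [hb0 k z hz, hb0 k _ (by linarith), sub_zero])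
      (fun z => (hgdiff k z).trans (le_max_left _ _))
      (fun z => (hbdiff k z).trans (le_max_right _ _))
  have hlimL : Tendsto (fun k => ∫ p in heatBall X T r,
        (b k (c + logKernel X T p) - b k (c + logKernel X T p - (c - d))) *
          localDensity X T e P Q p) atTop
      (𝓝 (∫ p in heatBall X T r, ((if 0 < c + logKernel X T p then 1 else 0) -
        (if 0 < c + logKernel X T p - (c - d) then 1 else 0)) * localDensity X T e P Q p)) := by
    refine tendsto_integral_of_dominated_convergence
      (fun p => 2 * B * ‖localDensity X T e P Q p‖) (fun k => ?_) (hL.norm.const_mul _)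
      (fun k => ae_of_all _ fun p => ?_) (ae_of_all _ fun p => ?_)
    · exact (integrableOn_comp_logKernel_mul ht₁.1 hr hsub
        ((hbc k).sub ((hbc k).comp (continuous_id.sub continuous_const))) (hbdiff k)
        (hB.continuousOn_localDensity X) hL c).aestronglyMeasurable
    · rw [norm_mul]
      exact mul_le_mul_of_nonneg_right (hbdiff k _) (norm_nonneg _)
    · exact ((hblim _).sub (hblim _)).mul_const _
  have hlimG : Tendsto (fun k => ∫ p in heatBall X T r,
        (g k (c + logKernel X T p) - g k (c + logKernel X T p - (c - d))) *
          totalDensity X T e K w P p) atTop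
      (𝓝 (∫ p in heatBall X T r, (max (c + logKernel X T p) 0 -
        max (c + logKernel X T p - (c - d)) 0) * totalDensity X T e K w P p)) := by
    refine tendsto_integral_of_dominated_convergence
      (fun p => B * (c - d) * ‖totalDensity X T e K w P p‖) (fun k => ?_) (hG.norm.const_mul _)
      (fun k => ae_of_all _ fun p => ?_) (ae_of_all _ fun p => ?_)
    · exact (integrableOn_comp_logKernel_mul ht₁.1 hr hsub
        ((hgc k).sub ((hgc k).comp (continuous_id.sub continuous_const))) (hgdiff k)
        (hB.continuousOn_totalDensity X) hG c).aestronglyMeasurable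
    · rw [norm_mul]
      exact mul_le_mul_of_nonneg_right (hgdiff k _) (norm_nonneg _)
    · exact ((hglim _).sub (hglim _)).mul_const _
  simp only [hweak] at hlimL
  -- In the limit the derivatives become indicators of the two heat balls, and the functions become
  -- positive parts.
  have heq := tendsto_nhds_unique hlimL hlimG
  have hcd : ∀ z, c + z - (c - d) = d + z := fun z => by ring
  simp only [hcd] at heq
  rw [← heq]
  have hρint : ∫ p in heatBall X T ρ, localDensity X T e P Q p =
      ∫ p in heatBall X T r, (heatBall X T ρ).indicator (localDensity X T e P Q) p := by
    rw [setIntegral_indicator hmeasρ, inter_eq_self_of_subset_right (heatBall_mono hn hρ hρr)]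
  rw [hρint, ← integral_sub hL (hL.indicator hmeasρ)]
  refine setIntegral_congr_fun hmeasr fun p hp => ?_
  have hp1 := (mem_heatBall_iff hr).mp hp
  have hp2 := mem_heatBall_iff (X := X) (T := T) (p := p) hρ
  rw [← hc] at hp1
  rw [← hd] at hp2
  simp only [if_pos hp1.2]
  by_cases hpρ : p ∈ heatBall X T ρ
  · rw [indicator_of_mem hpρ, if_pos (hp2.mp hpρ).2]
    ring
  · rw [indicator_of_notMem hpρ, if_neg fun h => hpρ (hp2.mpr ⟨hp1.1, h⟩)]
    ring

/-- The derivative of the integral of the local density over heat balls. -/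
lemma hasDerivAt_integral_localDensity {ρ : ℝ} (hρ : ρ ∈ Ioo 0 r) :
    HasDerivAt (fun s => ∫ p in heatBall X T s, localDensity X T e P Q p)
      (((n : ℝ) - 4) / ρ * ∫ p in heatBall X T ρ, totalDensity X T e K w P p) ρ := by
  have hm := sub_four_pos hn
  set m := (n : ℝ) - 4 with hmdef
  have hρ2 : 0 < ρ / 2 := half_pos hρ.1
  have hmeasr := (isOpen_heatBall (X := X) (T := T) hr).measurableSet
  have hmeasρ := (isOpen_heatBall (X := X) (T := T) hρ.1).measurableSet
  have hG := hB.integrableOn_totalDensity hn hR hR₂ ht₁ he hr hsub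
  have hnhds : Ioo (ρ / 2) r ∈ 𝓝 ρ := Ioo_mem_nhds (by linarith [hρ.1]) hρ.2
  -- A fixed reference radius `ρ/2` and the fixed domain of radius `r` confine the dependence on `s`
  -- to the integrand, which vanishes outside the ball of radius `s`.
  have hformula : ∀ s ∈ Ioo (ρ / 2) r, ∫ p in heatBall X T s, localDensity X T e P Q p =
      (∫ p in heatBall X T (ρ / 2), localDensity X T e P Q p) +
        ∫ p in heatBall X T r, (max (m * Real.log s + logKernel X T p) 0 -
          max (m * Real.log (ρ / 2) + logKernel X T p) 0) * totalDensity X T e K w P p := by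
    intro s hs
    have hs0 : 0 < s := hρ2.trans hs.1
    have hsr := heatBall_mono (X := X) (T := T) hn hs0 hs.2.le
    have h1 := hB.integral_localDensity_sub hn hR hR₂ ht₁ he hs0 (hsr.trans hsub) hρ2 hs.1.le
    rw [← hmdef] at h1
    rw [setIntegral_eq_of_subset_of_forall_sdiff_eq_zero hmeasr hsr fun p hp => ?_, ← h1]
    · ring
    · have h2 : m * Real.log s + logKernel X T p ≤ 0 := by
        by_contra h
        exact hp.2 ((mem_heatBall_iff hs0).mpr ⟨hp.1.1, not_le.mp h⟩)
      have h3 : m * Real.log (ρ / 2) ≤ m * Real.log s :=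
        mul_le_mul_of_nonneg_left (Real.log_le_log hρ2 hs.1.le) hm.le
      rw [max_eq_right h2, max_eq_right (by linarith), sub_zero, zero_mul]
  -- The positive part is 1-Lipschitz and the logarithm is Lipschitz above `ρ/2`, so dominated
  -- differentiation applies although the integrand has a kink.
  have hLip : ∀ (c : ℝ) (s s' : ℝ), s ∈ Ioo (ρ / 2) r → s' ∈ Ioo (ρ / 2) r →
      |max (m * Real.log s + c) 0 - max (m * Real.log s' + c) 0| ≤ m * (1 / (ρ / 2) * |s - s'|) := by
    intro c s s' hs hs'
    refine (abs_max_sub_max_le_abs _ _ _).trans ?_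
    rw [add_sub_add_right_eq_sub, ← mul_sub, abs_mul, abs_of_pos hm]
    exact mul_le_mul_of_nonneg_left (abs_log_sub_log_le hρ2 hs.1.le hs'.1.le) hm.le
  have hcont : ∀ s, Continuous fun z : ℝ =>
      max (m * Real.log s + z) 0 - max (m * Real.log (ρ / 2) + z) 0 := fun s => by fun_prop
  have hbound : ∀ s, ∀ z : ℝ, |max (m * Real.log s + z) 0 - max (m * Real.log (ρ / 2) + z) 0| ≤
      |m * Real.log s - m * Real.log (ρ / 2)| := fun s z => by
    refine (abs_max_sub_max_le_abs _ _ _).trans (le_of_eq ?_)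
    rw [add_sub_add_right_eq_sub]
  have hFint : ∀ s, IntegrableOn (fun p => (max (m * Real.log s + logKernel X T p) 0 -
      max (m * Real.log (ρ / 2) + logKernel X T p) 0) * totalDensity X T e K w P p)
      (heatBall X T r) := fun s => by
    simpa only [zero_add] using integrableOn_comp_logKernel_mul ht₁.1 hr hsub (hcont s) (hbound s)
      (hB.continuousOn_totalDensity X) hG 0
  have hderiv := (hasDerivAt_integral_of_dominated_loc_of_lip (μ := volume.restrict (heatBall X T r))
    (F := fun s p => (max (m * Real.log s + logKernel X T p) 0 -
      max (m * Real.log (ρ / 2) + logKernel X T p) 0) * totalDensity X T e K w P p)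
    (F' := fun p => m / ρ * (heatBall X T ρ).indicator (totalDensity X T e K w P) p)
    (bound := fun p => m * (1 / (ρ / 2)) * ‖totalDensity X T e K w P p‖) (x₀ := ρ)
    hnhds (Eventually.of_forall fun s => (hFint s).aestronglyMeasurable) (hFint ρ)
    ((hG.indicator hmeasρ).const_mul _).aestronglyMeasurable
    (ae_of_all _ fun p => ?_) (hG.norm.const_mul _) ?_).2
  · have hsm : ∫ p in heatBall X T r, m / ρ * (heatBall X T ρ).indicator
        (totalDensity X T e K w P) p = m / ρ * ∫ p in heatBall X T ρ, totalDensity X T e K w P p := by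
      rw [integral_const_mul, setIntegral_indicator hmeasρ,
        inter_eq_self_of_subset_right (heatBall_mono hn hρ.1 hρ.2.le)]
    rw [hsm] at hderiv
    refine (hderiv.const_add
      (∫ p in heatBall X T (ρ / 2), localDensity X T e P Q p)).congr_of_eventuallyEq ?_
    filter_upwards [hnhds] with s hs
    exact hformula s hs
  · refine LipschitzOnWith.of_dist_le_mul fun s hs s' hs' => ?_
    have hb0 : 0 ≤ m * (1 / (ρ / 2)) * ‖totalDensity X T e K w P p‖ := by positivity
    rw [Real.dist_eq, Real.dist_eq, Real.coe_nnabs, abs_of_nonneg hb0, ← sub_mul,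
      sub_sub_sub_cancel_right, abs_mul, ← Real.norm_eq_abs (totalDensity X T e K w P p)]
    calc _ ≤ m * (1 / (ρ / 2) * |s - s'|) * ‖totalDensity X T e K w P p‖ := by
          gcongr
          exact hLip _ s s' hs hs'
      _ = _ := by ring
  · have hnull : ∀ᵐ p ∂(volume.restrict (heatBall X T r)),
        ¬ (p.2 < T ∧ m * Real.log ρ + logKernel X T p = 0) :=
      ae_restrict_of_ae (measure_eq_zero_iff_ae_notMem.mp
        (volume_logKernel_level_eq_zero hn X T (m * Real.log ρ)))
    filter_upwards [hnull, ae_restrict_mem hmeasr] with p hp hpr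
    have hlog : HasDerivAt (fun s => m * Real.log s + logKernel X T p) (m * ρ⁻¹) ρ :=
      ((Real.hasDerivAt_log hρ.1.ne').const_mul m).add_const _
    classical
    have hmax : HasDerivAt (fun s => max (m * Real.log s + logKernel X T p) 0)
        (if p ∈ heatBall X T ρ then m / ρ else 0) ρ := by
      split_ifs with h
      · have h1 := ((mem_heatBall_iff hρ.1).mp h).2
        refine (hlog.congr_of_eventuallyEq ?_)
        filter_upwards [hlog.continuousAt.eventually (lt_mem_nhds h1)] with s hs
        exact max_eq_left hs.le
      · have h1 : m * Real.log ρ + logKernel X T p < 0 := by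
          refine lt_of_le_of_ne (not_lt.mp fun h' => ?_) fun h' => hp ⟨hpr.1, h'⟩
          exact h ((mem_heatBall_iff hρ.1).mpr ⟨hpr.1, h'⟩)
        refine (hasDerivAt_const ρ (0 : ℝ)).congr_of_eventuallyEq ?_
        filter_upwards [hlog.continuousAt.eventually (gt_mem_nhds h1)] with s hs
        exact max_eq_right hs.le
    have h2 := (hmax.sub_const (max (m * Real.log (ρ / 2) + logKernel X T p) 0)).mul_const
      (totalDensity X T e K w P p)
    refine h2.congr_deriv ?_
    by_cases h : p ∈ heatBall X T ρ
    · rw [if_pos h, indicator_of_mem h]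
    · rw [if_neg h, indicator_of_notMem h, mul_zero, zero_mul]

end

/-- The dissipation, flux and stress terms form the nonnegative quadratic form at `s = 1` and `v`
the drift. -/
lemma growthDensity_nonneg {p : Spacetime n} (hp : p.2 < T) : 0 ≤ growthDensity X T K w P Q p := by
  have h := hB.form_nonneg p 1 (drift X T p)
  have h2 : 0 ≤ w p / (2 * (T - p.2)) :=
    div_nonneg (hB.w_nonneg p) (by linarith [sub_pos.mpr hp])
  rw [growthDensity]
  linarith

/-- The local monotonicity formula. -/
theorem local_monotonicity (hn : 4 < n) {r₀ : ℝ} (hr₀ : 0 < r₀)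
    (ha : a ≤ T - r₀ ^ 2 / (4 * Real.pi))
    (he : IntegrableOn e (Metric.ball X (2 * cConst n * r₀) ×ˢ
      Ioo (T - r₀ ^ 2 / (4 * Real.pi)) T)) {r : ℝ} (hr : r ∈ Ioo 0 r₀) :
    IntegrableOn (localDensity X T e P Q) (heatBall X T r) ∧
    IntegrableOn (growthDensity X T K w P Q) (heatBall X T r) ∧
    HasDerivAt (fun s : ℝ => 1 / s ^ ((n : ℝ) - 4) *
        ∫ p in heatBall X T s, localDensity X T e P Q p)
      (((n : ℝ) - 4) / r ^ ((n : ℝ) - 3) *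
        ∫ p in heatBall X T r, growthDensity X T K w P Q p) r ∧
    0 ≤ ((n : ℝ) - 4) / r ^ ((n : ℝ) - 3) *
        ∫ p in heatBall X T r, growthDensity X T K w P Q p := by
  have hm := sub_four_pos hn
  -- The larger radius `r₁` leaves room to differentiate at `r`. The time `t₁` chosen next precedes
  -- the heat ball of radius `r₁` and lies strictly after `a`, inside the open slab where the
  -- balance laws hold.
  obtain ⟨r₁, hrr₁, hr₁r₀⟩ := exists_between hr.2
  have hr₁0 : 0 < r₁ := hr.1.trans hrr₁
  have hsq : r₁ ^ 2 / (4 * Real.pi) < r₀ ^ 2 / (4 * Real.pi) := by gcongr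
  obtain ⟨t₁, ht₀, ht₁⟩ := exists_between (sub_lt_sub_left hsq T)
  have ht₁T : t₁ < T := ht₁.trans (sub_lt_self T (by positivity))
  have hc : 0 < cConst n := Real.sqrt_pos.mpr (by positivity)
  have hR : 0 < cConst n * r₀ := by positivity
  have hR₂ : cConst n * r₀ < 2 * cConst n * r₀ := by linarith
  have ht₁I : t₁ ∈ Ioo a T := ⟨ha.trans_lt ht₀, ht₁T⟩
  have he' : IntegrableOn e (Metric.ball X (2 * cConst n * r₀) ×ˢ Ioo t₁ T) :=
    he.mono_set (prod_mono le_rfl (Ioo_subset_Ioo_left ht₀.le))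
  have hsub₁ : heatBall X T r₁ ⊆ Metric.ball X (cConst n * r₀) ×ˢ Ioo t₁ T :=
    (heatBall_subset hn hr₁0).trans (prod_mono
      (Metric.ball_subset_ball (mul_le_mul_of_nonneg_left hr₁r₀.le hc.le))
      (Ioo_subset_Ioo_left ht₁.le))
  have hsub := (heatBall_mono hn hr.1 hrr₁.le).trans hsub₁
  have hL := hB.integrableOn_localDensity hn hR hR₂ ht₁I he' hr.1 hsub
  have hG := hB.integrableOn_totalDensity hn hR hR₂ ht₁I he' hr.1 hsub
  have hGL : IntegrableOn (growthDensity X T K w P Q) (heatBall X T r) :=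
    (hG.sub hL).congr (ae_of_all _ fun p => totalDensity_sub_localDensity X T e K w P Q p)
  have hint : ∫ p in heatBall X T r, growthDensity X T K w P Q p =
      (∫ p in heatBall X T r, totalDensity X T e K w P p) -
        ∫ p in heatBall X T r, localDensity X T e P Q p := by
    rw [← integral_sub hG hL]
    simp only [totalDensity_sub_localDensity]
  have hI := hB.hasDerivAt_integral_localDensity hn hR hR₂ ht₁I he' hr₁0 hsub₁ ⟨hr.1, hrr₁⟩
  refine ⟨hL, hGL, ?_, ?_⟩
  · have hpow : HasDerivAt (fun s : ℝ => 1 / s ^ ((n : ℝ) - 4))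
        (-((n : ℝ) - 4) / r ^ ((n : ℝ) - 3)) r := by
      have h1 := Real.hasDerivAt_rpow_const (x := r) (p := -((n : ℝ) - 4)) (Or.inl hr.1.ne')
      have h2 : -((n : ℝ) - 4) / r ^ ((n : ℝ) - 3) =
          -((n : ℝ) - 4) * r ^ (-((n : ℝ) - 4) - 1) := by
        rw [div_eq_mul_inv, ← Real.rpow_neg hr.1.le]
        ring_nf
      rw [h2]
      refine h1.congr_of_eventuallyEq ?_
      filter_upwards [Ioi_mem_nhds hr.1] with s hs
      rw [Real.rpow_neg (le_of_lt hs), one_div]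
    -- The derivative of `r⁻ᵐ` subtracts the local density from the total density, leaving the
    -- growth density.
    refine (hpow.mul hI).congr_deriv ?_
    have h3 : r ^ ((n : ℝ) - 3) = r ^ ((n : ℝ) - 4) * r := by
      rw [← Real.rpow_add_one hr.1.ne']
      ring_nf
    have h4 : 0 < r ^ ((n : ℝ) - 4) := Real.rpow_pos_of_pos hr.1 _
    have h5 := hr.1
    rw [hint, h3]
    field_simp
    ring
  · refine mul_nonneg (div_nonneg hm.le (Real.rpow_nonneg hr.1.le _)) ?_
    exact setIntegral_nonneg (isOpen_heatBall hr.1).measurableSet fun p hp =>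
      hB.growthDensity_nonneg hp.1

end IsStressBalance

end YMH

end

theorem theorem3p3
    {E : Type*} [NormedAddCommGroup E] [NormedSpace ℝ E] [FiniteDimensional ℝ E]
    {G : Type*} [TopologicalSpace G] [T2Space G] [CompactSpace G] [ConnectedSpace G]
    [ChartedSpace E G] [Group G] [LieGroup 𝓘(ℝ, E) ∞ G]
    [LieAlgebra.IsSemisimple ℝ (GroupLieAlgebra 𝓘(ℝ, E) G)]
    {V : Type*} [NormedAddCommGroup V] [InnerProductSpace ℝ V] [FiniteDimensional ℝ V]
    (ρ : G →* (V →L[ℝ] V))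
    (hρ_smooth : ContMDiff 𝓘(ℝ, E) 𝓘(ℝ, V →L[ℝ] V) ∞ (fun g : G => ρ g))
    (hρ_inv : ∀ (g : G) (v w : V), inner ℝ (ρ g v) (ρ g w) = inner ℝ v w)
    (W : ℝ → ℝ) (hW : ContDiff ℝ 1 W) (hW_nonneg : ∀ s, 0 ≤ W s)
    {n : ℕ} (hn : 4 < n) (X : EuclideanSpace ℝ (Fin n)) (a T : ℝ)
    (A : Fin n → YMH.Spacetime n → E) (u : YMH.Spacetime n → V)
    (hflow : YMH.IsYMHFlow ρ W A u a T)
    (r₀ : ℝ) (hr₀ : 0 < r₀) (hr₀_le : r₀ ≤ √(4 * Real.pi * (T - a)))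
    (he : IntegrableOn (YMH.energyDensity ρ W A u)
      (Metric.ball X (2 * YMH.cConst n * r₀) ×ˢ Ioo (T - r₀ ^ 2 / (4 * Real.pi)) T)) :
    ∀ r ∈ Ioo 0 r₀,
      IntegrableOn (YMH.lhsIntegrand ρ W X T A u) (YMH.heatBall X T r) ∧
      IntegrableOn (YMH.rhsIntegrand ρ W X T A u) (YMH.heatBall X T r) ∧
      HasDerivAt
        (fun s : ℝ => 1 / s ^ ((n : ℝ) - 4) *
          ∫ p in YMH.heatBall X T s, YMH.lhsIntegrand ρ W X T A u p)
        (((n : ℝ) - 4) / r ^ ((n : ℝ) - 3) *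
          ∫ p in YMH.heatBall X T r, YMH.rhsIntegrand ρ W X T A u p) r ∧
      0 ≤ ((n : ℝ) - 4) / r ^ ((n : ℝ) - 3) *
          ∫ p in YMH.heatBall X T r, YMH.rhsIntegrand ρ W X T A u p := by
  intro r hr
  have hB := YMH.isStressBalance hρ_smooth hρ_inv hW hW_nonneg hflow
  have hpos : 0 < √(4 * Real.pi * (T - a)) := hr₀.trans_le hr₀_le
  have hTa : 0 < 4 * Real.pi * (T - a) := Real.sqrt_pos.mp hpos
  have ha : a ≤ T - r₀ ^ 2 / (4 * Real.pi) := by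
    have h1 : r₀ ^ 2 ≤ 4 * Real.pi * (T - a) := by
      rw [← Real.sq_sqrt hTa.le]
      gcongr
    have h2 : r₀ ^ 2 / (4 * Real.pi) ≤ T - a := by
      rw [div_le_iff₀ (by positivity)]
      linarith
    linarith
  -- Expanding the squares expresses both integrands through energy, dissipation, flux and stress,
  -- so the abstract formula applies.
  have hL : YMH.lhsIntegrand ρ W X T A u = YMH.localDensity X T (YMH.energyDensity ρ W A u)
      (YMH.energyFlux ρ A u) (YMH.stress ρ A u) :=
    funext fun p => YMH.lhsIntegrand_eq hρ_smooth hρ_inv X T p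
  have hR : YMH.rhsIntegrand ρ W X T A u = YMH.growthDensity X T (YMH.dissipation G A u)
      (YMH.scalarDensity ρ W A u) (YMH.energyFlux ρ A u) (YMH.stress ρ A u) :=
    funext fun p => YMH.rhsIntegrand_eq hρ_smooth hρ_inv X T p
  rw [hL, hR]
  exact hB.local_monotonicity hn hr₀ ha he hr
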